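/- **Setting.** Let $X,Y$ be real or complex Banach spaces, $A,B$ closed densely defined linear operators from $X$ to $Y$ with domains $D_A\subseteq D_B$, $D:=D_A$ (with the norm of $X$), $\mathrm{range}\,A$ closed, $\mathbb R_+=[0,\infty)$ and $f\in C(\mathbb R_+\times D,Y)$. Consider $$\tfrac{d}{dt}[Ax]+Bx=f(t,x),\qquad t>0. \tag{1}$$ Let $\lambda A+B$ be a regular pencil of index $\nu$: every $\lambda\in\mathbb C$ with $|\lambda|$ large has a bounded resolvent $R(\lambda)=(\lambda A+B)^{-1}\in L(Y,X)$, and $\nu$ is the least nonnegative integer with $\|R(\lambda)\|\le C|\lambda|^{\nu-1}$ for some $C$ and all large $|\lambda|$ (i.e. $(A+\mu B)^{-1}$ has a pole of order $\nu$ at $\mu=0$; $\nu=0$ means that $A$ is boundedly invertible); for real spaces this is understood for the complexifications. Let $\dim\ker A=n<\infty$, and let $\varphi_i^j\in D$, $q_i^j\in Y^*$, $p_i^j\in X^*$ ($1\le i\le n$, $1\le j\le m_i$, $\max_i m_i=\nu$) be a canonical system with its biorthogonal system: $\{\varphi_i^1\}$ is a basis of $\ker A$; $A\varphi_i^{j}=-B\varphi_i^{j-1}$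 for $j\ge2$; $p_i^j=B^*q_i^j$, i.e. $\langle x,p_i^j\rangle=\langle Bx,q_i^j\rangle$ on $D$; $A^*q_i^{m_i}=0$, $A^*q_i^j=-B^*q_i^{j+1}$ for $j<m_i$; $\langle B\varphi_i^j,q_k^l\rangle=\delta_{ik}\delta_{jl}$. For a set $T$ of pairs $(i,j)$ put $P_Tx=\sum_{(i,j)\in T}\langle x,p_i^j\rangle\varphi_i^j$, $Q_Ty=\sum_{(i,j)\in T}\langle y,q_i^j\rangle B\varphi_i^j$, $D_T=\mathrm{span}\{\varphi_i^j:(i,j)\in T\}$, $Y_T=BD_T$. The indices below stand for the following sets $T$: $20$: $j=1$; $2\Sigma$: $j\ge2$; ${}_{2s}^{(s+1)}$ for $P,Q,D,Y$: $j=s+1=m_i$; ${}_{2\wedge,s}$ for $P,D$ and ${}_{2\Sigma,s}$ for $Q,Y$: $j=s+1$, $m_i\ge s+2$. With all pairs one gets $P_2,Q_2$; $P_1=I-P_2$, $Q_1=I-Q_2$, $D_1=P_1D$, $Y_1=Q_1Y$. Let $\widetilde A=A+\sum_i\langle\cdot,p_i^1\rangle B\varphi_i^{m_i}$, a bijection of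 $D$ onto $Y$ mapping $D_1$ onto $Y_1$. Write $x_1=P_1x$, $x_{2s}^{(s+1)}=P_{2s}^{(s+1)}x$, $x_{2\wedge,s}=P_{2\wedge,s}x$. Empty sums are zero; conditions indexed by an empty range of $s$ are void. Derivatives and smoothness are in the real Fréchet sense, one-sided in $t$ at $t=0$. **Structure of $f$.** For all $t\ge0$, $x\in D$, $$f(t,x)=(Q_1+Q_{20})f(t,x)+\sum_{s=1}^{\nu-2}Q_{2\Sigma,s}f\Big(t,\sum_{j=1}^{\nu-1}x_{2j}^{(j+1)}+\sum_{j=s}^{\nu-2}x_{2\wedge,j}\Big)+\sum_{s=1}^{\nu-1}Q_{2s}^{(s+1)}f\Big(t,\sum_{j=s}^{\nu-1}x_{2j}^{(j+1)}\Big).$$ **Regions and smoothness.** Let $M_{20}\subseteq D_{20}$, $M_{2j}^{(j+1)}\subseteq D_{2j}^{(j+1)}$ ($1\le j\le\nu-1$), $M_{2\wedge,j}\subseteq D_{2\wedge,j}$ ($1\le j\le\nu-2$) be relatively open, $M_{2\Sigma}=\sum_{j=1}^{\nu-1}M_{2j}^{(j+1)}+\sum_{j=1}^{\nu-2}M_{2\wedge,j}$,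 $M=D_1+M_{20}+M_{2\Sigma}$. Assume $Q_{2s}^{(s+1)}f$ is of class $C^{\nu-2}$ on $\mathbb R_+\times\sum_{j=s}^{\nu-1}M_{2j}^{(j+1)}$ and $Q_{2\Sigma,s}f$ of class $C^s$ on $\mathbb R_+\times\big(\sum_{j=1}^{\nu-1}M_{2j}^{(j+1)}+\sum_{i=s}^{\nu-2}M_{2\wedge,i}\big)$ for $1\le s\le\nu-2$, and, if $\nu\ge2$, $Q_{2(\nu-1)}^{(\nu)}f$ of class $C^{\nu-1}$ on $\mathbb R_+\times M_{2(\nu-1)}^{(\nu)}$. Put $$F_{2s}^{(s+1)}=Q_{2s}^{(s+1)}f\Big(t,\sum_{j=s}^{\nu-1}x_{2j}^{(j+1)}\Big)-Bx_{2s}^{(s+1)}\quad(1\le s\le\nu-1),$$ $$F_{2\Sigma,s}=Q_{2\Sigma,s}f\Big(t,\sum_{j=1}^{\nu-1}x_{2j}^{(j+1)}+\sum_{i=s}^{\nu-2}x_{2\wedge,i}\Big)-Bx_{2\wedge,s}-A[d+d']\quad(1\le s\le\nu-2,\ d\in D_{2(s+1)}^{(s+2)},\ d'\in D_{2\wedge,s+1}),$$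 $$F_{20}=Q_{20}f(t,x_1+x_{20}+x_{2\Sigma})-Bx_{20}-Q_{20}A[d+d']\quad(d\in D_{21}^{(2)},\ d'\in D_{2\wedge,1}).$$ **Unique solvability.** For all $t\ge0$ and all values of the other arguments ($x_1\in D_1$, the components of $x$ in the sets $M$ with the same indices, $x_{2\Sigma}\in M_{2\Sigma}$, and $d,d'$ in the subspaces indicated): $F_{2s}^{(s+1)}=0$ has a unique solution $x_{2s}^{(s+1)}\in M_{2s}^{(s+1)}$ ($1\le s\le\nu-1$); $F_{2\Sigma,s}=0$ a unique solution $x_{2\wedge,s}\in M_{2\wedge,s}$ ($1\le s\le\nu-2$); $F_{20}=0$ a unique solution $x_{20}\in M_{20}$. **Invertibility.** At every such zero, $\partial F_{2s}^{(s+1)}/\partial x_{2s}^{(s+1)}\colon D_{2s}^{(s+1)}\to Y_{2s}^{(s+1)}$, resp. $\partial F_{2\Sigma,s}/\partial x_{2\wedge,s}\colon D_{2\wedge,s}\to Y_{2\Sigma,s}$, has a bounded inverse. Moreover one of the following holds. (L) $Q_1f$ and $Q_{20}f$ are locally Lipschitz with respect to $x_1+x_{20}$ on $\mathbb R_+\times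 M$ (locally uniformly in $t$ and $x_{2\Sigma}$), and for each zero $(\hat t,\hat x_1,\hat x_{20},\hat x_{2\Sigma},\hat d,\hat d')$ of $F_{20}$ with $\hat t\ge0$, $\hat x_1\in D_1$, $\hat x_{20}\in M_{20}$, $\hat x_{2\Sigma}\in M_{2\Sigma}$, $\hat d\in D_{21}^{(2)}$, $\hat d'\in D_{2\wedge,1}$ there are a bounded operator $Z\colon D_{20}\to Y_{20}$ with bounded inverse and a function $k(\delta,\varepsilon)$ with $\lim_{\delta,\varepsilon\to0}k(\delta,\varepsilon)<\|Z^{-1}\|^{-1}$ such that for all small $\delta,\varepsilon>0$ $$\|F_{20}(t,x_1,x_{20}',x_{2\Sigma},d,d')-F_{20}(t,x_1,x_{20}'',x_{2\Sigma},d,d')-Z[x_{20}'-x_{20}'']\|\le k(\delta,\varepsilon)\|x_{20}'-x_{20}''\|$$ whenever $t\ge0$, $x_1\in D_1$, $x_{2\Sigma}\in D_{2\Sigma}$, $d\in D_{21}^{(2)}$, $d'\in D_{2\wedge,1}$ are $\delta$-close to $\hat t,\hat x_1,\hat x_{2\Sigma},\hat d,\hat d'$ and $x_{20}',x_{20}''\in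 D_{20}$ are $\varepsilon$-close to $\hat x_{20}$. (S) $Q_1f$ and $Q_{20}f$ have continuous partial derivatives with respect to $x$ on $\mathbb R_+\times M$, and at each such zero of $F_{20}$ the operator $\partial F_{20}/\partial x_{20}\colon D_{20}\to Y_{20}$ has a bounded inverse. **Boundedness.** For all $a_1,a_2>0$: $\ \sup\{\|Q_1f(t,x)\|: t\in[0,a_1],\ x\in M,\ \|x_1\|\le a_2\}<\infty$. **Lyapunov condition.** There are $R>0$, $U\in C(\mathbb R_+,\mathbb R_+)$ with $\int_{u_0}^\infty du/U(u)=\infty$ for all $u_0>0$ (where $1/0=\infty$), $\psi\colon\mathbb R_+\to\mathbb R_+$ integrable on finite intervals, and $V\in C(Y_1,\mathbb R_+)$ with $V(w_1)\to\infty$ as $\|w_1\|\to\infty$ such that one of the following holds. (i) $V=\max_{1\le i\le m}V_i$ with $V_i\in C(Y_1,\mathbb R_+)$ continuously differentiable on $\{\|w_1\|\ge R\}$, and for each $w_1\in Y_1$ with $\|w_1\|\ge R$ there is an index $j$ with $V(w_1)=V_j(w_1)$ such that for all $t\ge0$, $x_{20}\in M_{20}$, $x_{2\Sigma}\in M_{2\Sigma}$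 $$\big\langle Q_1f(t,\widetilde A^{-1}w_1+x_{20}+x_{2\Sigma})-Q_1B\widetilde A^{-1}w_1,\ \partial V_j(w_1)\big\rangle\le U(V(w_1))\psi(t).$$ (ii) $V$ is Lipschitz on $\{w_1\in Y_1:\|w_1\|\ge R\}$ and for all $w_1\in Y_1$ with $\|w_1\|\ge R$, $t\ge0$, $x_{20}\in M_{20}$, $x_{2\Sigma}\in M_{2\Sigma}$ $$\big\|Q_1f(t,\widetilde A^{-1}w_1+x_{20}+x_{2\Sigma})-Q_1B\widetilde A^{-1}w_1\big\|\le U(V(w_1))\psi(t).$$ **Conclusion.** For each $t_0\ge0$ and $x_{0,1}\in D_1$ there is a unique global solution $x$ of (1) on $[t_0,\infty)$ in $M$ with $P_1x(t_0)=x_{0,1}$; moreover every solution in $M$ on an interval $[t_0,T)$, $T>t_0$, with the same initial condition coincides with $x$ there. Here a solution on $J$ is a function $x\in C(J,X)$ with values in $D$ such that $Ax\in C^1(J\cap(0,\infty),Y)$ and (1) holds at every $t\in J$, $t>0$; it is in $M$ if $x(t)\in M$ for all $t\in J$. -/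

import Mathlib

open Set Filter Topology MeasureTheory

namespace ADAE

section Operators

variable (𝕜 X Y : Type*) [RCLike 𝕜] [NormedAddCommGroup X] [NormedSpace 𝕜 X]
  [NormedAddCommGroup Y] [NormedSpace 𝕜 Y]

/-- The pair of linear operators `A`, `B` from `X` to `Y`: both closed and densely defined,
`A` with closed range, and `D_A ⊆ D_B`. -/
structure OperatorPair where
  A : X →ₗ.[𝕜] Y
  B : X →ₗ.[𝕜] Y
  closed_A : A.IsClosed
  closed_B : B.IsClosed
  dense_A : Dense (A.domain : Set X)
  dense_B : Dense (B.domain : Set X)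
  closed_range_A : IsClosed (LinearMap.range A.toFun : Set Y)
  domain_le : A.domain ≤ B.domain

end Operators

section Pencil

variable {𝕜 X Y : Type*} [RCLike 𝕜] [NormedAddCommGroup X] [NormedSpace 𝕜 X]
  [NormedAddCommGroup Y] [NormedSpace 𝕜 Y]

/-- The common domain `D = D_A`, with the norm of `X`. -/
abbrev OperatorPair.D (E : OperatorPair 𝕜 X Y) : Submodule 𝕜 X := E.A.domain

/-- `A` as a linear map on `D`. -/
def OperatorPair.opA (E : OperatorPair 𝕜 X Y) : E.D →ₗ[𝕜] Y := E.A.toFun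

/-- The restriction of `B` to `D`. -/
def OperatorPair.opB (E : OperatorPair 𝕜 X Y) : E.D →ₗ[𝕜] Y :=
  E.B.toFun ∘ₗ Submodule.inclusion E.domain_le

/-- For a complex pair: `l` is a regular point of the pencil `l A + B : D → Y`, and its resolvent
`R(l) ∈ L(Y, X)` has norm at most `C`. -/
def OperatorPair.ResolventBoundComplex (E : OperatorPair 𝕜 X Y) (l : ℂ) (C : ℝ) : Prop :=
  ∃ R : Y →L[𝕜] X, ‖R‖ ≤ C ∧
    (∀ x : E.D, R (((l.re : 𝕜) + (l.im : 𝕜) * RCLike.I) • E.opA x + E.opB x) = x) ∧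
    (∀ y : Y, ∃ x : E.D, (x : X) = R y ∧
      ((l.re : 𝕜) + (l.im : 𝕜) * RCLike.I) • E.opA x + E.opB x = y)

/-- For a real pair: `l = a + b i` is a regular point of the complexified pencil, and the
resolvent of the latter has norm at most `C`. An element `u + i v` of a complexification is
written as the pair `(u, v)`, so that the complexified `l A + B` sends it to the pair
`(a A u - b A v + B u, b A u + a A v + B v)`. -/
def OperatorPair.ResolventBoundReal (E : OperatorPair 𝕜 X Y) (l : ℂ) (C : ℝ) : Prop :=
  ∃ R : (Y × Y) →L[𝕜] (X × X), ‖R‖ ≤ C ∧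
    (∀ u v : E.D,
      R ((l.re : 𝕜) • E.opA u - (l.im : 𝕜) • E.opA v + E.opB u,
         (l.im : 𝕜) • E.opA u + (l.re : 𝕜) • E.opA v + E.opB v) = ((u : X), (v : X))) ∧
    (∀ y : Y × Y, ∃ u v : E.D, ((u : X), (v : X)) = R y ∧
      (l.re : 𝕜) • E.opA u - (l.im : 𝕜) • E.opA v + E.opB u = y.1 ∧
      (l.im : 𝕜) • E.opA u + (l.re : 𝕜) • E.opA v + E.opB v = y.2)

/-- `l` is a regular point of the pencil and its resolvent has norm at most `C`; the field `𝕜`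
is real exactly when its imaginary unit `RCLike.I` vanishes. -/
def OperatorPair.ResolventBound (E : OperatorPair 𝕜 X Y) (l : ℂ) (C : ℝ) : Prop :=
  ((RCLike.I : 𝕜) = 0 → E.ResolventBoundReal l C) ∧
  ((RCLike.I : 𝕜) ≠ 0 → E.ResolventBoundComplex l C)

/-- `l A + B` is a regular pencil of index `ν`: all `l` in a neighbourhood of infinity are regular
points, and `ν` is the least natural number with `‖R(l)‖ ≤ C |l| ^ (ν - 1)` near infinity, that is
`(A + μ B)⁻¹` has a pole of order `ν` at `μ = 0` (`ν = 0`: `A` is boundedly invertible). -/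
def OperatorPair.IsRegularOfIndex (E : OperatorPair 𝕜 X Y) (ν : ℕ) : Prop :=
  IsLeast {k : ℕ | ∃ C r : ℝ, 0 < r ∧
    ∀ l : ℂ, r ≤ ‖l‖ → E.ResolventBound l (C * ‖l‖ ^ ((k : ℤ) - 1))} ν

/-- A canonical system of eigenvectors and adjoined vectors of `A + μ B` at `μ = 0`, together with
the biorthogonal system of functionals. `φ i s` is the adjoined vector of order `s` (the
eigenvector, for `s = 0`) of the `i`-th chain, which has length `m i`; only `s < m i` matters.
`p i s` is the functional `B* (q i s)`. -/
structure RootSystem (E : OperatorPair 𝕜 X Y) (ν : ℕ) where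
  n : ℕ
  m : Fin n → ℕ
  φ : Fin n → ℕ → E.D
  q : Fin n → ℕ → (Y →L[𝕜] 𝕜)
  p : Fin n → ℕ → (X →L[𝕜] 𝕜)
  one_le_m : ∀ i, 1 ≤ m i
  max_m : Finset.univ.sup m = ν
  linearIndependent_eigenvectors : LinearIndependent 𝕜 (fun i => φ i 0)
  span_eigenvectors : Submodule.span 𝕜 (Set.range fun i => φ i 0) = LinearMap.ker E.opA
  chain : ∀ i s, s + 1 < m i → E.opA (φ i (s + 1)) = - E.opB (φ i s)
  p_eq : ∀ i s, s < m i → ∀ x : E.D, p i s (x : X) = q i s (E.opB x)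
  adjoint_last : ∀ i (x : E.D), q i (m i - 1) (E.opA x) = 0
  adjoint_chain : ∀ i s, s + 1 < m i → ∀ x : E.D, q i s (E.opA x) = - p i (s + 1) (x : X)
  biorthogonal : ∀ i s, s < m i → ∀ k l, l < m k →
    q k l (E.opB (φ i s)) = if i = k ∧ s = l then 1 else 0

namespace RootSystem

variable {E : OperatorPair 𝕜 X Y} {ν : ℕ} (S : RootSystem E ν)

open Classical in
/-- The partial sum, over the pairs `(i, r)`, `r < m i`, with `T i r`, of the projector
`x ↦ ∑ ⟨x, p i r⟩ φ i r` (on `D`). -/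
noncomputable def projD (T : Fin S.n → ℕ → Prop) : E.D →ₗ[𝕜] E.D :=
  ∑ i, ∑ r ∈ (Finset.range (S.m i)).filter (T i),
    ((S.p i r : X →ₗ[𝕜] 𝕜) ∘ₗ E.D.subtype).smulRight (S.φ i r)

open Classical in
/-- The partial sum, over the pairs `(i, r)`, `r < m i`, with `T i r`, of the projector
`y ↦ ∑ ⟨y, q i r⟩ B φ i r` (on `Y`). -/
noncomputable def projY (T : Fin S.n → ℕ → Prop) : Y →ₗ[𝕜] Y :=
  ∑ i, ∑ r ∈ (Finset.range (S.m i)).filter (T i),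
    (S.q i r : Y →ₗ[𝕜] 𝕜).smulRight (E.opB (S.φ i r))

/-- The span of the root vectors `φ i r`, `r < m i`, with `T i r`. -/
def spanD (T : Fin S.n → ℕ → Prop) : Submodule 𝕜 E.D :=
  Submodule.span 𝕜 {x | ∃ i r, r < S.m i ∧ T i r ∧ x = S.φ i r}

/-- The image under `B` of the span of the root vectors `φ i r`, `r < m i`, with `T i r`. -/
def spanY (T : Fin S.n → ℕ → Prop) : Submodule 𝕜 Y := (S.spanD T).map E.opB

/-- Index set of all root vectors. -/
def all : Fin S.n → ℕ → Prop := fun _ _ => True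
/-- Index set of the eigenvectors. -/
def eig : Fin S.n → ℕ → Prop := fun _ r => r = 0
/-- Index set of the adjoined vectors. -/
def adj : Fin S.n → ℕ → Prop := fun _ r => 1 ≤ r
/-- Index set of the vectors of order `s` at the end of a chain of length `s + 1`. -/
def last (s : ℕ) : Fin S.n → ℕ → Prop := fun i r => r = s ∧ S.m i = s + 1
/-- Index set of the vectors of order `s` in the chains of length at least `s + 2`. -/
def inner (s : ℕ) : Fin S.n → ℕ → Prop := fun i r => r = s ∧ s + 2 ≤ S.m i

/-- `P₁ = I - P₂`. -/
noncomputable def P1 : E.D →ₗ[𝕜] E.D := LinearMap.id - S.projD S.all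
/-- `P_{2Σ}`. -/
noncomputable def P2Sigma : E.D →ₗ[𝕜] E.D := S.projD S.adj
/-- `P_{2s}^{(s+1)}`. -/
noncomputable def PLast (s : ℕ) : E.D →ₗ[𝕜] E.D := S.projD (S.last s)
/-- `P_{2∧,s}`. -/
noncomputable def PWedge (s : ℕ) : E.D →ₗ[𝕜] E.D := S.projD (S.inner s)

/-- `Q₁ = I - Q₂`. -/
noncomputable def Q1 : Y →ₗ[𝕜] Y := LinearMap.id - S.projY S.all
/-- `Q_{20}`. -/
noncomputable def Q20 : Y →ₗ[𝕜] Y := S.projY S.eig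
/-- `Q_{2s}^{(s+1)}`. -/
noncomputable def QLast (s : ℕ) : Y →ₗ[𝕜] Y := S.projY (S.last s)
/-- `Q_{2Σ,s}`. -/
noncomputable def QSigma (s : ℕ) : Y →ₗ[𝕜] Y := S.projY (S.inner s)

/-- `D₁ = P₁ D`. -/
noncomputable abbrev D1 : Submodule 𝕜 E.D := LinearMap.range S.P1
/-- `D_{20} = ker A`. -/
abbrev D20 : Submodule 𝕜 E.D := S.spanD S.eig
/-- `D_{2Σ}`. -/
abbrev D2Sigma : Submodule 𝕜 E.D := S.spanD S.adj
/-- `D_{2s}^{(s+1)}`; in particular `D_{2(ν-1)}` for `s = ν - 1`. -/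
abbrev DLast (s : ℕ) : Submodule 𝕜 E.D := S.spanD (S.last s)
/-- `D_{2∧,s}`; it is zero for `s ≥ ν - 1`. -/
abbrev DWedge (s : ℕ) : Submodule 𝕜 E.D := S.spanD (S.inner s)

/-- `Y₁ = Q₁ Y`. -/
noncomputable abbrev Y1 : Submodule 𝕜 Y := LinearMap.range S.Q1
/-- `Y_{20} = B D_{20}`. -/
abbrev Y20 : Submodule 𝕜 Y := S.spanY S.eig
/-- `Y_{2s}^{(s+1)} = B D_{2s}^{(s+1)}`. -/
abbrev YLast (s : ℕ) : Submodule 𝕜 Y := S.spanY (S.last s)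
/-- `Y_{2Σ,s} = B D_{2∧,s}`. -/
abbrev YSigma (s : ℕ) : Submodule 𝕜 Y := S.spanY (S.inner s)

/-- `Ã = A + ∑ i, ⟨·, B* q_i^1⟩ B φ_i^{m_i}`, which maps `D` bijectively onto `Y` and `D₁` onto
`Y₁`. -/
noncomputable def Atilde : E.D →ₗ[𝕜] Y :=
  E.opA + ∑ i, ((S.p i 0 : X →ₗ[𝕜] 𝕜) ∘ₗ E.D.subtype).smulRight (E.opB (S.φ i (S.m i - 1)))

/-- The structural assumption on `f`. -/
def HasStructure (f : ℝ → E.D → Y) : Prop :=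
  ∀ t, 0 ≤ t → ∀ x : E.D,
    f t x = S.Q1 (f t x) + S.Q20 (f t x)
      + ∑ s ∈ Finset.Ico 1 (ν - 1), S.QSigma s (f t (∑ j ∈ Finset.Ico 1 ν, S.PLast j x
          + ∑ j ∈ Finset.Ico s (ν - 1), S.PWedge j x))
      + ∑ s ∈ Finset.Ico 1 ν, S.QLast s (f t (∑ j ∈ Finset.Ico s ν, S.PLast j x))

/-- `F_{2s}^{(s+1)}`, with `y` in place of `x_{2s}^{(s+1)}` and `x j` for `x_{2j}^{(j+1)}`,
`j = s + 1, …, ν - 1`. -/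
noncomputable def FLast (f : ℝ → E.D → Y) (s : ℕ) (t : ℝ) (y : E.D) (x : ℕ → E.D) : Y :=
  S.QLast s (f t (y + ∑ j ∈ Finset.Ico (s + 1) ν, x j)) - E.opB y

/-- `F_{2Σ,s}`, with `x j` for `x_{2j}^{(j+1)}`, `y` for `x_{2∧,s}`, `z i` for `x_{2∧,i}`,
`i = s + 1, …, ν - 2`, and `d`, `d'` for the derivatives of `x_{2(s+1)}^{(s+2)}`, `x_{2∧,s+1}`. -/
noncomputable def FSigma (f : ℝ → E.D → Y) (s : ℕ) (t : ℝ) (x : ℕ → E.D) (y : E.D)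
    (z : ℕ → E.D) (d d' : E.D) : Y :=
  S.QSigma s (f t (∑ j ∈ Finset.Ico 1 ν, x j + y + ∑ i ∈ Finset.Ico (s + 1) (ν - 1), z i))
    - E.opB y - E.opA (d + d')

/-- `F_{20}`. -/
noncomputable def F20 (f : ℝ → E.D → Y) (t : ℝ) (x1 x20 xS d d' : E.D) : Y :=
  S.Q20 (f t (x1 + x20 + xS)) - E.opB x20 - S.Q20 (E.opA (d + d'))

/-- `M` is an open subset of the subspace `H`. -/
def IsOpenIn (H : Submodule 𝕜 E.D) (M : Set E.D) : Prop :=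
  M ⊆ (H : Set E.D) ∧ IsOpen ((fun h : H => (h : E.D)) ⁻¹' M)

/-- The open sets `M_{20}`, `M_{2j}^{(j+1)}` for `1 ≤ j ≤ ν - 1` and `M_{2∧,j}` for
`1 ≤ j ≤ ν - 2`. -/
structure Regions (S : RootSystem E ν) where
  M20 : Set E.D
  MLast : ℕ → Set E.D
  MWedge : ℕ → Set E.D
  isOpen_M20 : IsOpenIn S.D20 M20
  isOpen_MLast : ∀ j ∈ Finset.Ico 1 ν, IsOpenIn (S.DLast j) (MLast j)
  isOpen_MWedge : ∀ j ∈ Finset.Ico 1 (ν - 1), IsOpenIn (S.DWedge j) (MWedge j)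

end RootSystem

namespace RootSystem.Regions

open RootSystem

variable {E : OperatorPair 𝕜 X Y} {ν : ℕ} {S : RootSystem E ν} (G : S.Regions)

/-- The direct sum of the sets `M_{2j}^{(j+1)}`, `j = s, …, ν - 1`. -/
def sumLast (s : ℕ) : Set E.D :=
  {x | ∃ u : ℕ → E.D, (∀ j ∈ Finset.Ico s ν, u j ∈ G.MLast j) ∧ x = ∑ j ∈ Finset.Ico s ν, u j}

/-- The direct sum of the sets `M_{2∧,j}`, `j = s, …, ν - 2`. -/
def sumWedge (s : ℕ) : Set E.D :=
  {x | ∃ u : ℕ → E.D, (∀ j ∈ Finset.Ico s (ν - 1), u j ∈ G.MWedge j) ∧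
    x = ∑ j ∈ Finset.Ico s (ν - 1), u j}

/-- The direct sum of all `M_{2j}^{(j+1)}`, `j ≥ 1`, and of the `M_{2∧,j}`, `j = s, …, ν - 2`. -/
def sumFrom (s : ℕ) : Set E.D := {x | ∃ u ∈ G.sumLast 1, ∃ v ∈ G.sumWedge s, x = u + v}

/-- `M_{2Σ}`. -/
def M2Sigma : Set E.D := G.sumFrom 1

/-- `M`, the direct sum of `D₁`, `M_{20}` and `M_{2Σ}`. -/
def M : Set E.D := {x | ∃ x1 ∈ S.D1, ∃ x20 ∈ G.M20, ∃ xS ∈ G.M2Sigma, x = x1 + x20 + xS}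

/-- Unique solvability of the algebraic equations. The case `s = ν - 1` of `last` is the equation
for `x_{2(ν-1)}`, and the case `s = ν - 2` of `wedge` (where `D_{2∧,ν-1} = 0`) that for
`x_{2∧,ν-2}`. -/
structure UniqueSolvability (f : ℝ → E.D → Y) : Prop where
  last : ∀ s ∈ Finset.Ico 1 ν, ∀ t, 0 ≤ t → ∀ x : ℕ → E.D,
    (∀ j ∈ Finset.Ico (s + 1) ν, x j ∈ G.MLast j) →
    ∃! y : E.D, y ∈ G.MLast s ∧ S.FLast f s t y x = 0
  wedge : ∀ s ∈ Finset.Ico 1 (ν - 1), ∀ t, 0 ≤ t → ∀ x z : ℕ → E.D,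
    (∀ j ∈ Finset.Ico 1 ν, x j ∈ G.MLast j) →
    (∀ i ∈ Finset.Ico (s + 1) (ν - 1), z i ∈ G.MWedge i) →
    ∀ d ∈ S.DLast (s + 1), ∀ d' ∈ S.DWedge (s + 1),
    ∃! y : E.D, y ∈ G.MWedge s ∧ S.FSigma f s t x y z d d' = 0
  eig : ∀ t, 0 ≤ t → ∀ x1 ∈ S.D1, ∀ xS ∈ G.M2Sigma, ∀ d ∈ S.DLast 1, ∀ d' ∈ S.DWedge 1,
    ∃! y : E.D, y ∈ G.M20 ∧ S.F20 f t x1 y xS d d' = 0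

/-- The boundedness condition on `Q₁ f`. -/
def Q1Bounded (f : ℝ → E.D → Y) : Prop :=
  ∀ a₁ a₂ : ℝ, 0 < a₁ → 0 < a₂ → ∃ C : ℝ, ∀ t ∈ Icc 0 a₁, ∀ x ∈ G.M, ‖S.P1 x‖ ≤ a₂ →
    ‖S.Q1 (f t x)‖ ≤ C

end RootSystem.Regions

end Pencil

section Derivatives

variable {𝕜 X Y : Type*} [RCLike 𝕜] [NormedAddCommGroup X] [NormedSpace 𝕜 X]
  [NormedSpace ℝ X] [IsScalarTower ℝ 𝕜 X]
  [NormedAddCommGroup Y] [NormedSpace 𝕜 Y] [NormedSpace ℝ Y] [IsScalarTower ℝ 𝕜 Y]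
  {E : OperatorPair 𝕜 X Y} {ν : ℕ} {S : RootSystem E ν}

/-- The map `F : H → K`, written as a map into `Y ⊇ K`, has at `y` a Fréchet derivative which is
an operator `H → K` with a bounded inverse `K → H`. -/
def InvertibleDerivAt (H : Submodule 𝕜 E.D) (K : Submodule 𝕜 Y) (F : E.D → Y) (y : H) : Prop :=
  ∃ W : H ≃L[ℝ] K, HasFDerivAt (fun h : H => F (h : E.D))
    ((K.subtypeL.restrictScalars ℝ).comp (W : H →L[ℝ] K)) y

namespace RootSystem.Regions

variable (G : S.Regions)

/-- The smoothness assumptions on the components of `f` that act in the algebraic equations. -/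
structure Smoothness (f : ℝ → E.D → Y) : Prop where
  last : ∀ s ∈ Finset.Ico 1 (ν - 1),
    ContDiffOn ℝ ((ν - 2 : ℕ) : WithTop ℕ∞)
      (fun z : ℝ × (⨆ j ∈ Finset.Ico s ν, S.DLast j : Submodule 𝕜 E.D) =>
        S.QLast s (f z.1 (z.2 : E.D)))
      {z | 0 ≤ z.1 ∧ (z.2 : E.D) ∈ G.sumLast s}
  wedge : ∀ s ∈ Finset.Ico 1 (ν - 1),
    ContDiffOn ℝ (s : WithTop ℕ∞)
      (fun z : ℝ × ((⨆ j ∈ Finset.Ico 1 ν, S.DLast j) ⊔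
          (⨆ j ∈ Finset.Ico s (ν - 1), S.DWedge j) : Submodule 𝕜 E.D) =>
        S.QSigma s (f z.1 (z.2 : E.D)))
      {z | 0 ≤ z.1 ∧ (z.2 : E.D) ∈ G.sumFrom s}
  top : 2 ≤ ν →
    ContDiffOn ℝ ((ν - 1 : ℕ) : WithTop ℕ∞)
      (fun z : ℝ × S.DLast (ν - 1) => S.QLast (ν - 1) (f z.1 (z.2 : E.D)))
      {z | 0 ≤ z.1 ∧ (z.2 : E.D) ∈ G.MLast (ν - 1)}

/-- Invertibility of the partial derivatives of `F_{2s}^{(s+1)}` and `F_{2Σ,s}`. -/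
structure Invertibility (f : ℝ → E.D → Y) : Prop where
  last : ∀ s ∈ Finset.Ico 1 ν, ∀ t, 0 ≤ t → ∀ x : ℕ → E.D,
    (∀ j ∈ Finset.Ico (s + 1) ν, x j ∈ G.MLast j) →
    ∀ y : S.DLast s, (y : E.D) ∈ G.MLast s → S.FLast f s t y x = 0 →
    InvertibleDerivAt (S.DLast s) (S.YLast s) (fun h => S.FLast f s t h x) y
  wedge : ∀ s ∈ Finset.Ico 1 (ν - 1), ∀ t, 0 ≤ t → ∀ x z : ℕ → E.D,
    (∀ j ∈ Finset.Ico 1 ν, x j ∈ G.MLast j) →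
    (∀ i ∈ Finset.Ico (s + 1) (ν - 1), z i ∈ G.MWedge i) →
    ∀ d ∈ S.DLast (s + 1), ∀ d' ∈ S.DWedge (s + 1),
    ∀ y : S.DWedge s, (y : E.D) ∈ G.MWedge s → S.FSigma f s t x y z d d' = 0 →
    InvertibleDerivAt (S.DWedge s) (S.YSigma s) (fun h => S.FSigma f s t x h z d d') y

/-- `g(t, x)` satisfies locally a Lipschitz condition with respect to `x₁ + x_{20}` on
`[0, ∞) × M` (`x_{2Σ}` is a parameter). -/
def LocallyLipschitz (g : ℝ → E.D → Y) : Prop :=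
  ∀ t', 0 ≤ t' → ∀ x' ∈ G.M, ∃ I ∈ 𝓝[Ici 0] t', ∃ N ∈ 𝓝 x', ∃ L : ℝ, ∀ t ∈ I, 0 ≤ t →
    ∀ x ∈ N ∩ G.M, ∀ y ∈ N ∩ G.M, S.P2Sigma x = S.P2Sigma y →
      ‖g t x - g t y‖ ≤ L * ‖x - y‖

/-- The condition on `Q₁ f` and `Q_{20} f`, Lipschitz form. The function `k δ ε` has a limit `l < ‖Z⁻¹‖⁻¹`
as `δ, ε → 0`. -/
structure LipschitzCondition (f : ℝ → E.D → Y) : Prop where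
  lipschitz_Q1 : G.LocallyLipschitz (fun t x => S.Q1 (f t x))
  lipschitz_Q20 : G.LocallyLipschitz (fun t x => S.Q20 (f t x))
  contraction : ∀ t₀, 0 ≤ t₀ → ∀ x1₀ ∈ S.D1, ∀ x20₀ ∈ G.M20, ∀ xS₀ ∈ G.M2Sigma,
    ∀ d₀ ∈ S.DLast 1, ∀ d'₀ ∈ S.DWedge 1, S.F20 f t₀ x1₀ x20₀ xS₀ d₀ d'₀ = 0 →
    ∃ (Z : S.D20 ≃L[ℝ] S.Y20) (k : ℝ → ℝ → ℝ) (l : ℝ),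
      Tendsto (fun e : ℝ × ℝ => k e.1 e.2) (𝓝[>] 0 ×ˢ 𝓝[>] 0) (𝓝 l) ∧
      l * ‖(Z.symm : S.Y20 →L[ℝ] S.D20)‖ < 1 ∧
      ∀ᶠ e : ℝ × ℝ in 𝓝[>] 0 ×ˢ 𝓝[>] 0,
        ∀ t, 0 ≤ t → |t - t₀| < e.1 → ∀ x1 ∈ S.D1, ‖x1 - x1₀‖ < e.1 →
        ∀ xS ∈ S.D2Sigma, ‖xS - xS₀‖ < e.1 →
        ∀ d ∈ S.DLast 1, ‖d - d₀‖ < e.1 → ∀ d' ∈ S.DWedge 1, ‖d' - d'₀‖ < e.1 →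
        ∀ u v : S.D20, ‖(u : E.D) - x20₀‖ < e.2 → ‖(v : E.D) - x20₀‖ < e.2 →
          ‖S.F20 f t x1 u xS d d' - S.F20 f t x1 v xS d d' - (Z (u - v) : Y)‖
            ≤ k e.1 e.2 * ‖u - v‖

/-- The condition on `Q₁ f` and `Q_{20} f`, differentiable form. -/
structure SmoothCondition (f : ℝ → E.D → Y) : Prop where
  diff_Q1 : ∀ t, 0 ≤ t → ∀ x ∈ G.M, DifferentiableAt ℝ (fun y => S.Q1 (f t y)) x
  cont_Q1 : ContinuousOn (fun z : ℝ × E.D => fderiv ℝ (fun y => S.Q1 (f z.1 y)) z.2)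
    (Ici 0 ×ˢ G.M)
  diff_Q20 : ∀ t, 0 ≤ t → ∀ x ∈ G.M, DifferentiableAt ℝ (fun y => S.Q20 (f t y)) x
  cont_Q20 : ContinuousOn (fun z : ℝ × E.D => fderiv ℝ (fun y => S.Q20 (f z.1 y)) z.2)
    (Ici 0 ×ˢ G.M)
  invertible : ∀ t, 0 ≤ t → ∀ x1 ∈ S.D1, ∀ xS ∈ G.M2Sigma,
    ∀ d ∈ S.DLast 1, ∀ d' ∈ S.DWedge 1, ∀ y : S.D20, (y : E.D) ∈ G.M20 →
    S.F20 f t x1 y xS d d' = 0 →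
    InvertibleDerivAt S.D20 S.Y20 (fun h => S.F20 f t x1 h xS d d') y

end RootSystem.Regions

/-- The conditions on the comparison functions: `U` is continuous and nonnegative on `[0, ∞)`,
`ψ` is nonnegative and integrable on finite intervals, and the integral of `1 / U` diverges at
infinity (`1 / U = ∞` where `U = 0`). -/
structure IsComparisonPair (U ψ : ℝ → ℝ) : Prop where
  continuousOn_U : ContinuousOn U (Ici 0)
  nonneg_U : ∀ u, 0 ≤ u → 0 ≤ U u
  nonneg_psi : ∀ t, 0 ≤ t → 0 ≤ ψ t
  integrable_psi : ∀ T : ℝ, 0 < T → IntegrableOn ψ (Icc 0 T)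
  divergence : ∀ u₀ : ℝ, 0 < u₀ → ∫⁻ u in Ioi u₀, (ENNReal.ofReal (U u))⁻¹ = ⊤

namespace RootSystem.Regions

variable (G : S.Regions)

/-- `Q₁ f(t, x₁ + x_{20} + x_{2Σ}) - Q₁ B x₁`, as an element of `Y₁`. -/
noncomputable def drift (S : RootSystem E ν) (f : ℝ → E.D → Y) (t : ℝ) (x1 x20 xS : E.D) : S.Y1 :=
  S.Q1.rangeRestrict (f t (x1 + x20 + xS) - E.opB x1)

/-- The condition with a Lyapunov functional of the form `V = max V_i`. The vector `x1` is
`Ã⁻¹ w`, and `j` is an index with `V(w) = V_j(w)`. -/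
def LyapunovMax (f : ℝ → E.D → Y) : Prop :=
  ∃ (R : ℝ) (k : ℕ) (V : Fin (k + 1) → S.Y1 → ℝ) (Vmax : S.Y1 → ℝ) (U ψ : ℝ → ℝ),
    0 < R ∧
    (∀ i, Continuous (V i)) ∧ (∀ i w, 0 ≤ V i w) ∧
    (∀ i, ContDiffOn ℝ 1 (V i) {w | R ≤ ‖w‖}) ∧
    (∀ w, Vmax w = Finset.univ.sup' Finset.univ_nonempty (fun i => V i w)) ∧
    IsComparisonPair U ψ ∧
    Tendsto Vmax (Bornology.cobounded S.Y1) atTop ∧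
    ∀ w : S.Y1, R ≤ ‖w‖ → ∃ j, Vmax w = V j w ∧
      ∀ x1 : E.D, S.Atilde x1 = w → ∀ t, 0 ≤ t → ∀ x20 ∈ G.M20, ∀ xS ∈ G.M2Sigma,
        fderivWithin ℝ (V j) {w | R ≤ ‖w‖} w (drift S f t x1 x20 xS) ≤ U (Vmax w) * ψ t

/-- The condition with a Lipschitz functional `V` and a bound on the norm. The vector `x1` is
`Ã⁻¹ w`. -/
def LyapunovLipschitz (f : ℝ → E.D → Y) : Prop :=
  ∃ (R : ℝ) (V : S.Y1 → ℝ) (U ψ : ℝ → ℝ),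
    0 < R ∧ Continuous V ∧ (∀ w, 0 ≤ V w) ∧
    (∃ L, LipschitzOnWith L V {w | R ≤ ‖w‖}) ∧
    IsComparisonPair U ψ ∧
    Tendsto V (Bornology.cobounded S.Y1) atTop ∧
    ∀ w : S.Y1, R ≤ ‖w‖ → ∀ x1 : E.D, S.Atilde x1 = w →
      ∀ t, 0 ≤ t → ∀ x20 ∈ G.M20, ∀ xS ∈ G.M2Sigma,
        ‖drift S f t x1 x20 xS‖ ≤ U (V w) * ψ t

/-- `x` is a solution of `d/dt [A x] + B x = f(t, x)`, `t > 0`, on the interval `J ⊆ [0, ∞)`, which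
lies in `M` and satisfies the initial condition `P₁ x(t₀) = x₀₁`. -/
structure IsSolutionOn (f : ℝ → E.D → Y) (t₀ : ℝ) (x₀₁ : E.D) (J : Set ℝ) (x : ℝ → E.D) :
    Prop where
  continuousOn : ContinuousOn x J
  contDiffOn : ContDiffOn ℝ 1 (fun t => E.opA (x t)) (J ∩ Ioi 0)
  equation : ∀ t ∈ J ∩ Ioi 0, derivWithin (fun τ => E.opA (x τ)) J t + E.opB (x t) = f t (x t)
  mem : ∀ t ∈ J, x t ∈ G.M
  initial : S.P1 (x t₀) = x₀₁

end RootSystem.Regions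

end Derivatives

end ADAE

/-!
The proof eliminates all components of `x` except `x₁` and reduces the problem to an ordinary
differential equation for `w = A x₁` in the Banach space `Y₁`.

*Splitting.* In the coordinates given by the canonical system, `B` is diagonal and `A` lowers the
position in a chain of root vectors by one (`opA_projD`, `opB_projD`). Applying the projectors `Q`
to the equation therefore gives an equivalent system (`equation_iff`). The component at the end of a
chain satisfies `F_{2s}^{(s+1)} = 0`, without derivatives, since `Q_{2s}^{(s+1)} A = 0`; the other
adjoined components satisfy `F_{2Σ,s} = 0`, and the component `x_{20}` in `ker A` satisfies
`F_{20} = 0`, where the arguments `d`, `d'` are the derivatives of the components of the next order.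
By the structural assumption on `f`, the equations for the adjoined components contain neither `x₁`
nor `x_{20}`.

*Algebraic equations.* Starting from the highest order, unique solvability and a one-sided implicit
function theorem (`contDiffOn_implicit`) determine the adjoined components one after another as
functions of time, with one derivative lost at each passage from order `s + 1` to order `s`
(`exists_last_family`, `exists_wedge_family`). Thus `x_{2Σ}` is a fixed `C¹` function of time,
the same for all solutions (`exists_isAdjComponent`). The equation `F_{20} = 0` then gives
`x_{20} = η(t, w)`. Both alternative hypotheses on `F_{20}` say that it is close to an invertible
linear map near each zero (`EigContraction`), so that `η` is continuous and locally Lipschitz in `w`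
(`continuousOn_eigSolution`, `locallyLipschitz_eigSolution`).

*The reduced equation.* The closed range of `A` and the resolvent of the pencil show that `A` maps
`D₁` onto `Y₁` with a bounded inverse `T`, and that `B T` is bounded (`exists_inverse`). Hence `w`
solves `w' = Q₁ f(t, T w + η(t, w) + x_{2Σ}(t)) - B T w`, whose right-hand side is locally Lipschitz
(`locallyLipschitzField_reducedField`). The Lyapunov function is compared with the solutions of
`u' = U(u) ψ(t)`, which exist for all times (`IsComparisonPair.exists_bound`); with the boundedness
of `Q₁ f` this excludes a blow-up in finite time (`exists_norm_le_of_lyapunov`), so that `w` exists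
on `[t₀, ∞)`.

*Uniqueness.* The same equations show that every solution is the state determined by its component
`A x₁` (`IsSolutionOn.eq_state`), and uniqueness for the reduced equation applies
(`IsSolutionOn.eqOn_state`). A solution starting at `t₀ = 0` is required to be differentiable only
for `t > 0`; there the boundedness of `Q₁ f` provides a limit of `A x₁(t)` as `t → 0`, which is the
right one because `A` is closed (`IsSolutionOn.tendsto_diffComponent`).
-/

namespace ADAE

/-! ### Ordinary differential equations with a locally Lipschitz right-hand side -/

section ODE

variable {F : Type*} [NormedAddCommGroup F] [NormedSpace ℝ F]

/-- The vector field `v`, considered for times `t ≥ 0` only, is locally Lipschitz in the space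
variable, locally uniformly in time. -/
def LocallyLipschitzField (v : ℝ → F → F) : Prop :=
  ∀ t, 0 ≤ t → ∀ w, ∃ δ > 0, ∃ K : NNReal, ∀ s, 0 ≤ s → |s - t| < δ →
    LipschitzOnWith K (v s) (Metric.ball w δ)

theorem LocallyLipschitzField.eqOn_Icc {v : ℝ → F → F} (hv : LocallyLipschitzField v)
    {a b : ℝ} (ha : 0 ≤ a) {f g : ℝ → F}
    (hf : ContinuousOn f (Icc a b))
    (hf' : ∀ t ∈ Ico a b, HasDerivWithinAt f (v t (f t)) (Ici t) t)
    (hg : ContinuousOn g (Icc a b))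
    (hg' : ∀ t ∈ Ico a b, HasDerivWithinAt g (v t (g t)) (Ici t) t)
    (h : f a = g a) : EqOn f g (Icc a b) := by
  have hcl : IsClosed ({t | f t = g t} ∩ Icc a b) := by
    rw [inter_comm]
    exact (hf.prodMk hg).preimage_isClosed_of_isClosed isClosed_Icc isClosed_diagonal
  refine hcl.Icc_subset_of_forall_exists_gt h ?_
  rintro x ⟨hx, hxa, hxb⟩ y hy
  obtain ⟨δ, hδ, K, hK⟩ := hv x (ha.trans hxa) (f x)
  -- on a short interval to the right of `x` both curves stay in the ball of the Lipschitz bound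
  have key : ∀ u : ℝ → F, ContinuousOn u (Icc a b) → u x = f x →
      ∀ᶠ t in 𝓝[≥] x, u t ∈ Metric.ball (f x) δ := by
    intro u hu hux
    have : ContinuousWithinAt u (Icc x b) x :=
      (hu x ⟨hxa, hxb.le⟩).mono (Icc_subset_Icc_left hxa)
    have h2 : Tendsto u (𝓝[≥] x) (𝓝 (f x)) := by
      rw [← hux, ← nhdsWithin_Icc_eq_nhdsGE hxb]; exact this
    exact h2 (Metric.ball_mem_nhds _ hδ)
  have hball := (key f hf rfl).and (key g hg (Eq.symm hx))
  obtain ⟨c, hc, hcs⟩ := (mem_nhdsGE_iff_exists_Icc_subset).1 hball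
  have hc : x < c := hc
  have hy : x < y := hy
  obtain ⟨e, hxe, he⟩ : ∃ e, x < e ∧ e < min (min c y) (min b (x + δ)) :=
    exists_between (by simp [hc, hy, hxb, hδ])
  simp only [lt_min_iff] at he
  have heq := ODE_solution_unique_of_mem_Icc_right (v := v) (K := K)
    (s := fun _ => Metric.ball (f x) δ) (a := x) (b := e) (f := f) (g := g)
    (fun t ht => hK t (ha.trans (hxa.trans ht.1)) (by
      rw [abs_of_nonneg (by linarith [ht.1])]; linarith [ht.2]))
    (hf.mono (Icc_subset_Icc hxa he.2.1.le))
    (fun t ht => hf' t ⟨hxa.trans ht.1, ht.2.trans he.2.1⟩)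
    (fun t ht => (hcs ⟨ht.1, (ht.2.trans he.1.1).le⟩).1)
    (hg.mono (Icc_subset_Icc hxa he.2.1.le))
    (fun t ht => hg' t ⟨hxa.trans ht.1, ht.2.trans he.2.1⟩)
    (fun t ht => (hcs ⟨ht.1, (ht.2.trans he.1.1).le⟩).2) hx
  exact ⟨e, heq ⟨hxe.le, le_rfl⟩, hxe, he.1.2.le⟩

theorem HasDerivWithinAt.Ici_of_Icc {f : ℝ → F} {f' : F} {a b t : ℝ}
    (h : HasDerivWithinAt f f' (Icc a b) t) (ht : t ∈ Ico a b) :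
    HasDerivWithinAt f f' (Ici t) t := by
  refine h.mono_of_mem_nhdsWithin ?_
  filter_upwards [Icc_mem_nhdsGE ht.2] with s hs using ⟨ht.1.trans hs.1, hs.2⟩

theorem LocallyLipschitzField.eqOn_Icc_of_Icc {v : ℝ → F → F} (hv : LocallyLipschitzField v)
    {a b : ℝ} (ha : 0 ≤ a) {f g : ℝ → F}
    (hf : ∀ t ∈ Icc a b, HasDerivWithinAt f (v t (f t)) (Icc a b) t)
    (hg : ∀ t ∈ Icc a b, HasDerivWithinAt g (v t (g t)) (Icc a b) t)
    (h : f a = g a) : EqOn f g (Icc a b) :=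
  hv.eqOn_Icc ha (HasDerivWithinAt.continuousOn hf)
    (fun t ht => HasDerivWithinAt.Ici_of_Icc (hf t (Ico_subset_Icc_self ht)) ht)
    (HasDerivWithinAt.continuousOn hg)
    (fun t ht => HasDerivWithinAt.Ici_of_Icc (hg t (Ico_subset_Icc_self ht)) ht) h

variable [CompleteSpace F]

theorem exists_local_solution {v : ℝ → F → F}
    (hcont : ContinuousOn (Function.uncurry v) (Ici 0 ×ˢ univ)) (hv : LocallyLipschitzField v)
    {t₀ : ℝ} (ht₀ : 0 ≤ t₀) (w₀ : F) :
    ∃ b > t₀, ∃ w : ℝ → F, w t₀ = w₀ ∧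
      ∀ t ∈ Icc t₀ b, HasDerivWithinAt w (v t (w t)) (Icc t₀ b) t := by
  obtain ⟨δ, hδ, K, hK⟩ := hv t₀ ht₀ w₀
  have hb : ∀ᶠ z in 𝓝[Ici 0 ×ˢ univ] (t₀, w₀), ‖Function.uncurry v z‖ < ‖v t₀ w₀‖ + 1 :=
    ((hcont (t₀, w₀) ⟨ht₀, mem_univ _⟩).norm).eventually (gt_mem_nhds (by simp))
  obtain ⟨ε, hε, hεb⟩ := Metric.mem_nhdsWithin_iff.1 hb
  set L : NNReal := ⟨‖v t₀ w₀‖ + 1, by positivity⟩ with hL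
  have hL1 : (1 : ℝ) ≤ L := by change (1 : ℝ) ≤ ‖v t₀ w₀‖ + 1; linarith [norm_nonneg (v t₀ w₀)]
  set r : ℝ := min δ ε / 2 with hr
  have hr0 : 0 < r := by positivity
  have hrδ : r < δ := by have := min_le_left δ ε; simp only [hr]; linarith
  have hrε : r < ε := by have := min_le_right δ ε; simp only [hr]; linarith
  have hq : r / L ≤ r := div_le_self hr0.le hL1
  have hq0 : 0 < r / L := by positivity
  have hpl : IsPicardLindelof v (tmin := t₀) (tmax := t₀ + r / L) ⟨t₀, le_rfl, by linarith⟩ w₀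
      ⟨r, hr0.le⟩ 0 L K := by
    refine ⟨fun t ht => ?_, fun x _ => ?_, fun t ht x hx => ?_, ?_⟩
    · refine (hK t (ht₀.trans ht.1) ?_).mono (Metric.closedBall_subset_ball hrδ)
      rw [abs_of_nonneg (by linarith [ht.1])]; linarith [ht.2]
    · exact hcont.comp (f := fun t => (t, x)) (by fun_prop) fun t ht => ⟨ht₀.trans ht.1, mem_univ _⟩
    · refine (hεb (a := (t, x)) ⟨?_, ht₀.trans ht.1, mem_univ _⟩).le
      rw [Metric.mem_ball, Prod.dist_eq, max_lt_iff]
      refine ⟨?_, lt_of_le_of_lt hx hrε⟩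
      rw [Real.dist_eq, abs_of_nonneg (by linarith [ht.1])]; linarith [ht.2]
    · have : (L : ℝ) * (r / L) = r := by field_simp
      simp [this, hq0.le]
      exact le_rfl
  obtain ⟨w, hw0, hw⟩ := hpl.exists_eq_forall_mem_Icc_hasDerivWithinAt₀
  exact ⟨t₀ + r / L, by linarith, w, hw0, hw⟩

/-- Continuation of a solution of `w' = v(t, w)`: if `v` stays bounded along every solution on a
bounded half-open interval, then the solutions are global. -/
theorem LocallyLipschitzField.exists_global_solution {v : ℝ → F → F}
    (hv : LocallyLipschitzField v)
    (hcont : ContinuousOn (Function.uncurry v) (Ici 0 ×ˢ univ))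
    (hbd : ∀ a b : ℝ, 0 ≤ a → a < b → ∀ w : ℝ → F,
      (∀ t ∈ Ico a b, HasDerivWithinAt w (v t (w t)) (Ico a b) t) →
      ∃ C, ∀ t ∈ Ico a b, ‖v t (w t)‖ ≤ C)
    {t₀ : ℝ} (ht₀ : 0 ≤ t₀) (w₀ : F) :
    ∃ w : ℝ → F, w t₀ = w₀ ∧ ∀ t, t₀ ≤ t → HasDerivWithinAt w (v t (w t)) (Ici t₀) t := by
  let IsSol (w : ℝ → F) (c : ℝ) : Prop :=
    w t₀ = w₀ ∧ ∀ t ∈ Icc t₀ c, HasDerivWithinAt w (v t (w t)) (Icc t₀ c) t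
  have hmono : ∀ {w c d}, c ≤ d → IsSol w d → IsSol w c := fun hcd h =>
    ⟨h.1, fun t ht => (h.2 t ⟨ht.1, ht.2.trans hcd⟩).mono (Icc_subset_Icc_right hcd)⟩
  have huniq : ∀ {w u c}, IsSol w c → IsSol u c → EqOn w u (Icc t₀ c) := fun h h' =>
    hv.eqOn_Icc_of_Icc ht₀ h.2 h'.2 (h.1.trans h'.1.symm)
  let S : Set ℝ := {c | ∃ w, IsSol w c}
  -- solutions on all compact subintervals of `[t₀, c)` patch together
  have hpatch : ∀ A : Set ℝ, (∀ t ∈ A, t₀ ≤ t ∧ ∃ d ∈ S, t < d) → (A ⊆ S) →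
      ∃ w : ℝ → F, (t₀ ∈ A → w t₀ = w₀) ∧ ∀ t ∈ A, ∀ d ∈ S, ∀ u, IsSol u d → t ≤ d → w t = u t := by
    intro A hA hAS
    choose! d hd using fun t (ht : t ∈ A) => (hA t ht).2
    choose! u hu using fun t (ht : t ∈ S) => ht
    refine ⟨fun t => u (d t) t, fun h => (hu _ (hd _ h).1).1, fun t ht e he u' hu' hte => ?_⟩
    have h1 := hmono (hd t ht).2.le (hu _ (hd t ht).1)
    exact huniq h1 (hmono hte hu') ⟨(hA t ht).1, le_rfl⟩
  have hderiv : ∀ (w : ℝ → F) (t d : ℝ) (u : ℝ → F) (J : Set ℝ), t₀ ≤ t → t < d → J ⊆ Ici t₀ →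
      IsSol u d → (∀ s ∈ J, s ≤ d → w s = u s) → t ∈ J →
      HasDerivWithinAt w (v t (w t)) J t := by
    intro w t d u J ht htd hJ hu hwu htJ
    have hmem : ∀ᶠ s in 𝓝[J] t, s ∈ Icc t₀ d := by
      filter_upwards [self_mem_nhdsWithin, mem_nhdsWithin_of_mem_nhds (gt_mem_nhds htd)] with s h1 h2
      exact ⟨hJ h1, h2.le⟩
    have h1 : HasDerivWithinAt u (v t (w t)) J t := by
      rw [hwu t htJ htd.le]
      exact (hu.2 t ⟨ht, htd.le⟩).mono_of_mem_nhdsWithin hmem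
    refine h1.congr_of_eventuallyEq ?_ (hwu t htJ htd.le)
    filter_upwards [hmem, self_mem_nhdsWithin] with s h2 h3 using hwu s h3 h2.2
  have hlim : ∀ c, t₀ < c → Ico t₀ c ⊆ S → c ∈ S := by
    intro c hc hcS
    obtain ⟨w, hw0, hw⟩ := hpatch (Ico t₀ c) (fun t ht => ⟨ht.1, by
      obtain ⟨d, h1, h2⟩ := exists_between ht.2
      exact ⟨d, hcS ⟨ht.1.trans h1.le, h2⟩, h1⟩⟩) hcS
    have hw' : ∀ t ∈ Ico t₀ c, HasDerivWithinAt w (v t (w t)) (Ico t₀ c) t := by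
      intro t ht
      obtain ⟨d, h1, h2⟩ := exists_between ht.2
      have hdS : d ∈ S := hcS ⟨ht.1.trans h1.le, h2⟩
      obtain ⟨u, hu⟩ := hdS
      exact hderiv w t d u _ ht.1 h1 (fun s hs => hs.1) hu (fun s hs hsd => hw s hs d ⟨u, hu⟩ u hu hsd) ht
    have hw0 := hw0 ⟨le_rfl, hc⟩
    obtain ⟨C, hC⟩ := hbd t₀ c ht₀ hc w hw'
    have hwc : ContinuousOn w (Ico t₀ c) := HasDerivWithinAt.continuousOn hw'
    have hgc : ContinuousOn (fun t => v t (w t)) (Ico t₀ c) :=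
      hcont.comp (f := fun t => (t, w t)) (by fun_prop) fun t ht => ⟨ht₀.trans ht.1, mem_univ _⟩
    -- the velocity is bounded, so its primitive extends `w` continuously to the end point
    have hint : IntegrableOn (fun t => v t (w t)) (Ico t₀ c) := by
      refine ⟨hgc.aestronglyMeasurable measurableSet_Ico,
        .restrict_of_bounded (C := C) (by simp) ?_⟩
      filter_upwards [ae_restrict_mem measurableSet_Ico] with t ht using hC t ht
    have hint' : IntegrableOn (fun t => v t (w t)) (Icc t₀ c) := by
      rw [integrableOn_Icc_iff_integrableOn_Ico]; exact hint
    set W : ℝ → F := fun t => w₀ + ∫ s in t₀..t, v s (w s) with hW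
    have hWc : ContinuousOn W (Icc t₀ c) := by
      refine continuousOn_const.add ?_
      have := intervalIntegral.continuousOn_primitive_interval (f := fun t => v t (w t))
        (a := t₀) (b := c) (μ := volume) (by rwa [uIcc_of_le hc.le])
      rwa [uIcc_of_le hc.le] at this
    have hWw : ∀ t ∈ Ico t₀ c, W t = w t := by
      intro t ht
      have h1 := ODE.picard_eq_of_hasDerivAt (f := v) (α := w) (t₀ := t₀) (t := t) (u := univ)
        (hcont.mono (by
          rintro ⟨a, x⟩ ⟨ha, -⟩
          rw [uIcc_of_le ht.1] at ha
          exact ⟨ht₀.trans ha.1, mem_univ _⟩))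
        (by
          rw [uIcc_of_le ht.1]
          intro s hs
          have hsub : Icc t₀ t ⊆ Ico t₀ c := fun r hr => ⟨hr.1, hr.2.trans_lt ht.2⟩
          exact (hw' s (hsub hs)).mono hsub) (mapsTo_univ _ _)
      rw [ODE.picard_apply, hw0] at h1
      exact h1
    refine ⟨W, by simp [hW], fun t ht => ?_⟩
    have h2 := ODE.hasDerivWithinAt_picard_Icc (f := v) (α := W) (u := univ) (tmin := t₀)
      (tmax := c) (t₀ := t₀) ⟨le_rfl, hc.le⟩
      (hcont.mono fun z hz => ⟨ht₀.trans hz.1.1, mem_univ _⟩) hWc (fun _ _ => mem_univ _) w₀ ht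
    refine h2.congr_of_mem (fun s hs => ?_) ht
    rw [ODE.picard_apply]
    refine congrArg (w₀ + ·) ?_
    refine intervalIntegral.integral_congr_ae ?_
    have : ∀ᵐ r : ℝ, r ≠ c := by simp [ae_iff]
    filter_upwards [this] with r hr hrs
    rw [uIoc_of_le hs.1] at hrs
    rw [hWw r ⟨hrs.1.le, lt_of_le_of_ne (hrs.2.trans hs.2) hr⟩]
  have hext : ∀ c ∈ S, t₀ ≤ c → ∃ d ∈ S, c < d := by
    rintro c ⟨w, hw⟩ hc
    obtain ⟨d, hd, u, hu0, hu⟩ := exists_local_solution hcont hv (ht₀.trans hc) (w c)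
    refine ⟨d, ⟨fun t => if t ≤ c then w t else u t, by simp [hc, hw.1], fun t ht => ?_⟩, hd⟩
    rw [← Icc_union_Icc_eq_Icc hc hd.le]
    have e1 : EqOn (fun t => if t ≤ c then w t else u t) w (Icc t₀ c) := fun s hs => by
      simp [hs.2]
    have e2 : EqOn (fun t => if t ≤ c then w t else u t) u (Icc c d) := fun s hs => by
      rcases hs.1.eq_or_lt with h | h
      · subst h; simp [hu0]
      · simp [not_le.2 h]
    have d1 : HasDerivWithinAt (fun t => if t ≤ c then w t else u t)
        (v t (if t ≤ c then w t else u t)) (Icc t₀ c) t := by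
      by_cases htc : t ≤ c
      · have h := (hw.2 t ⟨ht.1, htc⟩).congr_of_mem e1 ⟨ht.1, htc⟩
        simpa [htc] using h
      · exact hasDerivWithinAt_iff_hasFDerivWithinAt.2 <| .of_notMem_closure (by rw [isClosed_Icc.closure_eq]; exact fun h => htc h.2)
    have d2 : HasDerivWithinAt (fun t => if t ≤ c then w t else u t)
        (v t (if t ≤ c then w t else u t)) (Icc c d) t := by
      by_cases htc : c ≤ t
      · have h := (hu t ⟨htc, ht.2⟩).congr_of_mem e2 ⟨htc, ht.2⟩
        have h3 := e2 ⟨htc, ht.2⟩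
        simp only at h3
        rwa [← h3] at h
      · exact hasDerivWithinAt_iff_hasFDerivWithinAt.2 <| .of_notMem_closure (by rw [isClosed_Icc.closure_eq]; exact fun h => htc h.1)
    exact d1.union d2
  have hS0 : t₀ ∈ S := by
    refine ⟨fun _ => w₀, rfl, fun t ht => ?_⟩
    rw [Icc_self] at ht ⊢
    rw [mem_singleton_iff.1 ht]
    exact hasDerivWithinAt_iff_hasFDerivWithinAt.2 .singleton
  have hall : ∀ b, Icc t₀ b ⊆ S := by
    intro b
    refine IsClosed.Icc_subset_of_forall_exists_gt ?_ hS0 ?_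
    · refine isClosed_of_closure_subset fun c hc => ?_
      have hcI : c ∈ Icc t₀ b :=
        (closure_minimal inter_subset_right isClosed_Icc) hc
      refine ⟨?_, hcI⟩
      rcases hcI.1.eq_or_lt with h | h
      · exact h ▸ hS0
      refine hlim c h fun t ht => ?_
      obtain ⟨y, hy, hyS⟩ := mem_closure_iff.1 hc (Ioi t) isOpen_Ioi ht.2
      obtain ⟨u, hu⟩ := hyS.1
      exact ⟨u, hmono (le_of_lt hy) hu⟩
    · rintro x ⟨hxS, hx⟩ y hy
      obtain ⟨d, ⟨u, hu⟩, hxd⟩ := hext x hxS hx.1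
      exact ⟨min d y, ⟨u, hmono (min_le_left _ _) hu⟩, lt_min hxd hy, min_le_right _ _⟩
  have hallS : ∀ c, t₀ ≤ c → c ∈ S := fun c hc => hall c ⟨hc, le_rfl⟩
  obtain ⟨w, hw0, hw⟩ := hpatch (Ici t₀)
    (fun t ht => ⟨ht, t + 1, hallS _ (by linarith [mem_Ici.1 ht]), by linarith⟩) hallS
  refine ⟨w, hw0 self_mem_Ici, fun t ht => ?_⟩
  obtain ⟨u, hu⟩ := hallS (t + 1) (by linarith)
  exact hderiv w t (t + 1) u _ ht (by linarith) Subset.rfl hu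
    (fun s hs hsd => hw s hs _ ⟨u, hu⟩ u hu hsd) ht

end ODE

/-! ### A comparison theorem for scalar differential inequalities -/

section Comparison

/-- Separation of variables for `z' ≤ U(z) ψ(t)`, with `U + ε` in place of `U` so that the
reciprocal is finite: the function `∫ du / (U(u) + ε)` of `z(t)` grows at most as fast as `∫ ψ`. -/
theorem integral_inv_add_le {U ψ z : ℝ → ℝ} {a b ε u₀ : ℝ} {K : NNReal}
    (hU : ContinuousOn U (Ici 0)) (hU0 : ∀ u, 0 ≤ u → 0 ≤ U u) (hab : a ≤ b)
    (hz : LipschitzOnWith K z (Icc a b)) (hz0 : ∀ t ∈ Icc a b, 0 ≤ z t)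
    (hψ : IntegrableOn ψ (Icc a b)) (hψ0 : ∀ t ∈ Icc a b, 0 ≤ ψ t)
    (hd : ∀ t ∈ Ioo a b, ∀ z', HasDerivAt z z' t → z' ≤ U (z t) * ψ t)
    (hu : z a ≤ u₀) (hε : 0 < ε) :
    ∫ r in u₀..z b, (U (max r 0) + ε)⁻¹ ≤ ∫ t in a..b, ψ t := by
  set ρ : ℝ → ℝ := fun r => (U (max r 0) + ε)⁻¹ with hρ
  have hpos : ∀ r, 0 < U (max r 0) + ε := fun r => by
    have := hU0 (max r 0) (le_max_right _ _); linarith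
  have hρ0 : ∀ r, 0 ≤ ρ r := fun r => (inv_pos.2 (hpos r)).le
  have hρc : Continuous ρ := by
    refine Continuous.inv₀ ?_ fun r => (hpos r).ne'
    exact (hU.comp_continuous (by fun_prop) fun r => mem_Ici.2 (le_max_right _ _)).add continuous_const
  set g : ℝ → ℝ := fun u => ∫ r in u₀..u, ρ r with hg
  have hgd : ∀ u, HasDerivAt g (ρ u) u := fun u => (hρc.integral_hasStrictDerivAt u₀ u).hasDerivAt
  have hgL : LipschitzWith (Real.toNNReal ε⁻¹) g := by
    refine lipschitzWith_of_nnnorm_deriv_le (fun u => (hgd u).differentiableAt) fun u => ?_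
    rw [(hgd u).deriv, ← NNReal.coe_le_coe, coe_nnnorm, Real.norm_of_nonneg (hρ0 u),
      Real.coe_toNNReal _ (inv_pos.2 hε).le]
    refine inv_anti₀ hε ?_
    have := hU0 (max u 0) (le_max_right _ _); linarith
  have hac : AbsolutelyContinuousOnInterval (g ∘ z) a b := by
    refine LipschitzOnWith.absolutelyContinuousOnInterval (K := Real.toNNReal ε⁻¹ * K) ?_
    rw [uIcc_of_le hab]
    exact hgL.comp_lipschitzOnWith hz
  have hzac : AbsolutelyContinuousOnInterval z a b :=
    LipschitzOnWith.absolutelyContinuousOnInterval (by rwa [uIcc_of_le hab])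
  have hle : ∫ t in a..b, deriv (g ∘ z) t ≤ ∫ t in a..b, ψ t := by
    refine intervalIntegral.integral_mono_ae_restrict hab hac.intervalIntegrable_deriv
      ((intervalIntegrable_iff_integrableOn_Icc_of_le hab).2 hψ) ?_
    have h1 : ∀ᵐ t : ℝ, t ≠ a := by simp [ae_iff]
    have h2 : ∀ᵐ t : ℝ, t ≠ b := by simp [ae_iff]
    rw [EventuallyLE, ae_restrict_iff' measurableSet_Icc]
    filter_upwards [h1, h2, hzac.ae_differentiableAt] with t hta htb hdt ht
    have htI : t ∈ Ioo a b := ⟨lt_of_le_of_ne ht.1 (Ne.symm hta), lt_of_le_of_ne ht.2 htb⟩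
    have hdz := (hdt (by rwa [uIcc_of_le hab])).hasDerivAt
    rw [((hgd (z t)).comp t hdz).deriv]
    have h3 := hd t htI _ hdz
    have h4 := hz0 t ht
    have h5 := hψ0 t ht
    have h6 := hU0 _ h4
    have h7 : ρ (z t) = (U (z t) + ε)⁻¹ := by simp [hρ, h4]
    rw [h7, inv_mul_le_iff₀ (by linarith)]
    nlinarith
  rw [hac.integral_deriv_eq_sub] at hle
  have hga : g (z a) ≤ 0 := by
    simp only [hg]
    rw [intervalIntegral.integral_symm, neg_nonpos]
    exact intervalIntegral.integral_nonneg hu fun r _ => hρ0 r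
  have : g (z b) - g (z a) ≤ ∫ t in a..b, ψ t := hle
  change g (z b) ≤ _
  linarith

/-- Separation of variables for the inequality `z' ≤ U(z) ψ(t)`. No uniqueness is needed at the
zeros of `U`, since `U` is first replaced by `U + ε`, and then `ε → 0`. -/
theorem lintegral_inv_le {U ψ z : ℝ → ℝ} {a b u₀ : ℝ} {K : NNReal}
    (hU : ContinuousOn U (Ici 0)) (hU0 : ∀ u, 0 ≤ u → 0 ≤ U u) (hab : a ≤ b)
    (hz : LipschitzOnWith K z (Icc a b)) (hz0 : ∀ t ∈ Icc a b, 0 ≤ z t)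
    (hψ : IntegrableOn ψ (Icc a b)) (hψ0 : ∀ t ∈ Icc a b, 0 ≤ ψ t)
    (hd : ∀ t ∈ Ioo a b, ∀ z', HasDerivAt z z' t → z' ≤ U (z t) * ψ t)
    (hu0 : 0 ≤ u₀) (hu : z a ≤ u₀) :
    ∫⁻ u in Ioc u₀ (z b), (ENNReal.ofReal (U u))⁻¹ ≤ ENNReal.ofReal (∫ t in a..b, ψ t) := by
  rcases le_or_gt (z b) u₀ with h | h
  · simp [Ioc_eq_empty (not_lt.2 h)]
  have hcont : ∀ ε : ℝ, ContinuousOn (fun r => U r + ε) (Ioc u₀ (z b)) := fun ε =>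
    (hU.mono fun r hr => hu0.trans hr.1.le).add continuousOn_const
  have key : ∀ n : ℕ, ∫⁻ u in Ioc u₀ (z b), (ENNReal.ofReal (U u + 1 / ((n : ℝ) + 1)))⁻¹ ≤
      ENNReal.ofReal (∫ t in a..b, ψ t) := by
    intro n
    have hε : (0 : ℝ) < 1 / ((n : ℝ) + 1) := Nat.one_div_pos_of_nat
    have h1 := integral_inv_add_le hU hU0 hab hz hz0 hψ hψ0 hd hu hε
    refine le_trans (le_of_eq ?_) (ENNReal.ofReal_le_ofReal h1)
    have hpos : ∀ r, 0 < U (max r 0) + 1 / ((n : ℝ) + 1) := fun r => by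
      have := hU0 (max r 0) (le_max_right _ _); linarith
    have hc : Continuous fun r => (U (max r 0) + 1 / ((n : ℝ) + 1))⁻¹ :=
      Continuous.inv₀ ((hU.comp_continuous (by fun_prop) fun r => mem_Ici.2 (le_max_right _ _)).add
        continuous_const) fun r => (hpos r).ne'
    rw [intervalIntegral.integral_of_le h.le, ofReal_integral_eq_lintegral_ofReal
      (hc.integrableOn_Ioc) (Eventually.of_forall fun r => (inv_pos.2 (hpos r)).le)]
    refine setLIntegral_congr_fun measurableSet_Ioc fun r hr => ?_
    have hr0 : 0 ≤ r := hu0.trans hr.1.le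
    have hp := hpos r
    rw [max_eq_left hr0] at hp
    simp only [max_eq_left hr0]
    rw [ENNReal.ofReal_inv_of_pos hp]
  refine le_of_tendsto' (lintegral_tendsto_of_tendsto_of_monotone
    (f := fun (n : ℕ) u => (ENNReal.ofReal (U u + 1 / ((n : ℝ) + 1)))⁻¹) ?_ ?_ ?_) key
  · intro n
    exact (((hcont _).aemeasurable measurableSet_Ioc).ennreal_ofReal).inv
  · refine Eventually.of_forall fun u m n hmn => ?_
    refine ENNReal.inv_le_inv.2 (ENNReal.ofReal_le_ofReal ?_)
    have := Nat.one_div_le_one_div (α := ℝ) hmn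
    linarith
  · refine Eventually.of_forall fun u => ?_
    refine (continuous_inv.tendsto _).comp ((ENNReal.continuous_ofReal.tendsto _).comp ?_)
    simpa using tendsto_const_nhds.add (tendsto_one_div_add_atTop_nhds_zero_nat (𝕜 := ℝ))

theorem IsComparisonPair.const_mul {U ψ : ℝ → ℝ} (h : IsComparisonPair U ψ) {c : ℝ} (hc : 0 ≤ c) :
    IsComparisonPair U fun t => c * ψ t where
  continuousOn_U := h.continuousOn_U
  nonneg_U := h.nonneg_U
  nonneg_psi t ht := mul_nonneg hc (h.nonneg_psi t ht)
  integrable_psi T hT := (h.integrable_psi T hT).const_mul c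
  divergence := h.divergence

/-- A nonnegative function with `z' ≤ U(z) ψ(t)` does not blow up in finite time if the integral
of `1 / U` diverges at infinity. -/
theorem IsComparisonPair.exists_bound {U ψ z : ℝ → ℝ} (h : IsComparisonPair U ψ) {a T : ℝ}
    (ha : 0 ≤ a)
    (hz : ∀ b ∈ Ioo a T, ∃ K : NNReal, LipschitzOnWith K z (Icc a b))
    (hz0 : ∀ t ∈ Ico a T, 0 ≤ z t)
    (hd : ∀ t ∈ Ioo a T, ∀ z', HasDerivAt z z' t → z' ≤ U (z t) * ψ t) :
    ∃ C, ∀ t ∈ Ico a T, z t ≤ C := by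
  by_contra! hcon
  obtain ⟨t₁, ht₁, -⟩ := hcon 0
  have haT : a < T := ht₁.1.trans_lt ht₁.2
  set u₀ : ℝ := max (z a) 1 with hu₀
  have hu1 : 1 ≤ u₀ := le_max_right _ _
  have hψT : IntegrableOn ψ (Icc a T) :=
    (h.integrable_psi T (ha.trans_lt haT)).mono_set (Icc_subset_Icc_left ha)
  have key : ∀ n : ℕ, ∫⁻ u in Ioc u₀ n, (ENNReal.ofReal (U u))⁻¹ ≤
      ENNReal.ofReal (∫ t in a..T, ψ t) := by
    intro n
    obtain ⟨b, hb, hbn⟩ := hcon (max n u₀)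
    have hab : a < b := by
      rcases hb.1.eq_or_lt with h1 | h1
      · subst h1
        exact absurd hbn (not_lt.2 ((le_max_left _ _).trans (le_max_right _ _)))
      · exact h1
    obtain ⟨K, hK⟩ := hz b ⟨hab, hb.2⟩
    have h1 := lintegral_inv_le (u₀ := u₀) h.continuousOn_U h.nonneg_U hab.le hK
      (fun t ht => hz0 t ⟨ht.1, ht.2.trans_lt hb.2⟩) (hψT.mono_set (Icc_subset_Icc_right hb.2.le))
      (fun t ht => h.nonneg_psi t (ha.trans ht.1)) (fun t ht => hd t ⟨ht.1, ht.2.trans hb.2⟩)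
      (by linarith) (le_max_left _ _)
    refine (lintegral_mono_set (Ioc_subset_Ioc_right
      ((le_max_left _ _).trans hbn.le))).trans (h1.trans (ENNReal.ofReal_le_ofReal ?_))
    rw [intervalIntegral.integral_of_le hab.le, intervalIntegral.integral_of_le haT.le]
    refine setIntegral_mono_set (hψT.mono_set Ioc_subset_Icc_self) ?_
      (Ioc_subset_Ioc_right hb.2.le).eventuallyLE
    filter_upwards [ae_restrict_mem measurableSet_Ioc] with t ht
      using h.nonneg_psi t (ha.trans ht.1.le)
  have hU : Ioi u₀ = ⋃ n : ℕ, Ioc u₀ (n : ℝ) := by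
    ext u
    simp only [mem_Ioi, mem_iUnion, mem_Ioc, exists_and_left, iff_self_and]
    exact fun _ => exists_nat_ge u
  have hdir : Directed (· ⊆ ·) fun n : ℕ => Ioc u₀ (n : ℝ) :=
    Monotone.directed_le fun m n hmn => Ioc_subset_Ioc_right (Nat.cast_le.2 hmn)
  have h2 := h.divergence u₀ (by linarith)
  rw [hU, setLIntegral_iUnion_of_directed _ hdir] at h2
  have h3 := iSup_le key
  rw [h2] at h3
  exact ENNReal.ofReal_ne_top (top_le_iff.1 h3)

end Comparison

/-! ### Implicit functions -/

section ImplicitFunction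

variable {H K : Type*} [NormedAddCommGroup H] [NormedSpace ℝ H] [CompleteSpace H]
  [NormedAddCommGroup K] [NormedSpace ℝ K]

/-- If the maps `F p` are uniformly approximated near `y₀` by an invertible linear map, and
`F p y₀ → 0`, then `F p` has a zero arbitrarily close to `y₀`. -/
theorem eventually_exists_zero {P : Type*} {l : Filter P} {F : P → H → K} (Z : H ≃L[ℝ] K)
    {c : NNReal} (hc : c * ‖(Z.symm : K →L[ℝ] H)‖ < 1) {y₀ : H} {δ : ℝ} (hδ : 0 < δ)
    (happ : ∀ᶠ p in l, ApproximatesLinearOn (F p) (Z : H →L[ℝ] K) (Metric.ball y₀ δ) c)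
    (h0 : Tendsto (fun p => F p y₀) l (𝓝 0)) {ε : ℝ} (hε : 0 < ε) :
    ∀ᶠ p in l, ∃ y ∈ Metric.closedBall y₀ ε, F p y = 0 := by
  rcases subsingleton_or_nontrivial H with hH | hH
  · have : Subsingleton K := Z.symm.toEquiv.subsingleton
    exact Eventually.of_forall fun p => ⟨y₀, by simp [hε.le], Subsingleton.elim _ _⟩
  set N := Z.toNonlinearRightInverse.nnnorm with hN
  have hNe : (N : ℝ) = ‖(Z.symm : K →L[ℝ] H)‖ := rfl
  have hN0 : (0 : ℝ) < N := by rw [hNe]; exact Z.norm_symm_pos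
  have hpos : 0 < (N : ℝ)⁻¹ - c := by
    rw [sub_pos, inv_eq_one_div, lt_div_iff₀ hN0, hNe]
    exact hc
  set r := min ε (δ / 2) with hr
  have hr0 : 0 < r := by positivity
  have hrδ : r < δ := (min_le_right _ _).trans_lt (by linarith)
  have hsmall : ∀ᶠ p in l, F p y₀ ∈ Metric.ball (0 : K) (((N : ℝ)⁻¹ - c) * r) :=
    h0 (Metric.ball_mem_nhds _ (by positivity))
  filter_upwards [happ, hsmall] with p hp hps
  have hsurj := hp.surjOn_closedBall_of_nonlinearRightInverse Z.toNonlinearRightInverse hr0.le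
    (Metric.closedBall_subset_ball hrδ)
  obtain ⟨y, hy, hy0⟩ := hsurj (a := 0) (by
    rw [mem_closedBall_iff_norm']
    simpa using (mem_ball_zero_iff.1 hps).le)
  exact ⟨y, Metric.closedBall_subset_closedBall (min_le_left _ _) hy, hy0⟩

/-- A zero `η p` of `F p` that is unique in a fixed neighbourhood of `y₀` depends continuously on the
parameter, because `F p` has some zero near `y₀`. -/
theorem tendsto_zero_of_approximatesLinearOn {P : Type*} {l : Filter P} {F : P → H → K}
    (Z : H ≃L[ℝ] K) {c : NNReal} (hc : c * ‖(Z.symm : K →L[ℝ] H)‖ < 1) {y₀ : H} {δ : ℝ} (hδ : 0 < δ)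
    (happ : ∀ᶠ p in l, ApproximatesLinearOn (F p) (Z : H →L[ℝ] K) (Metric.ball y₀ δ) c)
    (h0 : Tendsto (fun p => F p y₀) l (𝓝 0)) {U : Set H} (hU : U ∈ 𝓝 y₀) {η : P → H}
    (huniq : ∀ᶠ p in l, ∀ y ∈ U, F p y = 0 → y = η p) : Tendsto η l (𝓝 y₀) := by
  rw [Metric.nhds_basis_closedBall.tendsto_right_iff]
  intro ε hε
  obtain ⟨ε', hε', hU'⟩ := Metric.nhds_basis_closedBall.mem_iff.1 hU
  filter_upwards [eventually_exists_zero Z hc hδ happ h0 (lt_min hε hε'), huniq] with p hp hu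
  obtain ⟨y, hy, hy0⟩ := hp
  rw [← hu y (hU' (Metric.closedBall_subset_closedBall (min_le_right _ _) hy)) hy0]
  exact Metric.closedBall_subset_closedBall (min_le_left _ _) hy

theorem exists_pos_mul_lt_one (a : ℝ) : ∃ c : NNReal, 0 < c ∧ c * a < 1 := by
  have : Tendsto (fun c : NNReal => (c : ℝ) * a) (𝓝[>] 0) (𝓝 ((0 : NNReal) * a)) :=
    ((NNReal.continuous_coe.mul continuous_const).tendsto (0 : NNReal)).mono_left
      nhdsWithin_le_nhds
  have h := this.eventually_lt_const (u := 1) (by simp)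
  obtain ⟨c, h1, h2⟩ := (h.and self_mem_nhdsWithin).exists
  exact ⟨c, h2, h1⟩

/-- One-sided implicit function theorem for a globally given zero `y(t)`, `t ≥ 0`, that is unique
in an open set `U`. Continuity of `y` comes from uniqueness, and the regularity is then bootstrapped
from `y' = -(∂F/∂h)⁻¹ ∂F/∂t`, so that no extension of `F` to negative times is needed. -/
theorem contDiffOn_implicit {F : ℝ × H → K} {U : Set H} (hU : IsOpen U) {n : ℕ} (hn : 1 ≤ n)
    (hF : ContDiffOn ℝ n F (Ici 0 ×ˢ U)) {y : ℝ → H} (hyU : ∀ t, 0 ≤ t → y t ∈ U)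
    (hy0 : ∀ t, 0 ≤ t → F (t, y t) = 0)
    (huniq : ∀ t, 0 ≤ t → ∀ h ∈ U, F (t, h) = 0 → h = y t)
    (hinv : ∀ t, 0 ≤ t → ∃ W : H ≃L[ℝ] K, HasFDerivAt (fun h => F (t, h)) (W : H →L[ℝ] K) (y t)) :
    ContDiffOn ℝ n y (Ici 0) := by
  have : Nonempty (H ≃L[ℝ] K) := ⟨(hinv 0 le_rfl).choose⟩
  choose! W hW using hinv
  set s : Set (ℝ × H) := Ici 0 ×ˢ U with hs
  have hus : UniqueDiffOn ℝ s := (uniqueDiffOn_Ici 0).prod hU.uniqueDiffOn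
  have hmem : ∀ t, 0 ≤ t → (t, y t) ∈ s := fun t ht => ⟨ht, hyU t ht⟩
  set F' := fderivWithin ℝ F s with hF'
  have hF1 : DifferentiableOn ℝ F s := hF.differentiableOn (by exact_mod_cast (by omega : n ≠ 0))
  have hFd : ∀ z ∈ s, HasFDerivWithinAt F (F' z) s z := fun z hz =>
    (hF1 z hz).hasFDerivWithinAt
  have hF'c : ∀ m : ℕ, m + 1 ≤ n → ContDiffOn ℝ m F' s := fun m hm =>
    hF.fderivWithin hus (by exact_mod_cast hm)
  have hpart : ∀ t, 0 ≤ t → ∀ h ∈ U,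
      HasFDerivAt (fun h => F (t, h)) ((F' (t, h)).comp (ContinuousLinearMap.inr ℝ ℝ H)) h := by
    intro t ht h hh
    have h1 : HasFDerivWithinAt (fun h : H => (t, h)) (ContinuousLinearMap.inr ℝ ℝ H) U h :=
      (hasFDerivAt_prodMk_right t h).hasFDerivWithinAt
    have h2 := (hFd (t, h) ⟨ht, hh⟩).comp h h1 (fun x hx => ⟨ht, hx⟩)
    exact h2.hasFDerivAt (hU.mem_nhds hh)
  have hWe : ∀ t, 0 ≤ t → (W t : H →L[ℝ] K) =
      (F' (t, y t)).comp (ContinuousLinearMap.inr ℝ ℝ H) := fun t ht =>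
    (hW t ht).unique (hpart t ht _ (hyU t ht))
  have hAc : ContinuousOn (fun z => (F' z).comp (ContinuousLinearMap.inr ℝ ℝ H)) s :=
    (hF'c 0 (by omega)).continuousOn.clm_comp continuousOn_const
  have hyc : ContinuousOn y (Ici 0) := by
    intro t₀ ht₀
    have ht₀ : 0 ≤ t₀ := ht₀
    obtain ⟨c, hc0, hc⟩ := exists_pos_mul_lt_one ‖((W t₀).symm : K →L[ℝ] H)‖
    have hev : ∀ᶠ z in 𝓝[s] (t₀, y t₀),
        ‖(F' z).comp (ContinuousLinearMap.inr ℝ ℝ H) - (W t₀ : H →L[ℝ] K)‖ < c := by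
      have h1 : ContinuousWithinAt (fun z => ‖(F' z).comp (ContinuousLinearMap.inr ℝ ℝ H)
          - (W t₀ : H →L[ℝ] K)‖) s (t₀, y t₀) :=
        ((hAc _ (hmem t₀ ht₀)).sub continuousWithinAt_const).norm
      refine h1.eventually (gt_mem_nhds ?_)
      simpa [hWe t₀ ht₀] using hc0
    obtain ⟨δ₁, hδ₁, h1⟩ := Metric.mem_nhdsWithin_iff.1 hev
    obtain ⟨δ₂, hδ₂, h2⟩ := Metric.isOpen_iff.1 hU _ (hyU t₀ ht₀)
    have hδ : 0 < min δ₁ δ₂ := lt_min hδ₁ hδ₂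
    refine tendsto_zero_of_approximatesLinearOn (F := fun t h => F (t, h)) (W t₀) hc hδ ?_ ?_
      (hU.mem_nhds (hyU t₀ ht₀)) ?_
    · filter_upwards [self_mem_nhdsWithin, mem_nhdsWithin_of_mem_nhds (Metric.ball_mem_nhds t₀ hδ)]
        with t ht htδ
      intro u hu v hv
      refine (convex_ball (y t₀) _).norm_image_sub_le_of_norm_hasFDerivWithin_le'
        (f := fun h => F (t, h)) (f' := fun h => (F' (t, h)).comp (ContinuousLinearMap.inr ℝ ℝ H))
        (fun h hh => (hpart t ht h (h2 (Metric.ball_subset_ball (min_le_right _ _) hh))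
          ).hasFDerivWithinAt) (fun h hh => ?_) hv hu
      refine (h1 ⟨?_, ht, h2 (Metric.ball_subset_ball (min_le_right _ _) hh)⟩).le
      rw [Metric.mem_ball, Prod.dist_eq, max_lt_iff]
      exact ⟨htδ.trans_le (min_le_left _ _), lt_of_lt_of_le hh (min_le_left _ _)⟩
    · have h3 : ContinuousWithinAt (fun t => F (t, y t₀)) (Ici 0) t₀ :=
        (hF1.continuousOn _ (hmem t₀ ht₀)).comp (f := fun t => (t, y t₀)) (t := s)
          (by fun_prop) fun t ht => ⟨ht, hyU t₀ ht₀⟩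
      have := h3.tendsto
      rwa [hy0 t₀ ht₀] at this
    · filter_upwards [self_mem_nhdsWithin] with t ht using huniq t ht
  have hyd : ∀ t, 0 ≤ t → HasDerivWithinAt y
      (-(ContinuousLinearMap.inverse ((F' (t, y t)).comp (ContinuousLinearMap.inr ℝ ℝ H)))
        (F' (t, y t) (1, 0))) (Ici 0) t := by
    intro t₀ ht₀
    set e : (ℝ × H) ≃L[ℝ] (ℝ × K) := (ContinuousLinearEquiv.refl ℝ ℝ).skewProd (W t₀)
      ((F' (t₀, y t₀)).comp (ContinuousLinearMap.inl ℝ ℝ H)) with he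
    have hee : (e : (ℝ × H) →L[ℝ] (ℝ × K)) =
        (ContinuousLinearMap.fst ℝ ℝ H).prod (F' (t₀, y t₀)) := by
      ext z
      · simp [he]
      · simp [he]
      · simp [he]
      · have := DFunLike.congr_fun (hWe t₀ ht₀) z
        simp only [ContinuousLinearMap.coe_comp, Function.comp_apply,
          ContinuousLinearMap.inr_apply] at this
        simpa [he, ← Prod.zero_eq_mk] using this
    have h1 : HasFDerivWithinAt (fun z : ℝ × H => (z.1, F z)) (e : (ℝ × H) →L[ℝ] (ℝ × K)) s
        (t₀, y t₀) := by
      rw [hee]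
      exact hasFDerivWithinAt_fst.prodMk (hFd _ ⟨ht₀, hyU t₀ ht₀⟩)
    have hg : ContinuousWithinAt (fun z : ℝ × K => (z.1, y z.1)) (Ici 0 ×ˢ {0}) (t₀, 0) :=
      continuousWithinAt_fst.prodMk
        ((hyc t₀ ht₀).comp (f := Prod.fst) continuousWithinAt_fst fun z hz => hz.1)
    have h2 : HasFDerivWithinAt (fun z : ℝ × K => (z.1, y z.1))
        (e.symm : (ℝ × K) →L[ℝ] (ℝ × H)) (Ici 0 ×ˢ {0}) (t₀, 0) := by
      refine HasFDerivWithinAt.of_local_left_inverse (f := fun z : ℝ × H => (z.1, F z)) (t := s)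
        ?_ h1 ⟨ht₀, rfl⟩ ?_
      · exact hg.tendsto_nhdsWithin fun z hz => ⟨hz.1, hyU _ hz.1⟩
      · filter_upwards [self_mem_nhdsWithin] with z hz
        rw [hy0 _ hz.1]
        exact Prod.ext rfl (Eq.symm hz.2)
    have h3 : HasFDerivWithinAt (fun t : ℝ => (t, (0 : K))) (ContinuousLinearMap.inl ℝ ℝ K)
        (Ici 0) t₀ := (hasFDerivAt_prodMk_left t₀ (0 : K)).hasFDerivWithinAt
    have h4 := ((h2.comp t₀ h3 fun t ht => (⟨ht, rfl⟩ : (t, (0 : K)) ∈ Ici 0 ×ˢ {0})).snd).hasDerivWithinAt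
    refine h4.congr_deriv ?_
    rw [← hWe t₀ ht₀, ContinuousLinearMap.inverse_equiv]
    simp [he]
  have hmain : ∀ m : ℕ, m ≤ n → ContDiffOn ℝ m y (Ici 0) := by
    intro m
    induction m with
    | zero => exact fun _ => by simpa using hyc
    | succ m ih =>
      intro hm
      have hym := ih (by omega)
      rw [Nat.cast_succ, contDiffOn_succ_iff_derivWithin (uniqueDiffOn_Ici 0)]
      refine ⟨fun t ht => (hyd t ht).differentiableWithinAt, by simp, ?_⟩
      have hcomp : ContDiffOn ℝ m (fun t => F' (t, y t)) (Ici 0) :=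
        (hF'c m hm).comp (contDiffOn_id.prodMk hym) fun t ht => ⟨ht, hyU t ht⟩
      have hder : ContDiffOn ℝ m (fun t =>
          -(ContinuousLinearMap.inverse ((F' (t, y t)).comp (ContinuousLinearMap.inr ℝ ℝ H)))
            (F' (t, y t) (1, 0))) (Ici 0) := by
        refine (ContDiffOn.clm_apply (fun t ht => ?_) (hcomp.clm_apply contDiffOn_const)).neg
        have h1 : ContDiffAt ℝ m ContinuousLinearMap.inverse
            ((F' (t, y t)).comp (ContinuousLinearMap.inr ℝ ℝ H)) := by
          rw [← hWe t ht]; exact contDiffAt_map_inverse _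
        exact h1.comp_contDiffWithinAt t ((hcomp.clm_comp contDiffOn_const) t ht)
      exact hder.congr fun t ht => (hyd t ht).derivWithin (uniqueDiffOn_Ici 0 t ht)
  exact hmain n le_rfl

end ImplicitFunction

/-! ### The projectors of a canonical system -/

namespace RootSystem

variable {𝕜 X Y : Type*} [RCLike 𝕜] [NormedAddCommGroup X] [NormedSpace 𝕜 X]
  [NormedAddCommGroup Y] [NormedSpace 𝕜 Y]
  {E : OperatorPair 𝕜 X Y} {ν : ℕ} (S : RootSystem E ν)

theorem m_le (i : Fin S.n) : S.m i ≤ ν :=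
  (Finset.le_sup (Finset.mem_univ i)).trans_eq S.max_m

open Classical in
theorem projD_apply (T : Fin S.n → ℕ → Prop) (x : E.D) :
    S.projD T x = ∑ i, ∑ r ∈ Finset.range (S.m i),
      if T i r then S.p i r (x : X) • S.φ i r else 0 := by
  simp only [projD, LinearMap.sum_apply, Finset.sum_filter]
  refine Finset.sum_congr rfl fun i _ => Finset.sum_congr rfl fun r _ => ?_
  split_ifs <;> simp

open Classical in
theorem projY_apply (T : Fin S.n → ℕ → Prop) (y : Y) :
    S.projY T y = ∑ i, ∑ r ∈ Finset.range (S.m i),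
      if T i r then S.q i r y • E.opB (S.φ i r) else 0 := by
  simp only [projY, LinearMap.sum_apply, Finset.sum_filter]
  refine Finset.sum_congr rfl fun i _ => Finset.sum_congr rfl fun r _ => ?_
  split_ifs <;> simp

theorem opB_projD (T : Fin S.n → ℕ → Prop) (x : E.D) :
    E.opB (S.projD T x) = S.projY T (E.opB x) := by
  classical
  rw [projD_apply, projY_apply]
  simp only [map_sum]
  refine Finset.sum_congr rfl fun i _ => Finset.sum_congr rfl fun r hr => ?_
  rw [apply_ite E.opB, map_smul, map_zero, S.p_eq i r (Finset.mem_range.1 hr)]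

open Classical in
theorem q_projY (T : Fin S.n → ℕ → Prop) (y : Y) {k : Fin S.n} {l : ℕ} (hl : l < S.m k) :
    S.q k l (S.projY T y) = if T k l then S.q k l y else 0 := by
  rw [projY_apply]
  simp only [map_sum]
  rw [Finset.sum_eq_single k, Finset.sum_eq_single l]
  · by_cases h : T k l
    · simp [h, S.biorthogonal k l hl k l hl]
    · simp [h]
  · intro r hr hrl
    by_cases h : T k r
    · simp [h, S.biorthogonal k r (Finset.mem_range.1 hr) k l hl, hrl]
    · simp [h]
  · simp [hl]
  · intro i _ hik
    refine Finset.sum_eq_zero fun r hr => ?_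
    by_cases h : T i r
    · simp [h, S.biorthogonal i r (Finset.mem_range.1 hr) k l hl, hik]
    · simp [h]
  · simp

open Classical in
theorem p_projD (T : Fin S.n → ℕ → Prop) (x : E.D) {k : Fin S.n} {l : ℕ} (hl : l < S.m k) :
    S.p k l (S.projD T x : X) = if T k l then S.p k l (x : X) else 0 := by
  rw [S.p_eq k l hl, opB_projD, q_projY S T _ hl, S.p_eq k l hl]

theorem projY_congr {T T' : Fin S.n → ℕ → Prop} {y y' : Y}
    (h : ∀ i r, r < S.m i → T i r → T' i r ∧ S.q i r y = S.q i r y')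
    (h' : ∀ i r, r < S.m i → T' i r → ¬ T i r → S.q i r y' = 0) :
    S.projY T y = S.projY T' y' := by
  classical
  rw [projY_apply, projY_apply]
  refine Finset.sum_congr rfl fun i _ => Finset.sum_congr rfl fun r hr => ?_
  have hr := Finset.mem_range.1 hr
  by_cases hT : T i r
  · simp [hT, h i r hr hT]
  · by_cases hT' : T' i r
    · simp [hT, hT', h' i r hr hT' hT]
    · simp [hT, hT']

theorem projD_congr {T T' : Fin S.n → ℕ → Prop} {x x' : E.D}
    (h : ∀ i r, r < S.m i → T i r → T' i r ∧ S.p i r (x : X) = S.p i r (x' : X))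
    (h' : ∀ i r, r < S.m i → T' i r → ¬ T i r → S.p i r (x' : X) = 0) :
    S.projD T x = S.projD T' x' := by
  classical
  rw [projD_apply, projD_apply]
  refine Finset.sum_congr rfl fun i _ => Finset.sum_congr rfl fun r hr => ?_
  have hr := Finset.mem_range.1 hr
  by_cases hT : T i r
  · simp [hT, h i r hr hT]
  · by_cases hT' : T' i r
    · simp [hT, hT', h' i r hr hT' hT]
    · simp [hT, hT']

theorem projD_eq_zero {T : Fin S.n → ℕ → Prop} {x : E.D}
    (h : ∀ i r, r < S.m i → T i r → S.p i r (x : X) = 0) : S.projD T x = 0 := by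
  classical
  rw [projD_apply]
  refine Finset.sum_eq_zero fun i _ => Finset.sum_eq_zero fun r hr => ?_
  by_cases hT : T i r
  · simp [hT, h i r (Finset.mem_range.1 hr) hT]
  · simp [hT]

theorem projY_eq_zero {T : Fin S.n → ℕ → Prop} {y : Y}
    (h : ∀ i r, r < S.m i → T i r → S.q i r y = 0) : S.projY T y = 0 := by
  classical
  rw [projY_apply]
  refine Finset.sum_eq_zero fun i _ => Finset.sum_eq_zero fun r hr => ?_
  by_cases hT : T i r
  · simp [hT, h i r (Finset.mem_range.1 hr) hT]
  · simp [hT]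

theorem projD_projD {T T' : Fin S.n → ℕ → Prop} (h : ∀ i r, r < S.m i → T i r → T' i r)
    (x : E.D) : S.projD T (S.projD T' x) = S.projD T x :=
  S.projD_congr (fun i r hr hT => ⟨hT, by simp [S.p_projD T' x hr, h i r hr hT]⟩)
    fun i r _ hT hT' => absurd hT hT'

theorem projD_projD_of_le {T T' : Fin S.n → ℕ → Prop} (h : ∀ i r, r < S.m i → T' i r → T i r)
    (x : E.D) : S.projD T (S.projD T' x) = S.projD T' x := by
  refine Eq.symm (S.projD_congr (fun i r hr hT => ⟨h i r hr hT, by simp [S.p_projD T' x hr, hT]⟩)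
    fun i r hr hT hT' => by simp [S.p_projD T' x hr, hT'])

theorem projD_projD_of_disjoint {T T' : Fin S.n → ℕ → Prop}
    (h : ∀ i r, r < S.m i → T i r → ¬ T' i r) (x : E.D) : S.projD T (S.projD T' x) = 0 :=
  S.projD_eq_zero fun i r hr hT => by simp [S.p_projD T' x hr, h i r hr hT]

theorem projY_projY {T T' : Fin S.n → ℕ → Prop} (h : ∀ i r, r < S.m i → T i r → T' i r)
    (y : Y) : S.projY T (S.projY T' y) = S.projY T y :=
  S.projY_congr (fun i r hr hT => ⟨hT, by simp [S.q_projY T' y hr, h i r hr hT]⟩)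
    fun i r _ hT hT' => absurd hT hT'

theorem projY_projY_of_disjoint {T T' : Fin S.n → ℕ → Prop}
    (h : ∀ i r, r < S.m i → T i r → ¬ T' i r) (y : Y) : S.projY T (S.projY T' y) = 0 :=
  S.projY_eq_zero fun i r hr hT => by simp [S.q_projY T' y hr, h i r hr hT]

theorem p_φ {i k : Fin S.n} {r l : ℕ} (hr : r < S.m i) (hl : l < S.m k) :
    S.p k l (S.φ i r : X) = if i = k ∧ r = l then 1 else 0 := by
  rw [S.p_eq k l hl, S.biorthogonal i r hr k l hl]

theorem projD_mem (T : Fin S.n → ℕ → Prop) (x : E.D) : S.projD T x ∈ S.spanD T := by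
  classical
  rw [projD_apply]
  refine Submodule.sum_mem _ fun i _ => Submodule.sum_mem _ fun r hr => ?_
  by_cases hT : T i r
  · rw [if_pos hT]
    exact Submodule.smul_mem _ _ (Submodule.subset_span ⟨i, r, Finset.mem_range.1 hr, hT, rfl⟩)
  · rw [if_neg hT]
    exact Submodule.zero_mem _

theorem mem_spanD_iff {T : Fin S.n → ℕ → Prop} {x : E.D} :
    x ∈ S.spanD T ↔ S.projD T x = x := by
  classical
  refine ⟨fun h => ?_, fun h => h ▸ S.projD_mem T x⟩
  suffices S.spanD T ≤ LinearMap.eqLocus (S.projD T) LinearMap.id from this h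
  refine Submodule.span_le.2 ?_
  rintro _ ⟨i, r, hr, hT, rfl⟩
  change S.projD T (S.φ i r) = S.φ i r
  rw [projD_apply, Finset.sum_eq_single i, Finset.sum_eq_single r]
  · simp [hT, S.p_φ hr hr]
  · intro l hl hlr
    simp [S.p_φ hr (Finset.mem_range.1 hl), Ne.symm hlr]
  · simp [hr]
  · intro k _ hki
    refine Finset.sum_eq_zero fun l hl => ?_
    simp [S.p_φ hr (Finset.mem_range.1 hl), Ne.symm hki]
  · simp

theorem projY_mem (T : Fin S.n → ℕ → Prop) (y : Y) : S.projY T y ∈ S.spanY T := by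
  classical
  rw [projY_apply]
  refine Submodule.sum_mem _ fun i _ => Submodule.sum_mem _ fun r hr => ?_
  by_cases hT : T i r
  · rw [if_pos hT]
    refine Submodule.smul_mem _ _ (Submodule.mem_map_of_mem
      (Submodule.subset_span ⟨i, r, Finset.mem_range.1 hr, hT, rfl⟩))
  · rw [if_neg hT]
    exact Submodule.zero_mem _

theorem opB_mem_spanY {T : Fin S.n → ℕ → Prop} {x : E.D} (hx : x ∈ S.spanD T) :
    E.opB x ∈ S.spanY T := Submodule.mem_map_of_mem hx

theorem spanD_mono {T T' : Fin S.n → ℕ → Prop} (h : ∀ i r, r < S.m i → T i r → T' i r) :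
    S.spanD T ≤ S.spanD T' :=
  Submodule.span_mono fun _ ⟨i, r, hr, hT, hx⟩ => ⟨i, r, hr, h i r hr hT, hx⟩

theorem projD_eq_zero_of_mem {T T' : Fin S.n → ℕ → Prop} {x : E.D} (hx : x ∈ S.spanD T')
    (h : ∀ i r, r < S.m i → T i r → ¬ T' i r) : S.projD T x = 0 := by
  rw [← S.mem_spanD_iff.1 hx]
  exact S.projD_projD_of_disjoint h x

instance finiteDimensional_spanD (T : Fin S.n → ℕ → Prop) : FiniteDimensional 𝕜 (S.spanD T) := by
  refine FiniteDimensional.span_of_finite 𝕜 (Set.Finite.subset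
    (Set.finite_range fun z : Σ i : Fin S.n, Fin (S.m i) => S.φ z.1 z.2) ?_)
  rintro _ ⟨i, r, hr, -, rfl⟩
  exact ⟨⟨i, r, hr⟩, rfl⟩

instance finiteDimensional_spanY (T : Fin S.n → ℕ → Prop) : FiniteDimensional 𝕜 (S.spanY T) :=
  inferInstanceAs (FiniteDimensional 𝕜 ((S.spanD T).map E.opB))

/-! ### The pencil in the coordinates of the canonical system -/

theorem q_opA (x : E.D) {i : Fin S.n} {r : ℕ} (hr : r < S.m i) :
    S.q i r (E.opA x) = if r + 1 < S.m i then - S.p i (r + 1) (x : X) else 0 := by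
  split_ifs with h
  · exact S.adjoint_chain i r h x
  · obtain rfl : r = S.m i - 1 := by omega
    exact S.adjoint_last i x

theorem opA_eigenvector (i : Fin S.n) : E.opA (S.φ i 0) = 0 := by
  have : S.φ i 0 ∈ LinearMap.ker E.opA := by
    rw [← S.span_eigenvectors]; exact Submodule.subset_span ⟨i, rfl⟩
  exact this

/-- `A` moves each root vector to the preceding place of its chain, so that it intertwines the
projector of `D` for the pairs `T` with the projector of `Y` for the pairs preceding those in `T`. -/
theorem opA_projD (T : Fin S.n → ℕ → Prop) (x : E.D) :
    E.opA (S.projD T x) = S.projY (fun i r => T i (r + 1) ∧ r + 1 < S.m i) (E.opA x) := by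
  classical
  rw [projD_apply, projY_apply]
  simp only [map_sum]
  refine Finset.sum_congr rfl fun i _ => ?_
  obtain ⟨k, hk⟩ : ∃ k, S.m i = k + 1 := ⟨S.m i - 1, by have := S.one_le_m i; omega⟩
  rw [hk, Finset.sum_range_succ', Finset.sum_range_succ]
  have h0 : E.opA (if T i 0 then S.p i 0 (x : X) • S.φ i 0 else 0) = 0 := by
    split_ifs <;> simp [opA_eigenvector]
  rw [h0, add_zero, if_neg (by simp), add_zero]
  refine Finset.sum_congr rfl fun r hr => ?_
  have hr' : r + 1 < S.m i := by rw [hk]; simpa using Finset.mem_range.1 hr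
  by_cases hT : T i (r + 1)
  · rw [if_pos hT, if_pos ⟨hT, by omega⟩, map_smul, S.chain i r hr',
      S.q_opA x (by omega), if_pos hr', smul_neg, neg_smul]
  · rw [if_neg hT, if_neg (fun h => hT h.1), map_zero]

/-- The functionals at the ends of the chains vanish on the range of `A`: this equation contains no
derivative. -/
theorem QLast_opA (s : ℕ) (x : E.D) : S.QLast s (E.opA x) = 0 :=
  S.projY_eq_zero fun i r hr hT => by
    obtain ⟨rfl, h⟩ := hT
    rw [S.q_opA x hr, if_neg (by omega)]

theorem PLast_add_PWedge (s : ℕ) (x : E.D) :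
    S.PLast s x + S.PWedge s x = S.projD (fun _ r => r = s) x := by
  classical
  rw [PLast, PWedge, projD_apply, projD_apply, projD_apply, ← Finset.sum_add_distrib]
  refine Finset.sum_congr rfl fun i _ => ?_
  rw [← Finset.sum_add_distrib]
  refine Finset.sum_congr rfl fun r hr => ?_
  have hr := Finset.mem_range.1 hr
  by_cases hrs : r = s
  · subst hrs
    by_cases h : S.m i = r + 1
    · simp [last, inner, h]
    · have h2 : r + 2 ≤ S.m i := by omega
      simp [last, inner, h, h2]
  · simp [last, inner, hrs]

/-- The only part of `A x` of order `s` comes from the components of `x` of order `s + 1`. -/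
theorem QSigma_opA (s : ℕ) (x : E.D) :
    S.QSigma s (E.opA x) = E.opA (S.PLast (s + 1) x + S.PWedge (s + 1) x) := by
  rw [PLast_add_PWedge, opA_projD]
  refine S.projY_congr (fun i r hr hT => ⟨⟨by rw [hT.1], ?_⟩, rfl⟩) fun i r hr hT hT' => ?_
  · have := hT.1; have := hT.2; omega
  · exact absurd ⟨by omega, by omega⟩ hT'

theorem Q20_opA (x : E.D) :
    S.Q20 (E.opA x) = E.opA (S.PLast 1 x + S.PWedge 1 x) := by
  rw [PLast_add_PWedge, opA_projD]
  refine Eq.symm (S.projY_congr (fun i r hr hT => ⟨Nat.succ_injective hT.1, rfl⟩) fun i r hr hT hT' => ?_)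
  have hT : r = 0 := hT
  subst hT
  rw [S.q_opA x hr, if_neg]
  exact fun h => hT' ⟨rfl, h⟩

theorem Q1_opA (x : E.D) : S.Q1 (E.opA x) = E.opA (S.P1 x) := by
  simp only [Q1, P1, LinearMap.sub_apply, LinearMap.id_apply, map_sub, opA_projD]
  refine congrArg _ (Eq.symm (S.projY_congr (fun i r _ _ => ⟨trivial, rfl⟩) fun i r hr _ h => ?_))
  rw [S.q_opA x hr, if_neg fun h' => h ⟨trivial, h'⟩]

theorem Q1_opB (x : E.D) : S.Q1 (E.opB x) = E.opB (S.P1 x) := by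
  simp [Q1, P1, opB_projD]

theorem QLast_opB (s : ℕ) (x : E.D) : S.QLast s (E.opB x) = E.opB (S.PLast s x) :=
  (S.opB_projD _ x).symm

theorem QSigma_opB (s : ℕ) (x : E.D) : S.QSigma s (E.opB x) = E.opB (S.PWedge s x) :=
  (S.opB_projD _ x).symm

theorem Q20_opB (x : E.D) : S.Q20 (E.opB x) = E.opB (S.projD S.eig x) :=
  (S.opB_projD _ x).symm

theorem projD_all_P1 (T : Fin S.n → ℕ → Prop) (x : E.D) : S.projD T (S.P1 x) = 0 := by
  rw [P1, LinearMap.sub_apply, map_sub, LinearMap.id_apply,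
    S.projD_projD (T' := S.all) (fun _ _ _ _ => trivial), sub_self]

theorem projD_of_mem_D1 (T : Fin S.n → ℕ → Prop) {x : E.D} (hx : x ∈ S.D1) :
    S.projD T x = 0 := by
  obtain ⟨z, rfl⟩ := hx
  exact S.projD_all_P1 T z

theorem P1_of_mem_D1 {x : E.D} (hx : x ∈ S.D1) : S.P1 x = x := by
  simp [P1, S.projD_of_mem_D1 S.all hx]

theorem p_of_mem_D1 {x : E.D} (hx : x ∈ S.D1) {i : Fin S.n} {r : ℕ} (hr : r < S.m i) :
    S.p i r (x : X) = 0 := by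
  have h := S.p_projD S.all x hr
  rw [S.projD_of_mem_D1 _ hx] at h
  simpa [all] using h.symm

theorem mem_D1_iff {x : E.D} : x ∈ S.D1 ↔ ∀ i r, r < S.m i → S.p i r (x : X) = 0 := by
  refine ⟨fun hx i r hr => S.p_of_mem_D1 hx hr, fun h => ⟨x, ?_⟩⟩
  rw [P1, LinearMap.sub_apply, S.projD_eq_zero fun i r hr _ => h i r hr]
  simp

theorem P1_of_mem_spanD {T : Fin S.n → ℕ → Prop} {x : E.D} (hx : x ∈ S.spanD T) :
    S.P1 x = 0 := by
  rw [P1, LinearMap.sub_apply, S.mem_spanD_iff.1 (S.spanD_mono (T' := S.all) (fun _ _ _ _ => trivial) hx)]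
  simp

theorem projY_all_Q1 (T : Fin S.n → ℕ → Prop) (y : Y) : S.projY T (S.Q1 y) = 0 := by
  rw [Q1, LinearMap.sub_apply, map_sub, LinearMap.id_apply,
    S.projY_projY (T' := S.all) (fun _ _ _ _ => trivial), sub_self]

theorem Q1_of_mem_Y1 {y : Y} (hy : y ∈ S.Y1) : S.Q1 y = y := by
  obtain ⟨z, rfl⟩ := hy
  have h := S.projY_all_Q1 S.all z
  change S.Q1 z - S.projY S.all (S.Q1 z) = S.Q1 z
  rw [h, sub_zero]

/-- A vector of `Y` is determined by its components under `Q₁`, `Q_{20}`, `Q_{2s}^{(s+1)}` and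
`Q_{2Σ,s}`. -/
theorem eq_of_components {y y' : Y} (h1 : S.Q1 y = S.Q1 y') (h20 : S.Q20 y = S.Q20 y')
    (hl : ∀ s ∈ Finset.Ico 1 ν, S.QLast s y = S.QLast s y')
    (hw : ∀ s ∈ Finset.Ico 1 (ν - 1), S.QSigma s y = S.QSigma s y') : y = y' := by
  have key : ∀ i r, r < S.m i → S.q i r y = S.q i r y' := by
    intro i r hr
    have hm := S.m_le i
    have aux : ∀ T : Fin S.n → ℕ → Prop, T i r → S.projY T y = S.projY T y' →
        S.q i r y = S.q i r y' := by
      intro T hT h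
      have := congrArg (S.q i r) h
      simpa [S.q_projY T _ hr, hT] using this
    rcases Nat.eq_zero_or_pos r with h0 | h0
    · exact aux _ h0 h20
    by_cases h : S.m i = r + 1
    · exact aux _ ⟨rfl, h⟩ (hl r (Finset.mem_Ico.2 ⟨h0, by omega⟩))
    · exact aux _ ⟨rfl, by omega⟩ (hw r (Finset.mem_Ico.2 ⟨h0, by omega⟩))
  have h2 : S.projY S.all y = S.projY S.all y' :=
    S.projY_congr (fun i r hr _ => ⟨trivial, key i r hr⟩) fun _ _ _ _ h => absurd trivial h
  simpa [Q1, h2] using h1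

theorem projD_adj_eq_sum (x : E.D) :
    S.projD S.adj x = ∑ j ∈ Finset.Ico 1 ν, S.PLast j x
      + ∑ j ∈ Finset.Ico 1 (ν - 1), S.PWedge j x := by
  classical
  have hl : ∀ j, S.PLast j x = S.projD S.all (S.PLast j x) := fun j =>
    (S.projD_projD_of_le (fun _ _ _ _ => trivial) x).symm
  have hw : ∀ j, S.PWedge j x = S.projD S.all (S.PWedge j x) := fun j =>
    (S.projD_projD_of_le (fun _ _ _ _ => trivial) x).symm
  rw [Finset.sum_congr rfl fun j _ => hl j, Finset.sum_congr rfl fun j _ => hw j, ← map_sum,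
    ← map_sum, ← map_add]
  have hcoef : ∀ i r, r < S.m i → S.p i r ((∑ j ∈ Finset.Ico 1 ν, S.PLast j x
      + ∑ j ∈ Finset.Ico 1 (ν - 1), S.PWedge j x : E.D) : X) =
      if 1 ≤ r then S.p i r (x : X) else 0 := by
    intro i r hr
    have hm := S.m_le i
    have h1 : ∀ j, S.p i r (S.PLast j x : X) =
        if r = j then (if S.m i = r + 1 then S.p i r (x : X) else 0) else 0 := by
      intro j
      rw [PLast, S.p_projD _ x hr]
      by_cases h : r = j
      · subst h; simp [last]
      · simp [last, h]
    have h2 : ∀ j, S.p i r (S.PWedge j x : X) =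
        if r = j then (if S.m i = r + 1 then 0 else S.p i r (x : X)) else 0 := by
      intro j
      rw [PWedge, S.p_projD _ x hr]
      by_cases h : r = j
      · subst h
        by_cases h' : S.m i = r + 1
        · simp [inner, h']
        · have : r + 2 ≤ S.m i := by omega
          simp [inner, h', this]
      · simp [inner, h]
    simp only [Submodule.coe_add, AddSubmonoidClass.coe_finsetSum, map_add, map_sum, h1, h2,
      Finset.sum_ite_eq, Finset.mem_Ico]
    by_cases h0 : 1 ≤ r
    · by_cases h' : S.m i = r + 1
      · have : r < ν := by omega
        simp [h0, h', this]
      · have : r < ν - 1 := by omega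
        simp [h0, h', this]
    · simp [h0]
  refine S.projD_congr (fun i r hr hT => ⟨trivial, ?_⟩) fun i r hr _ hT => ?_
  · rw [hcoef i r hr]; exact (if_pos hT).symm
  · rw [hcoef i r hr]; exact if_neg hT

theorem eq_add_components (x : E.D) : x = S.P1 x + S.projD S.eig x + S.projD S.adj x := by
  classical
  have : S.projD S.all x = S.projD S.eig x + S.projD S.adj x := by
    rw [projD_apply, projD_apply, projD_apply, ← Finset.sum_add_distrib]
    refine Finset.sum_congr rfl fun i _ => ?_
    rw [← Finset.sum_add_distrib]
    refine Finset.sum_congr rfl fun r _ => ?_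
    rcases Nat.eq_zero_or_pos r with h | h
    · simp [all, eig, adj, h]
    · have h1 : 1 ≤ r := h
      have h2 : r ≠ 0 := by omega
      simp [all, eig, adj, h1, h2]
  rw [add_assoc, ← this, P1]
  simp

theorem continuous_comp_projD {Z : Type*} [NormedAddCommGroup Z] [NormedSpace 𝕜 Z]
    (L : E.D →ₗ[𝕜] Z) (T : Fin S.n → ℕ → Prop) : Continuous fun x => L (S.projD T x) := by
  classical
  simp only [projD_apply, map_sum, apply_ite L, map_smul, map_zero]
  refine continuous_finsetSum _ fun i _ => continuous_finsetSum _ fun r _ => ?_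
  split_ifs
  · exact ((S.p i r).continuous.comp continuous_subtype_val).smul continuous_const
  · exact continuous_const

theorem continuous_projD (T : Fin S.n → ℕ → Prop) : Continuous (S.projD T) :=
  S.continuous_comp_projD LinearMap.id T

theorem continuous_P1 : Continuous S.P1 :=
  continuous_id.sub (S.continuous_projD S.all)

theorem continuous_projY (T : Fin S.n → ℕ → Prop) : Continuous (S.projY T) := by
  classical
  have : (S.projY T : Y → Y) = fun y => _ := funext fun y => S.projY_apply T y
  rw [this]
  refine continuous_finsetSum _ fun i _ => continuous_finsetSum _ fun r _ => ?_
  split_ifs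
  · exact (S.q i r).continuous.smul continuous_const
  · exact continuous_const

theorem continuous_Q1 : Continuous S.Q1 :=
  continuous_id.sub (S.continuous_projY S.all)

theorem isClosed_Y1 : IsClosed (S.Y1 : Set Y) := by
  have : (S.Y1 : Set Y) = {y | S.Q1 y = y} := by
    ext y
    exact ⟨fun h => S.Q1_of_mem_Y1 h, fun h => ⟨y, h⟩⟩
  rw [this]
  exact isClosed_eq S.continuous_Q1 continuous_id

instance completeSpace_Y1 [CompleteSpace Y] : CompleteSpace S.Y1 :=
  S.isClosed_Y1.completeSpace_coe

end RootSystem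

/-! ### The operator `A` on `D₁`, and the direct sums of the regions -/

variable {𝕜 X Y : Type*} [RCLike 𝕜] [NormedAddCommGroup X] [NormedSpace 𝕜 X]
  [NormedAddCommGroup Y] [NormedSpace 𝕜 Y]
  {E : OperatorPair 𝕜 X Y} {ν : ℕ}

theorem OperatorPair.IsRegularOfIndex.exists_solution (hE : E.IsRegularOfIndex ν) :
    ∃ r : ℝ, 0 < r ∧ ∀ a : ℝ, r ≤ a → ∀ y : Y, ∃ x : E.D, (a : 𝕜) • E.opA x + E.opB x = y := by
  obtain ⟨C, r, hr, h⟩ := hE.1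
  refine ⟨r, hr, fun a ha y => ?_⟩
  have ha' : r ≤ ‖(a : ℂ)‖ := by
    rw [Complex.norm_real, Real.norm_of_nonneg (hr.le.trans ha)]; exact ha
  obtain ⟨hreal, hcomplex⟩ := h a ha'
  by_cases hI : (RCLike.I : 𝕜) = 0
  · obtain ⟨R, -, -, hR⟩ := hreal hI
    obtain ⟨u, v, -, hu, -⟩ := hR (y, 0)
    exact ⟨u, by simpa using hu⟩
  · obtain ⟨R, -, -, hR⟩ := hcomplex hI
    obtain ⟨x, -, hx⟩ := hR y
    exact ⟨x, by simpa using hx⟩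

namespace RootSystem

variable (S : RootSystem E ν)

theorem mem_spanD_eig_of_opA_eq_zero {x : E.D} (hx : E.opA x = 0) : x ∈ S.spanD S.eig := by
  have h : x ∈ LinearMap.ker E.opA := hx
  rw [← S.span_eigenvectors] at h
  refine Submodule.span_mono ?_ h
  rintro _ ⟨i, rfl⟩
  exact ⟨i, 0, S.one_le_m i, rfl, rfl⟩

theorem eq_zero_of_opA_eq_zero {x : E.D} (hx : x ∈ S.D1) (h : E.opA x = 0) : x = 0 := by
  rw [← S.mem_spanD_iff.1 (S.mem_spanD_eig_of_opA_eq_zero h), S.projD_of_mem_D1 _ hx]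

theorem opA_mem_Y1 {x : E.D} (hx : x ∈ S.D1) : E.opA x ∈ S.Y1 :=
  ⟨E.opA x, by rw [Q1_opA, S.P1_of_mem_D1 hx]⟩

/-- The graph of the restriction of `A` to `D₁`. -/
noncomputable def graphD1 : Submodule 𝕜 (X × Y) := S.D1.map (E.D.subtype.prod E.opA)

theorem mem_graphD1 {z : X × Y} :
    z ∈ S.graphD1 ↔ ∃ x : E.D, x ∈ S.D1 ∧ (x : X) = z.1 ∧ E.opA x = z.2 := by
  simp only [graphD1, Submodule.mem_map]
  exact exists_congr fun x => and_congr_right fun _ => Prod.ext_iff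

theorem isClosed_graphD1 : IsClosed (S.graphD1 : Set (X × Y)) := by
  have : (S.graphD1 : Set (X × Y)) = (E.A.graph : Set (X × Y)) ∩
      ⋂ i, ⋂ r, ⋂ _ : r < S.m i, {z | S.p i r z.1 = 0} := by
    ext z
    simp only [SetLike.mem_coe, mem_graphD1, mem_inter_iff, mem_iInter, mem_ofPred_eq,
      LinearPMap.mem_graph_iff]
    constructor
    · rintro ⟨x, hx, h1, h2⟩
      exact ⟨⟨x, h1, h2⟩, fun i r hr => h1 ▸ S.p_of_mem_D1 hx hr⟩
    · rintro ⟨⟨x, h1, h2⟩, h⟩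
      exact ⟨x, S.mem_D1_iff.2 fun i r hr => by rw [h1]; exact h i r hr, h1, h2⟩
  rw [this]
  refine E.closed_A.inter (isClosed_iInter fun i => isClosed_iInter fun r => isClosed_iInter
    fun _ => isClosed_eq ?_ continuous_const)
  exact (S.p i r).continuous.comp continuous_fst

theorem isClosed_image_D1 : IsClosed (E.opA '' (S.D1 : Set E.D)) := by
  have : E.opA '' (S.D1 : Set E.D) = (LinearMap.range E.opA : Set Y) ∩ S.Y1 := by
    ext y
    constructor
    · rintro ⟨x, hx, rfl⟩
      exact ⟨⟨x, rfl⟩, S.opA_mem_Y1 hx⟩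
    · rintro ⟨⟨x, rfl⟩, h⟩
      exact ⟨S.P1 x, ⟨x, rfl⟩, by rw [← Q1_opA, S.Q1_of_mem_Y1 h]⟩
  rw [this]
  exact E.closed_range_A.inter S.isClosed_Y1

theorem mem_order_of_mem {s : ℕ} {d d' : E.D} (hd : d ∈ S.DLast s) (hd' : d' ∈ S.DWedge s) :
    d + d' ∈ S.spanD fun _ r => r = s :=
  Submodule.add_mem _ (S.spanD_mono (fun _ _ _ h => h.1) hd)
    (S.spanD_mono (fun _ _ _ h => h.1) hd')

theorem opA_mem_YSigma {s : ℕ} {d d' : E.D} (hd : d ∈ S.DLast (s + 1))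
    (hd' : d' ∈ S.DWedge (s + 1)) : E.opA (d + d') ∈ S.YSigma s := by
  have h := S.QSigma_opA s (d + d')
  rw [PLast_add_PWedge, S.mem_spanD_iff.1 (S.mem_order_of_mem hd hd')] at h
  rw [← h]
  exact S.projY_mem _ _

theorem FLast_congr (S : RootSystem E ν) (f : ℝ → E.D → Y) (s : ℕ) (t : ℝ) (y : E.D)
    {x x' : ℕ → E.D} (h : ∀ j ∈ Finset.Ico (s + 1) ν, x j = x' j) :
    S.FLast f s t y x = S.FLast f s t y x' := by
  rw [FLast, FLast, Finset.sum_congr rfl h]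

theorem FSigma_congr (S : RootSystem E ν) (f : ℝ → E.D → Y) (s : ℕ) (t : ℝ) (y d d' : E.D)
    {x x' z z' : ℕ → E.D} (h : ∀ j ∈ Finset.Ico 1 ν, x j = x' j)
    (h' : ∀ j ∈ Finset.Ico (s + 1) (ν - 1), z j = z' j) :
    S.FSigma f s t x y z d d' = S.FSigma f s t x' y z' d d' := by
  rw [FSigma, FSigma, Finset.sum_congr rfl h, Finset.sum_congr rfl h']

namespace Regions

variable {S}
variable (G : S.Regions)

theorem sumLast_subset {s : ℕ} (hs : 1 ≤ s) :
    G.sumLast s ⊆ (⨆ j ∈ Finset.Ico s ν, S.DLast j : Submodule 𝕜 E.D) := by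
  rintro _ ⟨u, hu, rfl⟩
  refine Submodule.sum_mem _ fun j hj => ?_
  refine Submodule.mem_iSup_of_mem j (Submodule.mem_iSup_of_mem hj ?_)
  have hj' := Finset.mem_Ico.1 hj
  exact (G.isOpen_MLast j (Finset.mem_Ico.2 ⟨hs.trans hj'.1, hj'.2⟩)).1 (hu j hj)

theorem sumWedge_subset {s : ℕ} (hs : 1 ≤ s) :
    G.sumWedge s ⊆ (⨆ j ∈ Finset.Ico s (ν - 1), S.DWedge j : Submodule 𝕜 E.D) := by
  rintro _ ⟨u, hu, rfl⟩
  refine Submodule.sum_mem _ fun j hj => ?_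
  refine Submodule.mem_iSup_of_mem j (Submodule.mem_iSup_of_mem hj ?_)
  have hj' := Finset.mem_Ico.1 hj
  exact (G.isOpen_MWedge j (Finset.mem_Ico.2 ⟨hs.trans hj'.1, hj'.2⟩)).1 (hu j hj)

theorem sumFrom_subset {s : ℕ} (hs : 1 ≤ s) :
    G.sumFrom s ⊆ ((⨆ j ∈ Finset.Ico 1 ν, S.DLast j) ⊔
      (⨆ j ∈ Finset.Ico s (ν - 1), S.DWedge j) : Submodule 𝕜 E.D) := by
  rintro _ ⟨u, hu, v, hv, rfl⟩
  exact Submodule.add_mem_sup (G.sumLast_subset le_rfl hu) (G.sumWedge_subset hs hv)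

theorem add_sum_mem_sumLast {s : ℕ} (hs : s < ν) {h : E.D} (hh : h ∈ G.MLast s) {x : ℕ → E.D}
    (hx : ∀ j ∈ Finset.Ico (s + 1) ν, x j ∈ G.MLast j) :
    h + ∑ j ∈ Finset.Ico (s + 1) ν, x j ∈ G.sumLast s := by
  refine ⟨Function.update x s h, fun j hj => ?_, ?_⟩
  · rcases eq_or_ne j s with rfl | hjs
    · simpa using hh
    · rw [Function.update_of_ne hjs]
      exact hx j (by simp only [Finset.mem_Ico] at hj ⊢; omega)
  · rw [Finset.sum_eq_sum_Ico_succ_bot hs, Function.update_self]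
    refine congrArg _ (Finset.sum_congr rfl fun j hj => ?_)
    rw [Function.update_of_ne]
    have := (Finset.mem_Ico.1 hj).1
    omega

theorem add_sum_mem_sumWedge {s : ℕ} (hs : s < ν - 1) {h : E.D} (hh : h ∈ G.MWedge s)
    {x : ℕ → E.D} (hx : ∀ j ∈ Finset.Ico (s + 1) (ν - 1), x j ∈ G.MWedge j) :
    h + ∑ j ∈ Finset.Ico (s + 1) (ν - 1), x j ∈ G.sumWedge s := by
  refine ⟨Function.update x s h, fun j hj => ?_, ?_⟩
  · rcases eq_or_ne j s with rfl | hjs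
    · simpa using hh
    · rw [Function.update_of_ne hjs]
      exact hx j (by simp only [Finset.mem_Ico] at hj ⊢; omega)
  · rw [Finset.sum_eq_sum_Ico_succ_bot hs, Function.update_self]
    refine congrArg _ (Finset.sum_congr rfl fun j hj => ?_)
    rw [Function.update_of_ne]
    have := (Finset.mem_Ico.1 hj).1
    omega

end Regions

variable [CompleteSpace X] [CompleteSpace Y]

/-- Boundedness from below of `A` on `D₁`, in the graph norm of `B`. It comes from the closed
range of `A` by the open mapping theorem, and from the closed graph theorem for `B`. -/
theorem exists_norm_le_opA : ∃ K : ℝ, 0 ≤ K ∧ ∀ x ∈ S.D1,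
    ‖x‖ ≤ K * ‖E.opA x‖ ∧ ‖E.opB x‖ ≤ K * ‖E.opA x‖ := by
  have : CompleteSpace S.graphD1 := S.isClosed_graphD1.completeSpace_coe
  let π : S.graphD1 →L[𝕜] Y := (ContinuousLinearMap.snd 𝕜 X Y).comp S.graphD1.subtypeL
  have hπr : range π = E.opA '' (S.D1 : Set E.D) := by
    ext y
    constructor
    · rintro ⟨⟨z, hz⟩, rfl⟩
      obtain ⟨x, hx, -, h2⟩ := S.mem_graphD1.1 hz
      exact ⟨x, hx, h2⟩
    · rintro ⟨x, hx, rfl⟩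
      exact ⟨⟨((x : X), E.opA x), S.mem_graphD1.2 ⟨x, hx, rfl, rfl⟩⟩, rfl⟩
  have hπi : Function.Injective π := by
    refine (injective_iff_map_eq_zero π).2 ?_
    rintro ⟨z, hz⟩ h
    obtain ⟨x, hx, h1, h2⟩ := S.mem_graphD1.1 hz
    have hx0 : x = 0 := S.eq_zero_of_opA_eq_zero hx (h2.trans h)
    refine Subtype.ext (Prod.ext ?_ h)
    rw [← h1, hx0]; rfl
  obtain ⟨K₁, hK₁⟩ := π.antilipschitz_of_injective_of_isClosed_range hπi
    (hπr ▸ S.isClosed_image_D1)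
  let β : S.graphD1 →ₗ[𝕜] Y := E.B.toFun ∘ₗ LinearMap.codRestrict E.B.domain
    (LinearMap.fst 𝕜 X Y ∘ₗ S.graphD1.subtype) (by
      rintro ⟨z, hz⟩
      obtain ⟨x, -, h1, -⟩ := S.mem_graphD1.1 hz
      have h2 : z.1 ∈ E.D := h1 ▸ x.2
      exact E.domain_le h2)
  have hβ : Continuous β := by
    refine β.continuous_of_seq_closed_graph fun u z y hu hy => ?_
    have h1 : Tendsto (fun n => ((u n).1.1, β (u n))) atTop (𝓝 (z.1.1, y)) :=
      (((continuous_fst.comp continuous_subtype_val).tendsto z).comp hu).prodMk_nhds hy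
    have h2 : (z.1.1, y) ∈ E.B.graph := by
      refine E.closed_B.mem_of_tendsto h1 (Eventually.of_forall fun n => ?_)
      exact E.B.mem_graph ⟨(u n).1.1, _⟩
    obtain ⟨b, hb1, hb2⟩ := (LinearPMap.mem_graph_iff _).1 h2
    simp only at hb1 hb2
    rw [← hb2]
    exact congrArg E.B.toFun (Subtype.ext hb1)
  let β' : S.graphD1 →L[𝕜] Y := ⟨β, hβ⟩
  refine ⟨max K₁ (‖β'‖ * K₁), le_max_of_le_left K₁.2, fun x hx => ?_⟩
  let z : S.graphD1 := ⟨((x : X), E.opA x), S.mem_graphD1.2 ⟨x, hx, rfl, rfl⟩⟩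
  have hz : ‖z‖ ≤ K₁ * ‖E.opA x‖ := by
    have := hK₁.le_mul_dist z 0
    rwa [map_zero, dist_zero_right, dist_zero_right] at this
  have hβz : β' z = E.opB x := rfl
  constructor
  · calc ‖x‖ ≤ ‖z‖ := norm_fst_le z.1
      _ ≤ K₁ * ‖E.opA x‖ := hz
      _ ≤ _ := by gcongr; exact le_max_left _ _
  · calc ‖E.opB x‖ = ‖β' z‖ := by rw [hβz]
      _ ≤ ‖β'‖ * (K₁ * ‖E.opA x‖) := (β'.le_opNorm z).trans (by gcongr)
      _ = ‖β'‖ * K₁ * ‖E.opA x‖ := by ring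
      _ ≤ _ := by gcongr; exact le_max_right _ _

/-- `A` maps `D₁` onto `Y₁`: the solutions `x` of `λ A x + B x = y` satisfy `A (λ x) → y` as
`λ → ∞`, since `A` is bounded below on `D₁`, and the range is closed. -/
theorem exists_opA_eq (hE : E.IsRegularOfIndex ν) {y : Y} (hy : y ∈ S.Y1) :
    ∃ x ∈ S.D1, E.opA x = y := by
  obtain ⟨K, hK0, hK⟩ := S.exists_norm_le_opA
  obtain ⟨r, hr, hsol⟩ := hE.exists_solution
  suffices y ∈ closure (E.opA '' (S.D1 : Set E.D)) by
    rw [S.isClosed_image_D1.closure_eq] at this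
    obtain ⟨x, hx, h⟩ := this
    exact ⟨x, hx, h⟩
  refine Metric.mem_closure_iff.2 fun ε hε => ?_
  set a : ℝ := max r (max (2 * K) (2 * K * ‖y‖ / ε)) + 1 with ha
  have ha1 : r ≤ a := (le_max_left _ _).trans (le_add_of_nonneg_right zero_le_one)
  have ha2 : 2 * K ≤ a := ((le_max_left _ _).trans (le_max_right _ _)).trans
    (le_add_of_nonneg_right zero_le_one)
  have ha3 : 2 * K * ‖y‖ / ε < a :=
    ((le_max_right _ _).trans (le_max_right _ _)).trans_lt (lt_add_one _)
  have ha0 : 0 < a := hr.trans_le ha1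
  obtain ⟨x, hx⟩ := hsol a ha1 y
  have h1 : (a : 𝕜) • E.opA (S.P1 x) + E.opB (S.P1 x) = y := by
    have := congrArg S.Q1 hx
    rwa [map_add, map_smul, Q1_opA, Q1_opB, S.Q1_of_mem_Y1 hy] at this
  set z : E.D := (a : 𝕜) • S.P1 x with hz
  have hzD : z ∈ S.D1 := S.D1.smul_mem _ ⟨x, rfl⟩
  have hBz : ‖E.opB (S.P1 x)‖ * a ≤ K * ‖E.opA z‖ := by
    have := (hK z hzD).2
    rw [hz, map_smul, norm_smul] at this
    rw [hz]
    simpa [abs_of_pos ha0, mul_comm] using this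
  have h2 : E.opA z = y - E.opB (S.P1 x) := by rw [hz, map_smul]; exact eq_sub_of_add_eq h1
  have h3 : ‖E.opA z‖ ≤ ‖y‖ + ‖E.opB (S.P1 x)‖ := h2 ▸ norm_sub_le _ _
  have h4 : ‖E.opA z‖ ≤ 2 * ‖y‖ := by
    have : 2 * ‖E.opB (S.P1 x)‖ * a ≤ a * ‖E.opA z‖ := by
      nlinarith [norm_nonneg (E.opA z)]
    have : 2 * ‖E.opB (S.P1 x)‖ ≤ ‖E.opA z‖ := by
      refine le_of_mul_le_mul_right ?_ ha0; linarith
    linarith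
  refine ⟨E.opA z, ⟨z, hzD, rfl⟩, ?_⟩
  rw [dist_eq_norm, h2, sub_sub_cancel]
  have h5 : ‖E.opB (S.P1 x)‖ * a ≤ 2 * K * ‖y‖ := by nlinarith
  have h6 : 2 * K * ‖y‖ < a * ε := by rwa [div_lt_iff₀ hε] at ha3
  nlinarith

/-- The bounded inverse `Y₁ → D₁` of the restriction of `A`, together with the bounded operator
`B A⁻¹` on `Y₁`. -/
theorem exists_inverse (hE : E.IsRegularOfIndex ν) :
    ∃ (T : S.Y1 →L[𝕜] E.D) (BT : S.Y1 →L[𝕜] Y), (∀ w, T w ∈ S.D1) ∧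
      (∀ w, E.opA (T w) = w) ∧ (∀ w, BT w = E.opB (T w)) ∧
      ∀ x ∈ S.D1, ∀ w : S.Y1, E.opA x = w → T w = x := by
  obtain ⟨K, hK0, hK⟩ := S.exists_norm_le_opA
  let A₁ : S.D1 →ₗ[𝕜] S.Y1 := (E.opA ∘ₗ S.D1.subtype).codRestrict S.Y1
    fun x => S.opA_mem_Y1 x.2
  have hA₁ : Function.Bijective A₁ := by
    constructor
    · refine (injective_iff_map_eq_zero A₁).2 fun x hx => ?_
      exact Subtype.ext (S.eq_zero_of_opA_eq_zero x.2 (congrArg Subtype.val hx))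
    · rintro ⟨y, hy⟩
      obtain ⟨x, hx, h⟩ := S.exists_opA_eq hE hy
      exact ⟨⟨x, hx⟩, Subtype.ext h⟩
  let e := LinearEquiv.ofBijective A₁ hA₁
  have he : ∀ w, E.opA (e.symm w : E.D) = w := fun w =>
    congrArg Subtype.val (e.apply_symm_apply w)
  let T₀ : S.Y1 →ₗ[𝕜] E.D := S.D1.subtype ∘ₗ e.symm.toLinearMap
  refine ⟨T₀.mkContinuous K fun w => ?_, (E.opB ∘ₗ T₀).mkContinuous K fun w => ?_,
    fun w => (e.symm w).2, he, fun w => rfl, fun x hx w h => ?_⟩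
  · have := (hK _ (e.symm w).2).1
    rwa [he] at this
  · have := (hK _ (e.symm w).2).2
    rwa [he] at this
  · have : e.symm w = ⟨x, hx⟩ := by
      rw [LinearEquiv.symm_apply_eq]
      exact Subtype.ext h.symm
    exact congrArg Subtype.val this

end RootSystem

/-! ### Solution of the algebraic equations for the adjoined components -/

section Constraints

variable {𝕜 X Y : Type*} [RCLike 𝕜] [NormedAddCommGroup X] [NormedSpace 𝕜 X]
  [NormedSpace ℝ X] [IsScalarTower ℝ 𝕜 X]
  [NormedAddCommGroup Y] [NormedSpace 𝕜 Y] [NormedSpace ℝ Y] [IsScalarTower ℝ 𝕜 Y]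
  {E : OperatorPair 𝕜 X Y} {ν : ℕ}

namespace RootSystem

section

variable (S : RootSystem E ν)

/-- The composition of a linear map on `D` with the projector onto a span of root vectors, as a
bounded real linear operator. -/
noncomputable def compProjL {Z : Type*} [NormedAddCommGroup Z] [NormedSpace 𝕜 Z] [NormedSpace ℝ Z]
    [IsScalarTower ℝ 𝕜 Z] (L : E.D →ₗ[𝕜] Z) (T : Fin S.n → ℕ → Prop) : E.D →L[ℝ] Z :=
  ContinuousLinearMap.restrictScalars ℝ
    (⟨L ∘ₗ S.projD T, S.continuous_comp_projD L T⟩ : E.D →L[𝕜] Z)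

theorem compProjL_apply {Z : Type*} [NormedAddCommGroup Z] [NormedSpace 𝕜 Z] [NormedSpace ℝ Z]
    [IsScalarTower ℝ 𝕜 Z] (L : E.D →ₗ[𝕜] Z) (T : Fin S.n → ℕ → Prop) (x : E.D) :
    S.compProjL L T x = L (S.projD T x) := rfl

theorem compProjL_of_mem {Z : Type*} [NormedAddCommGroup Z] [NormedSpace 𝕜 Z] [NormedSpace ℝ Z]
    [IsScalarTower ℝ 𝕜 Z] (L : E.D →ₗ[𝕜] Z) {T : Fin S.n → ℕ → Prop} {x : E.D}
    (hx : x ∈ S.spanD T) : S.compProjL L T x = L x := by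
  rw [compProjL_apply, S.mem_spanD_iff.1 hx]

theorem derivWithin_mem_spanD {T : Fin S.n → ℕ → Prop} {x : ℝ → E.D}
    (hx : ∀ t, 0 ≤ t → x t ∈ S.spanD T) (hd : DifferentiableOn ℝ x (Ici 0)) {t : ℝ} (ht : 0 ≤ t) :
    derivWithin x (Ici 0) t ∈ S.spanD T := by
  have h1 := (hd t ht).hasDerivWithinAt
  have h2 : HasDerivWithinAt (fun τ => S.compProjL LinearMap.id T (x τ))
      (S.compProjL LinearMap.id T (derivWithin x (Ici 0) t)) (Ici 0) t :=
    (S.compProjL LinearMap.id T).hasFDerivAt.comp_hasDerivWithinAt t h1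
  have h3 : HasDerivWithinAt x (S.compProjL LinearMap.id T (derivWithin x (Ici 0) t)) (Ici 0) t :=
    h2.congr (fun τ hτ => (S.compProjL_of_mem LinearMap.id (hx τ hτ)).symm)
      (S.compProjL_of_mem LinearMap.id (hx t ht)).symm
  rw [S.mem_spanD_iff]
  exact (uniqueDiffOn_Ici 0 t ht).eq_deriv _ h3 h1

end

/-- The one-sided implicit function theorem for an equation between finite-dimensional subspaces
of `D` and `Y`. -/
theorem contDiffOn_of_equation {H : Submodule 𝕜 E.D} {K : Submodule 𝕜 Y} [FiniteDimensional 𝕜 H]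
    [FiniteDimensional 𝕜 K] {M : Set E.D} (hM : IsOpenIn H M) {Φ : ℝ → E.D → Y} {n : ℕ}
    (hn : 1 ≤ n)
    (hΦ : ContDiffOn ℝ n (fun z : ℝ × H => Φ z.1 z.2) {z | 0 ≤ z.1 ∧ (z.2 : E.D) ∈ M})
    (hK : ∀ t, 0 ≤ t → ∀ h ∈ H, Φ t h ∈ K) {y : ℝ → E.D} (hy : ∀ t, 0 ≤ t → y t ∈ M)
    (hy0 : ∀ t, 0 ≤ t → Φ t (y t) = 0) (huniq : ∀ t, 0 ≤ t → ∀ h ∈ M, Φ t h = 0 → h = y t)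
    (hinv : ∀ t, 0 ≤ t → ∀ h : H, (h : E.D) ∈ M → Φ t h = 0 → InvertibleDerivAt H K (Φ t) h) :
    ContDiffOn ℝ n y (Ici 0) := by
  have : CompleteSpace H := FiniteDimensional.complete 𝕜 H
  obtain ⟨πH, hπH⟩ := Submodule.ClosedComplemented.of_finiteDimensional H
  obtain ⟨πK, hπK⟩ := Submodule.ClosedComplemented.of_finiteDimensional K
  have hyH : ∀ t, 0 ≤ t → (πH (y t) : E.D) = y t := fun t ht =>
    congrArg Subtype.val (hπH ⟨y t, hM.1 (hy t ht)⟩)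
  have hΦK : ∀ t, 0 ≤ t → ∀ h : H, (πK (Φ t h) : Y) = Φ t h := fun t ht h =>
    congrArg Subtype.val (hπK ⟨Φ t h, hK t ht h h.2⟩)
  have hset : {z : ℝ × H | 0 ≤ z.1 ∧ (z.2 : E.D) ∈ M} =
      Ici 0 ×ˢ ((fun h : H => (h : E.D)) ⁻¹' M) := rfl
  rw [hset] at hΦ
  have key : ContDiffOn ℝ n (fun t => πH (y t)) (Ici 0) := by
    refine contDiffOn_implicit (F := fun z : ℝ × H => πK (Φ z.1 z.2)) hM.2 hn
      ((πK.restrictScalars ℝ).contDiff.comp_contDiffOn hΦ) (fun t ht => ?_) (fun t ht => ?_)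
      (fun t ht h hh h0 => ?_) (fun t ht => ?_)
    · simp only [mem_preimage, hyH t ht, hy t ht]
    · simp only [hyH t ht, hy0 t ht, map_zero]
    · have h1 : Φ t h = 0 := by rw [← hΦK t ht h]; simpa using h0
      exact Subtype.ext ((huniq t ht h hh h1).trans (hyH t ht).symm)
    · obtain ⟨W, hW⟩ := hinv t ht (πH (y t)) (by rw [hyH t ht]; exact hy t ht)
        (by rw [hyH t ht]; exact hy0 t ht)
      refine ⟨W, ?_⟩
      have h1 := (πK.restrictScalars ℝ).hasFDerivAt.comp (πH (y t)) hW
      refine h1.congr_fderiv ?_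
      ext h
      exact congrArg Subtype.val (hπK (W h))
  have h2 : ContDiffOn ℝ n (fun t => (πH (y t) : E.D)) (Ici 0) :=
    (H.subtypeL.restrictScalars ℝ).contDiff.comp_contDiffOn key
  exact h2.congr fun t ht => (hyH t ht).symm

/-- The substitution of a smooth curve of vectors into a map that is smooth on a
finite-dimensional subspace. -/
theorem contDiffOn_comp_subspace {H H' : Submodule 𝕜 E.D} [FiniteDimensional 𝕜 H'] {N M : Set E.D}
    {g : ℝ → E.D → Y} {n : ℕ}
    (hg : ContDiffOn ℝ n (fun z : ℝ × H' => g z.1 z.2) {z | 0 ≤ z.1 ∧ (z.2 : E.D) ∈ N})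
    (hN : N ⊆ H') {c : ℝ → E.D} (hc : ContDiffOn ℝ n c (Ici 0))
    (hmem : ∀ t, 0 ≤ t → ∀ h ∈ M, h + c t ∈ N) :
    ContDiffOn ℝ n (fun z : ℝ × H => g z.1 (z.2 + c z.1)) {z | 0 ≤ z.1 ∧ (z.2 : E.D) ∈ M} := by
  obtain ⟨π, hπ⟩ := Submodule.ClosedComplemented.of_finiteDimensional H'
  have hπ' : ∀ x ∈ N, (π x : E.D) = x := fun x hx => congrArg Subtype.val (hπ ⟨x, hN hx⟩)
  have h1 : ContDiffOn ℝ n (fun z : ℝ × H => (z.1, π ((z.2 : E.D) + c z.1)))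
      {z | 0 ≤ z.1 ∧ (z.2 : E.D) ∈ M} := by
    refine contDiff_fst.contDiffOn.prodMk ((π.restrictScalars ℝ).contDiff.comp_contDiffOn
      (ContDiffOn.add ?_ ?_))
    · exact ((H.subtypeL.restrictScalars ℝ).contDiff.comp contDiff_snd).contDiffOn
    · exact hc.comp contDiff_fst.contDiffOn fun z hz => hz.1
  refine (hg.comp h1 fun z hz => ⟨hz.1, ?_⟩).congr fun z hz => ?_
  · simp only [hπ' _ (hmem z.1 hz.1 z.2 hz.2)]
    exact hmem z.1 hz.1 z.2 hz.2
  · simp only [Function.comp_apply, hπ' _ (hmem z.1 hz.1 z.2 hz.2)]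

theorem contDiff_opB {n : ℕ} (H : Submodule 𝕜 E.D) [FiniteDimensional 𝕜 H] :
    ContDiff ℝ n fun z : ℝ × H => E.opB (z.2 : E.D) :=
  ((LinearMap.toContinuousLinearMap (E.opB ∘ₗ H.subtype)).restrictScalars ℝ).contDiff.comp
    contDiff_snd

namespace Regions

variable {S : RootSystem E ν} (G : S.Regions)

/-- The components `x_{2j}^{(j+1)}(t)` are determined by the equations `F_{2j}^{(j+1)} = 0`, one
after another from the highest order downwards, as smooth functions of time alone. -/
theorem exists_last_family {f : ℝ → E.D → Y} (hsm : G.Smoothness f)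
    (hun : G.UniqueSolvability f) (hinv : G.Invertibility f) :
    ∃ x : ℕ → ℝ → E.D, ∀ j ∈ Finset.Ico 1 ν, (∀ t, 0 ≤ t → x j t ∈ G.MLast j) ∧
      (∀ t, 0 ≤ t → S.FLast f j t (x j t) (fun i => x i t) = 0) ∧
      ContDiffOn ℝ (if j = ν - 1 then ν - 1 else ν - 2 : ℕ) (x j) (Ici 0) := by
  suffices ∀ k : ℕ, ∃ x : ℕ → ℝ → E.D, (∀ j ∈ Finset.Ico (ν - k) ν, 1 ≤ j →
      (∀ t, 0 ≤ t → x j t ∈ G.MLast j) ∧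
      (∀ t, 0 ≤ t → S.FLast f j t (x j t) (fun i => x i t) = 0) ∧
      ContDiffOn ℝ (if j = ν - 1 then ν - 1 else ν - 2 : ℕ) (x j) (Ici 0)) ∧
      ∀ j, ν ≤ j → x j = 0 by
    obtain ⟨x, hx, -⟩ := this ν
    refine ⟨x, fun j hj => ?_⟩
    have := Finset.mem_Ico.1 hj
    exact hx j (Finset.mem_Ico.2 ⟨by omega, this.2⟩) this.1
  intro k
  induction k with
  | zero => exact ⟨0, fun j hj => by simp at hj, fun _ _ => rfl⟩
  | succ k ih =>
    obtain ⟨x, hx, hx0⟩ := ih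
    by_cases hs0 : ν - (k + 1) = 0
    · exact ⟨x, fun j hj h1 => hx j (by simp only [Finset.mem_Ico] at hj ⊢; omega) h1, hx0⟩
    obtain ⟨s, hs⟩ : ∃ s, ν - (k + 1) = s := ⟨_, rfl⟩
    have hs1 : 1 ≤ s := by omega
    have hsk : ν - k = s + 1 := by omega
    have hsν : s < ν := by omega
    have hsI : s ∈ Finset.Ico 1 ν := Finset.mem_Ico.2 ⟨hs1, hsν⟩
    rw [hsk] at hx
    have hxm : ∀ t, 0 ≤ t → ∀ j ∈ Finset.Ico (s + 1) ν, x j t ∈ G.MLast j := fun t ht j hj =>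
      (hx j hj (by have := (Finset.mem_Ico.1 hj).1; omega)).1 t ht
    choose! y hy hyu using fun t (ht : 0 ≤ t) => hun.last s hsI t ht (fun j => x j t) (hxm t ht)
    have hn : 1 ≤ (if s = ν - 1 then ν - 1 else ν - 2 : ℕ) := by split_ifs <;> omega
    have hc : ContDiffOn ℝ (if s = ν - 1 then ν - 1 else ν - 2 : ℕ)
        (fun t => ∑ j ∈ Finset.Ico (s + 1) ν, x j t) (Ici 0) := by
      refine ContDiffOn.sum fun j hj => ?_
      have hj' := Finset.mem_Ico.1 hj
      refine (hx j hj (by omega)).2.2.of_le ?_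
      rw [if_neg (by omega : s ≠ ν - 1)]
      split_ifs <;> exact_mod_cast (by omega)
    have hg : ContDiffOn ℝ (if s = ν - 1 then ν - 1 else ν - 2 : ℕ)
        (fun z : ℝ × S.DLast s => S.QLast s (f z.1 (z.2 + ∑ j ∈ Finset.Ico (s + 1) ν, x j z.1)))
        {z | 0 ≤ z.1 ∧ (z.2 : E.D) ∈ G.MLast s} := by
      by_cases hst : s = ν - 1
      · have hνs : ν = s + 1 := by omega
        rw [if_pos hst]
        have h2 := hsm.top (by omega)
        rw [← hst] at h2 ⊢
        refine h2.congr fun z hz => ?_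
        rw [Finset.Ico_eq_empty (by omega), Finset.sum_empty, add_zero]
      · rw [if_neg hst] at hc ⊢
        have : FiniteDimensional 𝕜 (⨆ j ∈ Finset.Ico s ν, S.DLast j : Submodule 𝕜 E.D) :=
          Submodule.finiteDimensional_of_le (S₂ := S.spanD S.all)
            (iSup₂_le fun j _ => S.spanD_mono fun _ _ _ _ => trivial)
        exact contDiffOn_comp_subspace (g := fun t x => S.QLast s (f t x))
          (hsm.last s (Finset.mem_Ico.2 ⟨hs1, by omega⟩)) (G.sumLast_subset hs1) hc
          fun t ht h hh => G.add_sum_mem_sumLast hsν hh (hxm t ht)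
    have hsmooth : ContDiffOn ℝ (if s = ν - 1 then ν - 1 else ν - 2 : ℕ) y (Ici 0) := by
      refine contDiffOn_of_equation (G.isOpen_MLast s hsI) (K := S.YLast s) hn
        (Φ := fun t h => S.FLast f s t h fun j => x j t) ?_ ?_ (fun t ht => (hy t ht).1)
        (fun t ht => (hy t ht).2) (fun t ht h hh h0 => hyu t ht h ⟨hh, h0⟩)
        (fun t ht h hh h0 => hinv.last s hsI t ht _ (hxm t ht) h hh h0)
      · exact hg.sub (contDiff_opB _).contDiffOn
      · exact fun t ht h hh => Submodule.sub_mem _ (S.projY_mem _ _) (S.opB_mem_spanY hh)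
    refine ⟨Function.update x s y, fun j hj h1 => ?_, fun j hj => ?_⟩
    · rw [hs] at hj
      have hupd : ∀ t, ∀ i ∈ Finset.Ico (j + 1) ν, Function.update x s y i t = x i t := by
        intro t i hi
        have := (Finset.mem_Ico.1 hi).1
        have := (Finset.mem_Ico.1 hj).1
        rw [Function.update_of_ne (by omega)]
      rcases eq_or_ne j s with rfl | hjs
      · rw [Function.update_self]
        refine ⟨fun t ht => (hy t ht).1, fun t ht => ?_, hsmooth⟩
        rw [S.FLast_congr f j t _ (hupd t)]
        exact (hy t ht).2
      · rw [Function.update_of_ne hjs]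
        obtain ⟨h2, h3, h4⟩ := hx j (by simp only [Finset.mem_Ico] at hj ⊢; omega) h1
        refine ⟨h2, fun t ht => ?_, h4⟩
        rw [S.FLast_congr f j t _ (hupd t)]
        exact h3 t ht
    · rw [Function.update_of_ne (by omega)]
      exact hx0 j hj

/-- The components `x_{2∧,s}(t)` are determined by the equations `F_{2Σ,s} = 0` as smooth functions
of time alone: their order of smoothness drops by one with each step, because the equation of
order `s` contains the derivatives of the components of order `s + 1`. -/
theorem exists_wedge_family {f : ℝ → E.D → Y} (hsm : G.Smoothness f)
    (hun : G.UniqueSolvability f) (hinv : G.Invertibility f) {x : ℕ → ℝ → E.D}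
    (hx : ∀ j ∈ Finset.Ico 1 ν, (∀ t, 0 ≤ t → x j t ∈ G.MLast j) ∧
      ContDiffOn ℝ (if j = ν - 1 then ν - 1 else ν - 2 : ℕ) (x j) (Ici 0)) :
    ∃ z : ℕ → ℝ → E.D, (∀ s ∈ Finset.Ico 1 (ν - 1), (∀ t, 0 ≤ t → z s t ∈ G.MWedge s) ∧
      (∀ t, 0 ≤ t → S.FSigma f s t (fun i => x i t) (z s t) (fun i => z i t)
        (derivWithin (x (s + 1)) (Ici 0) t) (derivWithin (z (s + 1)) (Ici 0) t) = 0) ∧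
      ContDiffOn ℝ s (z s) (Ici 0)) ∧ ∀ s, ν - 1 ≤ s → z s = 0 := by
  suffices ∀ k : ℕ, ∃ z : ℕ → ℝ → E.D, (∀ s ∈ Finset.Ico (ν - 1 - k) (ν - 1), 1 ≤ s →
      (∀ t, 0 ≤ t → z s t ∈ G.MWedge s) ∧
      (∀ t, 0 ≤ t → S.FSigma f s t (fun i => x i t) (z s t) (fun i => z i t)
        (derivWithin (x (s + 1)) (Ici 0) t) (derivWithin (z (s + 1)) (Ici 0) t) = 0) ∧
      ContDiffOn ℝ s (z s) (Ici 0)) ∧ ∀ s, ν - 1 ≤ s → z s = 0 by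
    obtain ⟨z, hz, hz0⟩ := this ν
    refine ⟨z, fun j hj => ?_, hz0⟩
    have := Finset.mem_Ico.1 hj
    exact hz j (Finset.mem_Ico.2 ⟨by omega, this.2⟩) this.1
  intro k
  induction k with
  | zero => exact ⟨0, fun j hj => by simp at hj, fun _ _ => rfl⟩
  | succ k ih =>
    obtain ⟨z, hz, hz0⟩ := ih
    by_cases hs0 : ν - 1 - (k + 1) = 0
    · exact ⟨z, fun j hj h1 => hz j (by simp only [Finset.mem_Ico] at hj ⊢; omega) h1, hz0⟩
    obtain ⟨s, hs⟩ : ∃ s, ν - 1 - (k + 1) = s := ⟨_, rfl⟩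
    have hs1 : 1 ≤ s := by omega
    have hsk : ν - 1 - k = s + 1 := by omega
    have hsν : s < ν - 1 := by omega
    have hsI : s ∈ Finset.Ico 1 (ν - 1) := Finset.mem_Ico.2 ⟨hs1, hsν⟩
    rw [hsk] at hz
    have hzm : ∀ t, 0 ≤ t → ∀ j ∈ Finset.Ico (s + 1) (ν - 1), z j t ∈ G.MWedge j :=
      fun t ht j hj => (hz j hj (by have := (Finset.mem_Ico.1 hj).1; omega)).1 t ht
    have hxm : ∀ t, 0 ≤ t → ∀ j ∈ Finset.Ico 1 ν, x j t ∈ G.MLast j :=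
      fun t ht j hj => (hx j hj).1 t ht
    have hs1I : s + 1 ∈ Finset.Ico 1 ν := Finset.mem_Ico.2 ⟨by omega, by omega⟩
    -- the derivatives of the components of order `s + 1` are of class `C^s`
    have hxs : ContDiffOn ℝ ((s : WithTop ℕ∞) + 1) (x (s + 1)) (Ici 0) := by
      refine (hx (s + 1) hs1I).2.of_le ?_
      split_ifs <;> exact_mod_cast (by omega)
    have hzs : ContDiffOn ℝ ((s : WithTop ℕ∞) + 1) (z (s + 1)) (Ici 0) := by
      by_cases h : s + 1 < ν - 1
      · exact_mod_cast (hz (s + 1) (Finset.mem_Ico.2 ⟨le_rfl, h⟩) (by omega)).2.2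
      · rw [hz0 (s + 1) (by omega)]
        exact contDiffOn_const
    have hdx := ((contDiffOn_succ_iff_derivWithin (uniqueDiffOn_Ici 0)).1 hxs)
    have hdz := ((contDiffOn_succ_iff_derivWithin (uniqueDiffOn_Ici 0)).1 hzs)
    have hdm : ∀ t, 0 ≤ t → derivWithin (x (s + 1)) (Ici 0) t ∈ S.DLast (s + 1) := fun t ht =>
      S.derivWithin_mem_spanD (fun τ hτ => (G.isOpen_MLast _ hs1I).1 (hxm τ hτ _ hs1I)) hdx.1 ht
    have hdm' : ∀ t, 0 ≤ t → derivWithin (z (s + 1)) (Ici 0) t ∈ S.DWedge (s + 1) := by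
      intro t ht
      refine S.derivWithin_mem_spanD (fun τ hτ => ?_) hdz.1 ht
      by_cases h : s + 1 < ν - 1
      · exact (G.isOpen_MWedge _ (Finset.mem_Ico.2 ⟨by omega, h⟩)).1
          (hzm τ hτ _ (Finset.mem_Ico.2 ⟨le_rfl, h⟩))
      · rw [hz0 (s + 1) (by omega)]
        exact Submodule.zero_mem _
    choose! y hy hyu using fun t (ht : 0 ≤ t) => hun.wedge s hsI t ht (fun j => x j t)
      (fun j => z j t) (hxm t ht) (hzm t ht) _ (hdm t ht) _ (hdm' t ht)
    have hc : ContDiffOn ℝ s (fun t => ∑ j ∈ Finset.Ico 1 ν, x j t +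
        ∑ j ∈ Finset.Ico (s + 1) (ν - 1), z j t) (Ici 0) := by
      refine (ContDiffOn.sum fun j hj => ?_).add (ContDiffOn.sum fun j hj => ?_)
      · refine (hx j hj).2.of_le ?_
        split_ifs <;> exact_mod_cast (by omega)
      · have hj' := Finset.mem_Ico.1 hj
        refine (hz j hj (by omega)).2.2.of_le ?_
        exact_mod_cast (by omega)
    have hg : ContDiffOn ℝ s (fun w : ℝ × S.DWedge s => S.QSigma s (f w.1
        (w.2 + (∑ j ∈ Finset.Ico 1 ν, x j w.1 + ∑ j ∈ Finset.Ico (s + 1) (ν - 1), z j w.1))))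
        {w | 0 ≤ w.1 ∧ (w.2 : E.D) ∈ G.MWedge s} := by
      have : FiniteDimensional 𝕜 ((⨆ j ∈ Finset.Ico 1 ν, S.DLast j) ⊔
          (⨆ j ∈ Finset.Ico s (ν - 1), S.DWedge j) : Submodule 𝕜 E.D) :=
        Submodule.finiteDimensional_of_le (S₂ := S.spanD S.all) (sup_le
          (iSup₂_le fun j _ => S.spanD_mono fun _ _ _ _ => trivial)
          (iSup₂_le fun j _ => S.spanD_mono fun _ _ _ _ => trivial))
      refine contDiffOn_comp_subspace (g := fun t x => S.QSigma s (f t x))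
        (hsm.wedge s hsI) (G.sumFrom_subset hs1) hc fun t ht h hh => ?_
      refine ⟨_, ⟨fun j => x j t, hxm t ht, rfl⟩, _, G.add_sum_mem_sumWedge hsν hh (hzm t ht), ?_⟩
      abel
    have hA : ContDiffOn ℝ s (fun t => S.compProjL E.opA S.all
        (derivWithin (x (s + 1)) (Ici 0) t + derivWithin (z (s + 1)) (Ici 0) t)) (Ici 0) :=
      (S.compProjL E.opA S.all).contDiff.comp_contDiffOn (hdx.2.2.add hdz.2.2)
    have hsmooth : ContDiffOn ℝ s y (Ici 0) := by
      refine contDiffOn_of_equation (G.isOpen_MWedge s hsI) (K := S.YSigma s) hs1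
        (Φ := fun t h => S.FSigma f s t (fun j => x j t) h (fun j => z j t)
          (derivWithin (x (s + 1)) (Ici 0) t) (derivWithin (z (s + 1)) (Ici 0) t)) ?_ ?_
        (fun t ht => (hy t ht).1)
        (fun t ht => (hy t ht).2) (fun t ht h hh h0 => hyu t ht h ⟨hh, h0⟩)
        (fun t ht h hh h0 => hinv.wedge s hsI t ht _ _ (hxm t ht) (hzm t ht) _ (hdm t ht) _
          (hdm' t ht) h hh h0)
      · refine ((hg.sub (contDiff_opB _).contDiffOn).sub
          (hA.comp contDiff_fst.contDiffOn fun w hw => hw.1)).congr fun w hw => ?_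
        simp only [FSigma, Function.comp_apply]
        rw [S.compProjL_of_mem E.opA (S.spanD_mono (T' := S.all) (fun _ _ _ _ => trivial)
          (S.mem_order_of_mem (hdm w.1 hw.1) (hdm' w.1 hw.1)))]
        rw [add_comm (∑ j ∈ Finset.Ico 1 ν, x j w.1) (w.2 : E.D), add_assoc]
      · exact fun t ht h hh => Submodule.sub_mem _
          (Submodule.sub_mem _ (S.projY_mem _ _) (S.opB_mem_spanY hh))
          (S.opA_mem_YSigma (hdm t ht) (hdm' t ht))
    refine ⟨Function.update z s y, fun j hj h1 => ?_, fun j hj => ?_⟩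
    · rw [hs] at hj
      have hupd : ∀ t, ∀ i ∈ Finset.Ico (j + 1) (ν - 1), Function.update z s y i t = z i t := by
        intro t i hi
        have := (Finset.mem_Ico.1 hi).1
        have := (Finset.mem_Ico.1 hj).1
        rw [Function.update_of_ne (by omega)]
      have hjs : j + 1 ≠ s := by have := (Finset.mem_Ico.1 hj).1; omega
      rw [Function.update_of_ne hjs]
      rcases eq_or_ne j s with rfl | hjs
      · rw [Function.update_self]
        refine ⟨fun t ht => (hy t ht).1, fun t ht => ?_, hsmooth⟩
        rw [S.FSigma_congr f j t _ _ _ (fun _ _ => rfl) (hupd t)]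
        exact (hy t ht).2
      · rw [Function.update_of_ne hjs]
        obtain ⟨h2, h3, h4⟩ := hz j (by simp only [Finset.mem_Ico] at hj ⊢; omega) h1
        refine ⟨h2, fun t ht => ?_, h4⟩
        rw [S.FSigma_congr f j t _ _ _ (fun _ _ => rfl) (hupd t)]
        exact h3 t ht
    · rw [Function.update_of_ne (by omega)]
      exact hz0 j hj

end Regions

end RootSystem

end Constraints

/-! ### The decomposition of the region, and the approximate linearity of `F_{20}` -/

section Components

variable {𝕜 X Y : Type*} [RCLike 𝕜] [NormedAddCommGroup X] [NormedSpace 𝕜 X]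
  [NormedAddCommGroup Y] [NormedSpace 𝕜 Y]
  {E : OperatorPair 𝕜 X Y} {ν : ℕ}

namespace RootSystem

theorem isOpen_preimage_projD (S : RootSystem E ν) {T : Fin S.n → ℕ → Prop} {N : Set E.D}
    (hN : IsOpenIn (S.spanD T) N) : IsOpen {x | S.projD T x ∈ N} :=
  hN.2.preimage (f := fun x => (⟨S.projD T x, S.projD_mem T x⟩ : S.spanD T))
    ((S.continuous_projD T).subtype_mk _)

theorem F20_mem (S : RootSystem E ν) (f : ℝ → E.D → Y) (t : ℝ) (x1 xS d d' : E.D) {h : E.D}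
    (hh : h ∈ S.D20) : S.F20 f t x1 h xS d d' ∈ S.Y20 :=
  Submodule.sub_mem _ (Submodule.sub_mem _ (S.projY_mem _ _) (S.opB_mem_spanY hh))
    (S.projY_mem _ _)

namespace Regions

variable {S : RootSystem E ν} (G : S.Regions)

theorem PLast_sum {u v : ℕ → E.D} (hu : ∀ j ∈ Finset.Ico 1 ν, u j ∈ S.DLast j)
    (hv : ∀ j ∈ Finset.Ico 1 (ν - 1), v j ∈ S.DWedge j) {j : ℕ} (hj : j ∈ Finset.Ico 1 ν) :
    S.PLast j (∑ i ∈ Finset.Ico 1 ν, u i + ∑ i ∈ Finset.Ico 1 (ν - 1), v i) = u j := by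
  rw [map_add, map_sum, map_sum, Finset.sum_eq_single_of_mem j hj, Finset.sum_eq_zero, add_zero]
  · exact S.mem_spanD_iff.1 (hu j hj)
  · exact fun i hi => S.projD_eq_zero_of_mem (hv i hi) fun k r _ h h' => by
      have := h.2; have := h'.2; have := h.1; have := h'.1; omega
  · exact fun i hi hij => S.projD_eq_zero_of_mem (hu i hi) fun k r _ h h' =>
      hij (h'.1.symm.trans h.1)

theorem PWedge_sum {u v : ℕ → E.D} (hu : ∀ j ∈ Finset.Ico 1 ν, u j ∈ S.DLast j)
    (hv : ∀ j ∈ Finset.Ico 1 (ν - 1), v j ∈ S.DWedge j) {j : ℕ}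
    (hj : j ∈ Finset.Ico 1 (ν - 1)) :
    S.PWedge j (∑ i ∈ Finset.Ico 1 ν, u i + ∑ i ∈ Finset.Ico 1 (ν - 1), v i) = v j := by
  rw [map_add, map_sum, map_sum, Finset.sum_eq_zero, zero_add, Finset.sum_eq_single_of_mem j hj]
  · exact S.mem_spanD_iff.1 (hv j hj)
  · exact fun i hi hij => S.projD_eq_zero_of_mem (hv i hi) fun k r _ h h' =>
      hij (h'.1.symm.trans h.1)
  · exact fun i hi => S.projD_eq_zero_of_mem (hu i hi) fun k r _ h h' => by
      have := h.2; have := h'.2; have := h.1; have := h'.1; omega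

theorem sum_mem_D2Sigma {u v : ℕ → E.D} (hu : ∀ j ∈ Finset.Ico 1 ν, u j ∈ S.DLast j)
    (hv : ∀ j ∈ Finset.Ico 1 (ν - 1), v j ∈ S.DWedge j) :
    ∑ i ∈ Finset.Ico 1 ν, u i + ∑ i ∈ Finset.Ico 1 (ν - 1), v i ∈ S.D2Sigma := by
  refine Submodule.add_mem _ (Submodule.sum_mem _ fun j hj => ?_)
    (Submodule.sum_mem _ fun j hj => ?_)
  · exact S.spanD_mono (fun i r _ h => h.1 ▸ (Finset.mem_Ico.1 hj).1) (hu j hj)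
  · exact S.spanD_mono (fun i r _ h => h.1 ▸ (Finset.mem_Ico.1 hj).1) (hv j hj)

theorem mem_M2Sigma_iff {x : E.D} : x ∈ G.M2Sigma ↔ x ∈ S.D2Sigma ∧
    (∀ j ∈ Finset.Ico 1 ν, S.PLast j x ∈ G.MLast j) ∧
    ∀ j ∈ Finset.Ico 1 (ν - 1), S.PWedge j x ∈ G.MWedge j := by
  constructor
  · rintro ⟨_, ⟨u, hu, rfl⟩, _, ⟨v, hv, rfl⟩, rfl⟩
    have hu' : ∀ j ∈ Finset.Ico 1 ν, u j ∈ S.DLast j := fun j hj => (G.isOpen_MLast j hj).1 (hu j hj)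
    have hv' : ∀ j ∈ Finset.Ico 1 (ν - 1), v j ∈ S.DWedge j := fun j hj =>
      (G.isOpen_MWedge j hj).1 (hv j hj)
    exact ⟨sum_mem_D2Sigma hu' hv', fun j hj => by rw [PLast_sum hu' hv' hj]; exact hu j hj,
      fun j hj => by rw [PWedge_sum hu' hv' hj]; exact hv j hj⟩
  · rintro ⟨hx, hl, hw⟩
    refine ⟨_, ⟨fun j => S.PLast j x, hl, rfl⟩, _, ⟨fun j => S.PWedge j x, hw, rfl⟩, ?_⟩
    rw [← projD_adj_eq_sum, S.mem_spanD_iff.1 hx]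

section

variable {x1 x20 xS : E.D}

theorem P1_add (h1 : x1 ∈ S.D1) (h20 : x20 ∈ S.D20) (hS : xS ∈ S.D2Sigma) :
    S.P1 (x1 + x20 + xS) = x1 := by
  rw [map_add, map_add, S.P1_of_mem_D1 h1, S.P1_of_mem_spanD h20, S.P1_of_mem_spanD hS]
  simp

theorem projD_eig_add (h1 : x1 ∈ S.D1) (h20 : x20 ∈ S.D20) (hS : xS ∈ S.D2Sigma) :
    S.projD S.eig (x1 + x20 + xS) = x20 := by
  rw [map_add, map_add, S.projD_of_mem_D1 _ h1, S.mem_spanD_iff.1 h20,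
    S.projD_eq_zero_of_mem hS fun i r _ h h' => by
      have h : r = 0 := h
      have h' : 1 ≤ r := h'
      omega]
  simp

theorem projD_add_of_le_adj {T : Fin S.n → ℕ → Prop} (hT : ∀ i r, T i r → 1 ≤ r)
    (h1 : x1 ∈ S.D1) (h20 : x20 ∈ S.D20) :
    S.projD T (x1 + x20 + xS) = S.projD T xS := by
  rw [map_add, map_add, S.projD_of_mem_D1 _ h1, S.projD_eq_zero_of_mem h20 fun i r _ h h' => by
      have h' : r = 0 := h'
      have h := hT i r h
      omega]
  simp

theorem projD_adj_add (h1 : x1 ∈ S.D1) (h20 : x20 ∈ S.D20) (hS : xS ∈ S.D2Sigma) :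
    S.projD S.adj (x1 + x20 + xS) = xS := by
  rw [projD_add_of_le_adj (T := S.adj) (fun _ _ h => h) h1 h20, S.mem_spanD_iff.1 hS]

end

theorem mem_M_iff {x : E.D} : x ∈ G.M ↔ S.projD S.eig x ∈ G.M20 ∧ S.projD S.adj x ∈ G.M2Sigma := by
  constructor
  · rintro ⟨x1, h1, x20, h20, xS, hS, rfl⟩
    have hS' := (G.mem_M2Sigma_iff.1 hS).1
    rw [projD_eig_add h1 (G.isOpen_M20.1 h20) hS', projD_adj_add h1 (G.isOpen_M20.1 h20) hS']
    exact ⟨h20, hS⟩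
  · rintro ⟨h20, hS⟩
    exact ⟨_, ⟨x, rfl⟩, _, h20, _, hS, S.eq_add_components x⟩

/-- The region is open in all of `D`: it is restricted in finitely many coordinates only. -/
theorem isOpen_M : IsOpen G.M := by
  have : G.M = {x | S.projD S.eig x ∈ G.M20} ∩
      ((⋂ j ∈ Finset.Ico 1 ν, {x | S.projD (S.last j) x ∈ G.MLast j}) ∩
        ⋂ j ∈ Finset.Ico 1 (ν - 1), {x | S.projD (S.inner j) x ∈ G.MWedge j}) := by
    ext x
    have hl : ∀ j ∈ Finset.Ico 1 ν, S.PLast j (S.projD S.adj x) = S.PLast j x := fun j hj =>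
      S.projD_projD (fun i r _ h => h.1 ▸ (Finset.mem_Ico.1 hj).1) x
    have hw : ∀ j ∈ Finset.Ico 1 (ν - 1), S.PWedge j (S.projD S.adj x) = S.PWedge j x :=
      fun j hj => S.projD_projD (fun i r _ h => h.1 ▸ (Finset.mem_Ico.1 hj).1) x
    simp only [mem_M_iff, mem_M2Sigma_iff, mem_inter_iff, mem_iInter, mem_ofPred_eq]
    refine and_congr_right fun _ => ⟨fun h => ⟨fun j hj => ?_, fun j hj => ?_⟩,
      fun h => ⟨S.projD_mem _ _, fun j hj => ?_, fun j hj => ?_⟩⟩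
    · exact hl j hj ▸ h.2.1 j hj
    · exact hw j hj ▸ h.2.2 j hj
    · rw [hl j hj]; exact h.1 j hj
    · rw [hw j hj]; exact h.2 j hj
  rw [this]
  refine (S.isOpen_preimage_projD G.isOpen_M20).inter
    ((isOpen_biInter_finset fun j hj => ?_).inter (isOpen_biInter_finset fun j hj => ?_))
  · exact S.isOpen_preimage_projD (G.isOpen_MLast j hj)
  · exact S.isOpen_preimage_projD (G.isOpen_MWedge j hj)

end Regions

end RootSystem

end Components

section EigenComponent

variable {𝕜 X Y : Type*} [RCLike 𝕜] [NormedAddCommGroup X] [NormedSpace 𝕜 X]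
  [NormedSpace ℝ X] [IsScalarTower ℝ 𝕜 X]
  [NormedAddCommGroup Y] [NormedSpace 𝕜 Y] [NormedSpace ℝ Y] [IsScalarTower ℝ 𝕜 Y]
  {E : OperatorPair 𝕜 X Y} {ν : ℕ} {S : RootSystem E ν}

namespace RootSystem.Regions

variable (G : S.Regions)

/-- Near each zero of `F_{20}`, the map `F_{20}` is approximated as a function of `x_{20}` by an
invertible linear operator `Z`, uniformly in the other arguments and up to an error with Lipschitz
constant `c < ‖Z⁻¹‖⁻¹`. This is what the Lipschitz and the differentiable form of the hypothesis
have in common. -/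
def EigContraction (f : ℝ → E.D → Y) : Prop :=
  ∀ t₀, 0 ≤ t₀ → ∀ x1₀ ∈ S.D1, ∀ x20₀ ∈ G.M20, ∀ xS₀ ∈ G.M2Sigma,
    ∀ d₀ ∈ S.DLast 1, ∀ d'₀ ∈ S.DWedge 1, S.F20 f t₀ x1₀ x20₀ xS₀ d₀ d'₀ = 0 →
    ∃ (Z : S.D20 ≃L[ℝ] S.Y20) (c : NNReal) (δ : ℝ), 0 < δ ∧
      c * ‖(Z.symm : S.Y20 →L[ℝ] S.D20)‖ < 1 ∧
      ∀ t, 0 ≤ t → |t - t₀| < δ → ∀ x1 ∈ S.D1, ‖x1 - x1₀‖ < δ →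
        ∀ xS ∈ G.M2Sigma, ‖xS - xS₀‖ < δ →
        ∀ d ∈ S.DLast 1, ‖d - d₀‖ < δ → ∀ d' ∈ S.DWedge 1, ‖d' - d'₀‖ < δ →
        ∀ u v : S.D20, ‖(u : E.D) - x20₀‖ < δ → ‖(v : E.D) - x20₀‖ < δ →
          ‖S.F20 f t x1 u xS d d' - S.F20 f t x1 v xS d d' - (Z (u - v) : Y)‖ ≤ c * ‖u - v‖

variable {G}

theorem LipschitzCondition.eigContraction {f : ℝ → E.D → Y} (h : G.LipschitzCondition f) :
    G.EigContraction f := by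
  intro t₀ ht₀ x1₀ hx1₀ x20₀ hx20₀ xS₀ hxS₀ d₀ hd₀ d'₀ hd'₀ h0
  obtain ⟨Z, k, l, hk, hl, hev⟩ :=
    h.contraction t₀ ht₀ x1₀ hx1₀ x20₀ hx20₀ xS₀ hxS₀ d₀ hd₀ d'₀ hd'₀ h0
  set N := ‖(Z.symm : S.Y20 →L[ℝ] S.D20)‖ with hN
  obtain ⟨c, hc0, hlc, hc⟩ : ∃ c : ℝ, 0 ≤ c ∧ l < c ∧ c * N < 1 := by
    have h1 : max l 0 * N < 1 := by
      rcases le_total l 0 with h | h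
      · simp [max_eq_right h]
      · rwa [max_eq_left h]
    have h2 : Tendsto (fun c : ℝ => c * N) (𝓝[>] (max l 0)) (𝓝 (max l 0 * N)) :=
      ((continuous_mul_const N).tendsto _).mono_left nhdsWithin_le_nhds
    obtain ⟨c, h3, h4⟩ := ((h2.eventually_lt_const h1).and self_mem_nhdsWithin).exists
    have h4 : max l 0 < c := h4
    exact ⟨c, (le_max_right _ _).trans h4.le, (le_max_left _ _).trans_lt h4, h3⟩
  have hpos : ∀ᶠ e : ℝ × ℝ in 𝓝[>] 0 ×ˢ 𝓝[>] 0, 0 < e.1 ∧ 0 < e.2 := by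
    have h : ∀ᶠ e in 𝓝[>] (0 : ℝ), 0 < e := self_mem_nhdsWithin
    exact h.prod_mk h
  obtain ⟨⟨e₁, e₂⟩, ⟨he, hke⟩, hee⟩ := ((hpos.and (hk.eventually_lt_const hlc)).and hev).exists
  refine ⟨Z, ⟨c, hc0⟩, min e₁ e₂, lt_min he.1 he.2, hc, ?_⟩
  intro t ht htd x1 hx1 hx1d xS hxS hxSd d hd hdd d' hd' hdd' u v hu hv
  have m1 := min_le_left e₁ e₂
  have m2 := min_le_right e₁ e₂
  refine (hee t ht (htd.trans_le m1) x1 hx1 (hx1d.trans_le m1) xS (G.mem_M2Sigma_iff.1 hxS).1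
    (hxSd.trans_le m1) d hd (hdd.trans_le m1) d' hd' (hdd'.trans_le m1) u v (hu.trans_le m2)
    (hv.trans_le m2)).trans ?_
  exact mul_le_mul_of_nonneg_right hke.le (norm_nonneg _)

/-- Here `Z` is the partial derivative at the zero; the error is estimated with the mean value
inequality on a small ball. -/
theorem SmoothCondition.eigContraction {f : ℝ → E.D → Y} (h : G.SmoothCondition f) :
    G.EigContraction f := by
  intro t₀ ht₀ x1₀ hx1₀ x20₀ hx20₀ xS₀ hxS₀ d₀ hd₀ d'₀ hd'₀ h0
  have hx20D := G.isOpen_M20.1 hx20₀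
  obtain ⟨W, hW⟩ := h.invertible t₀ ht₀ x1₀ hx1₀ xS₀ hxS₀ d₀ hd₀ d'₀ hd'₀ ⟨x20₀, hx20D⟩ hx20₀ h0
  let ι : S.D20 →L[ℝ] E.D := S.D20.subtypeL.restrictScalars ℝ
  have hι : ‖ι‖ ≤ 1 := ContinuousLinearMap.opNorm_le_bound _ zero_le_one fun x => by
    rw [one_mul]; exact le_rfl
  let β : S.D20 →L[ℝ] Y :=
    (LinearMap.toContinuousLinearMap (E.opB ∘ₗ S.D20.subtype)).restrictScalars ℝ
  let g' : ℝ × E.D → E.D →L[ℝ] Y := fun z => fderiv ℝ (fun y => S.Q20 (f z.1 y)) z.2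
  have hderiv : ∀ t, 0 ≤ t → ∀ x1 xS d d' : E.D, ∀ u : S.D20, x1 + u + xS ∈ G.M →
      HasFDerivAt (fun u : S.D20 => S.F20 f t x1 u xS d d')
        ((g' (t, x1 + u + xS)).comp ι - β) u := by
    intro t ht x1 xS d d' u hu
    have h1 : HasFDerivAt (fun u : S.D20 => x1 + (u : E.D) + xS) ι u :=
      (ι.hasFDerivAt.const_add x1).add_const xS
    have h2 := (h.diff_Q20 t ht _ hu).hasFDerivAt.comp u h1
    exact (h2.sub β.hasFDerivAt).sub_const _
  obtain ⟨c, hc0, hc⟩ := exists_pos_mul_lt_one ‖(W.symm : S.Y20 →L[ℝ] S.D20)‖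
  have hx₀ : x1₀ + x20₀ + xS₀ ∈ G.M := ⟨x1₀, hx1₀, x20₀, hx20₀, xS₀, hxS₀, rfl⟩
  have hWe := hW.unique (hderiv t₀ ht₀ x1₀ xS₀ d₀ d'₀ ⟨x20₀, hx20D⟩ hx₀)
  have hev : ∀ᶠ z in 𝓝[Ici 0 ×ˢ G.M] (t₀, x1₀ + x20₀ + xS₀),
      ‖g' z - g' (t₀, x1₀ + x20₀ + xS₀)‖ < c := by
    have h1 : ContinuousWithinAt (fun z => ‖g' z - g' (t₀, x1₀ + x20₀ + xS₀)‖) (Ici 0 ×ˢ G.M)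
        (t₀, x1₀ + x20₀ + xS₀) :=
      ((h.cont_Q20 (t₀, x1₀ + x20₀ + xS₀) ⟨ht₀, hx₀⟩).sub continuousWithinAt_const).norm
    exact h1.eventually_lt_const (by simpa using hc0)
  obtain ⟨δ₁, hδ₁, h1⟩ := Metric.mem_nhdsWithin_iff.1 hev
  obtain ⟨δ₂, hδ₂, h2⟩ := Metric.isOpen_iff.1 G.isOpen_M20.2 ⟨x20₀, hx20D⟩ hx20₀
  refine ⟨W, c, min (δ₁ / 3) δ₂, by positivity, hc, ?_⟩
  intro t ht htd x1 hx1 hx1d xS hxS hxSd d hd hdd d' hd' hdd' u v hu hv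
  simp only [lt_min_iff] at htd hx1d hxSd
  have hball : ∀ u : S.D20, u ∈ Metric.ball (⟨x20₀, hx20D⟩ : S.D20) (min (δ₁ / 3) δ₂) →
      x1 + u + xS ∈ G.M ∧ ‖g' (t, x1 + u + xS) - g' (t₀, x1₀ + x20₀ + xS₀)‖ ≤ c := by
    intro u hu
    have hu20 := h2 (Metric.ball_subset_ball (min_le_right _ _) hu)
    have huM : x1 + u + xS ∈ G.M := ⟨x1, hx1, u, hu20, xS, hxS, rfl⟩
    have hu3 : ‖(u : E.D) - x20₀‖ < δ₁ / 3 := by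
      have : dist u (⟨x20₀, hx20D⟩ : S.D20) < δ₁ / 3 := lt_of_lt_of_le hu (min_le_left _ _)
      rwa [Subtype.dist_eq, dist_eq_norm] at this
    refine ⟨huM, (h1 (a := (t, x1 + u + xS)) ⟨?_, ht, huM⟩).le⟩
    rw [Metric.mem_ball, Prod.dist_eq, max_lt_iff]
    refine ⟨by rw [Real.dist_eq]; linarith [htd.1], ?_⟩
    rw [dist_eq_norm]
    calc ‖x1 + u + xS - (x1₀ + x20₀ + xS₀)‖
        = ‖(x1 - x1₀) + ((u : E.D) - x20₀) + (xS - xS₀)‖ := by congr 1; abel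
      _ ≤ ‖x1 - x1₀‖ + ‖(u : E.D) - x20₀‖ + ‖xS - xS₀‖ := norm_add₃_le
      _ < δ₁ := by linarith [hx1d.1, hxSd.1]
  have hmem : ∀ u : S.D20, ‖(u : E.D) - x20₀‖ < min (δ₁ / 3) δ₂ →
      u ∈ Metric.ball (⟨x20₀, hx20D⟩ : S.D20) (min (δ₁ / 3) δ₂) := fun u hu => by
    rw [Metric.mem_ball, Subtype.dist_eq, dist_eq_norm]; exact hu
  refine (convex_ball _ _).norm_image_sub_le_of_norm_hasFDerivWithin_le'
    (f := fun u : S.D20 => S.F20 f t x1 u xS d d')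
    (φ := (S.Y20.subtypeL.restrictScalars ℝ).comp (W : S.D20 →L[ℝ] S.Y20))
    (fun u hu => (hderiv t ht x1 xS d d' u (hball u hu).1).hasFDerivWithinAt)
    (fun u hu => ?_) (hmem v hv) (hmem u hu)
  rw [hWe, sub_sub_sub_cancel_right, ← ContinuousLinearMap.sub_comp]
  calc _ ≤ ‖g' (t, x1 + u + xS) - g' (t₀, x1₀ + x20₀ + xS₀)‖ * ‖ι‖ :=
        ContinuousLinearMap.opNorm_comp_le _ _
    _ ≤ c * 1 := mul_le_mul (hball u hu).2 hι (norm_nonneg ι) c.2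
    _ = c := mul_one _

/-- The mean value inequality on balls, which exist because the region is open in `D`. -/
theorem locallyLipschitz_of_continuous_fderiv {g : ℝ → E.D → Y}
    (hd : ∀ t, 0 ≤ t → ∀ x ∈ G.M, DifferentiableAt ℝ (g t) x)
    (hc : ContinuousOn (fun z : ℝ × E.D => fderiv ℝ (g z.1) z.2) (Ici 0 ×ˢ G.M)) :
    G.LocallyLipschitz g := by
  intro t' ht' x' hx'
  have hev : ∀ᶠ z in 𝓝[Ici 0 ×ˢ G.M] (t', x'),
      ‖fderiv ℝ (g z.1) z.2‖ < ‖fderiv ℝ (g t') x'‖ + 1 :=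
    (hc (t', x') ⟨ht', hx'⟩).norm.eventually_lt_const (by simp)
  obtain ⟨δ₁, hδ₁, h1⟩ := Metric.mem_nhdsWithin_iff.1 hev
  obtain ⟨δ₂, hδ₂, h2⟩ := Metric.isOpen_iff.1 G.isOpen_M x' hx'
  have hδ : 0 < min δ₁ δ₂ := lt_min hδ₁ hδ₂
  refine ⟨Metric.ball t' (min δ₁ δ₂), mem_nhdsWithin_of_mem_nhds (Metric.ball_mem_nhds _ hδ),
    Metric.ball x' (min δ₁ δ₂), Metric.ball_mem_nhds _ hδ, ‖fderiv ℝ (g t') x'‖ + 1, ?_⟩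
  intro t ht ht0 x hx y hy _
  refine (convex_ball x' (min δ₁ δ₂)).norm_image_sub_le_of_norm_fderiv_le
    (fun z hz => hd t ht0 z (h2 (Metric.ball_subset_ball (min_le_right _ _) hz)))
    (fun z hz => ?_) hy.1 hx.1
  refine (h1 (a := (t, z)) ⟨?_, ht0, h2 (Metric.ball_subset_ball (min_le_right _ _) hz)⟩).le
  rw [Metric.mem_ball, Prod.dist_eq, max_lt_iff]
  exact ⟨lt_of_lt_of_le ht (min_le_left _ _), lt_of_lt_of_le hz (min_le_left _ _)⟩

end RootSystem.Regions

end EigenComponent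

/-! ### The component in the kernel of `A` -/

section EigenSolution

variable {𝕜 X Y : Type*} [RCLike 𝕜] [NormedAddCommGroup X] [NormedSpace 𝕜 X]
  [NormedSpace ℝ X] [IsScalarTower ℝ 𝕜 X]
  [NormedAddCommGroup Y] [NormedSpace 𝕜 Y] [NormedSpace ℝ Y] [IsScalarTower ℝ 𝕜 Y]
  {E : OperatorPair 𝕜 X Y} {ν : ℕ} {S : RootSystem E ν}

namespace RootSystem.Regions

variable {G : S.Regions} {f : ℝ → E.D → Y} {T : S.Y1 →L[𝕜] E.D} {xS d d' : ℝ → E.D}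
  {η : ℝ → S.Y1 → S.D20}

/-- `A` may be unbounded, but it is continuous along curves in the finite-dimensional span of the
root vectors. -/
theorem continuousOn_opA_add (hd : ∀ t, 0 ≤ t → d t ∈ S.DLast 1)
    (hd' : ∀ t, 0 ≤ t → d' t ∈ S.DWedge 1) (cd : ContinuousOn d (Ici 0))
    (cd' : ContinuousOn d' (Ici 0)) : ContinuousOn (fun t => E.opA (d t + d' t)) (Ici 0) := by
  refine ((S.compProjL E.opA S.adj).continuous.comp_continuousOn (cd.add cd')).congr
    fun t ht => ?_
  exact (S.compProjL_of_mem E.opA (T := S.adj) (Submodule.add_mem _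
    (S.spanD_mono (fun i r _ h => h.1.ge) (hd t ht))
    (S.spanD_mono (fun i r _ h => h.1.ge) (hd' t ht)))).symm

/-- The solution `x_{20} = η(t, w)` of `F_{20} = 0` is continuous, by uniqueness of the zero and the
approximate linearity of `F_{20}`. -/
theorem continuousOn_eigSolution
    (hf : ContinuousOn (fun z : ℝ × E.D => f z.1 z.2) (Ici 0 ×ˢ univ))
    (huniq : G.UniqueSolvability f) (hc : G.EigContraction f) (hT : ∀ w, T w ∈ S.D1)
    (hxS : ∀ t, 0 ≤ t → xS t ∈ G.M2Sigma) (hd : ∀ t, 0 ≤ t → d t ∈ S.DLast 1)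
    (hd' : ∀ t, 0 ≤ t → d' t ∈ S.DWedge 1) (cS : ContinuousOn xS (Ici 0))
    (cd : ContinuousOn d (Ici 0)) (cd' : ContinuousOn d' (Ici 0))
    (hη : ∀ t, 0 ≤ t → ∀ w, (η t w : E.D) ∈ G.M20 ∧
      S.F20 f t (T w) (η t w) (xS t) (d t) (d' t) = 0) :
    ContinuousOn (Function.uncurry η) (Ici 0 ×ˢ univ) := by
  rintro ⟨t₀, w₀⟩ ⟨ht₀, -⟩
  have ht₀ : 0 ≤ t₀ := ht₀
  obtain ⟨Z, c, δ, hδ, hcZ, happ⟩ := hc t₀ ht₀ (T w₀) (hT w₀) (η t₀ w₀) (hη t₀ ht₀ w₀).1 (xS t₀)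
    (hxS t₀ ht₀) (d t₀) (hd t₀ ht₀) (d' t₀) (hd' t₀ ht₀) (hη t₀ ht₀ w₀).2
  set l := 𝓝[Ici 0 ×ˢ univ] (t₀, w₀) with hl
  have hl0 : ∀ᶠ p in l, 0 ≤ p.1 := by
    filter_upwards [self_mem_nhdsWithin] with p hp using hp.1
  have hfst : Tendsto (fun p : ℝ × S.Y1 => p.1) l (𝓝[Ici 0] t₀) :=
    tendsto_nhdsWithin_iff.2 ⟨(continuous_fst.tendsto (t₀, w₀)).mono_left nhdsWithin_le_nhds, hl0⟩
  have hTw : Tendsto (fun p : ℝ × S.Y1 => T p.2) l (𝓝 (T w₀)) :=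
    ((T.continuous.comp continuous_snd).tendsto (t₀, w₀)).mono_left nhdsWithin_le_nhds
  have tS : Tendsto (fun p : ℝ × S.Y1 => xS p.1) l (𝓝 (xS t₀)) := (cS t₀ ht₀).tendsto.comp hfst
  have td : Tendsto (fun p : ℝ × S.Y1 => d p.1) l (𝓝 (d t₀)) := (cd t₀ ht₀).tendsto.comp hfst
  have td' : Tendsto (fun p : ℝ × S.Y1 => d' p.1) l (𝓝 (d' t₀)) := (cd' t₀ ht₀).tendsto.comp hfst
  have tA : Tendsto (fun p : ℝ × S.Y1 => E.opA (d p.1 + d' p.1)) l (𝓝 (E.opA (d t₀ + d' t₀))) :=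
    (continuousOn_opA_add hd hd' cd cd' t₀ ht₀).tendsto.comp hfst
  let F : ℝ × S.Y1 → S.D20 → S.Y20 := fun p h =>
    ⟨S.F20 f p.1 (T p.2) h (xS p.1) (d p.1) (d' p.1), S.F20_mem f _ _ _ _ _ h.2⟩
  have hnear : ∀ {g : ℝ × S.Y1 → E.D} {a : E.D}, Tendsto g l (𝓝 a) → ∀ᶠ p in l, ‖g p - a‖ < δ :=
    fun h => by simpa [dist_eq_norm] using (Metric.tendsto_nhds.1 h) δ hδ
  refine tendsto_zero_of_approximatesLinearOn (F := F) Z hcZ hδ ?_ ?_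
    (U := {h : S.D20 | (h : E.D) ∈ G.M20}) (G.isOpen_M20.2.mem_nhds (hη t₀ ht₀ w₀).1) ?_
  · have ht : ∀ᶠ p : ℝ × S.Y1 in l, |p.1 - t₀| < δ := by
      simpa [Real.dist_eq] using (Metric.tendsto_nhds.1 (hfst.mono_right nhdsWithin_le_nhds)) δ hδ
    filter_upwards [hl0, ht, hnear hTw, hnear tS, hnear td, hnear td'] with p h0 h1 h2 h3 h4 h5
    intro u hu v hv
    rw [Metric.mem_ball, Subtype.dist_eq, dist_eq_norm] at hu hv
    exact happ p.1 h0 h1 _ (hT _) h2 _ (hxS _ h0) h3 _ (hd _ h0) h4 _ (hd' _ h0) h5 u v hu hv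
  · rw [tendsto_subtype_rng]
    have hx : Tendsto (fun p : ℝ × S.Y1 => (p.1, T p.2 + (η t₀ w₀ : E.D) + xS p.1)) l
        (𝓝[Ici 0 ×ˢ univ] (t₀, T w₀ + η t₀ w₀ + xS t₀)) := by
      refine tendsto_nhdsWithin_iff.2
        ⟨(hfst.mono_right nhdsWithin_le_nhds).prodMk_nhds ((hTw.add_const _).add tS), ?_⟩
      filter_upwards [hl0] with p hp using ⟨hp, mem_univ _⟩
    have h1 := ((S.continuous_projY S.eig).tendsto _).comp
      ((hf (t₀, T w₀ + η t₀ w₀ + xS t₀) ⟨ht₀, mem_univ _⟩).tendsto.comp hx)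
    have h2 := (h1.sub_const (E.opB (η t₀ w₀))).sub (((S.continuous_projY S.eig).tendsto _).comp tA)
    have h3 : S.projY S.eig (f t₀ (T w₀ + η t₀ w₀ + xS t₀)) - E.opB (η t₀ w₀)
      - S.projY S.eig (E.opA (d t₀ + d' t₀)) = 0 := (hη t₀ ht₀ w₀).2
    rw [h3] at h2
    exact h2
  · filter_upwards [hl0] with p hp h hh hF
    refine Subtype.ext ?_
    exact (huniq.eig p.1 hp (T p.2) (hT _) (xS p.1) (hxS _ hp) (d p.1) (hd _ hp) (d' p.1)
      (hd' _ hp)).unique ⟨hh, congrArg Subtype.val hF⟩ (hη p.1 hp p.2)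

/-- Subtracting the equations for two values of `w` and using that `F_{20}` is close to the
invertible operator `Z`, the increment of `x_{20}` is bounded by that of `x₁ = T w`. -/
theorem locallyLipschitz_eigSolution
    (hc : G.EigContraction f) (hL : G.LocallyLipschitz fun t x => S.Q20 (f t x))
    (hT : ∀ w, T w ∈ S.D1)
    (hxS : ∀ t, 0 ≤ t → xS t ∈ G.M2Sigma) (hd : ∀ t, 0 ≤ t → d t ∈ S.DLast 1)
    (hd' : ∀ t, 0 ≤ t → d' t ∈ S.DWedge 1) (cS : ContinuousOn xS (Ici 0))
    (cd : ContinuousOn d (Ici 0)) (cd' : ContinuousOn d' (Ici 0))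
    (hη : ∀ t, 0 ≤ t → ∀ w, (η t w : E.D) ∈ G.M20 ∧
      S.F20 f t (T w) (η t w) (xS t) (d t) (d' t) = 0)
    (cη : ContinuousOn (Function.uncurry η) (Ici 0 ×ˢ univ)) {t₀ : ℝ} (ht₀ : 0 ≤ t₀) (w₀ : S.Y1) :
    ∃ K : ℝ, ∀ᶠ r in 𝓝[>] (0 : ℝ), ∀ t, 0 ≤ t → |t - t₀| < r →
      ∀ w ∈ Metric.ball w₀ r, ∀ w' ∈ Metric.ball w₀ r, ‖η t w - η t w'‖ ≤ K * ‖w - w'‖ := by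
  obtain ⟨Z, c, δ, hδ, hcZ, happ⟩ := hc t₀ ht₀ (T w₀) (hT w₀) (η t₀ w₀) (hη t₀ ht₀ w₀).1 (xS t₀)
    (hxS t₀ ht₀) (d t₀) (hd t₀ ht₀) (d' t₀) (hd' t₀ ht₀) (hη t₀ ht₀ w₀).2
  obtain ⟨I, hI, N, hN, L, hLN⟩ := hL t₀ ht₀ (T w₀ + η t₀ w₀ + xS t₀)
    ⟨_, hT w₀, _, (hη t₀ ht₀ w₀).1, _, hxS t₀ ht₀, rfl⟩
  obtain ⟨ε, hε, hεN⟩ := Metric.mem_nhds_iff.1 hN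
  set l := 𝓝[Ici 0 ×ˢ univ] (t₀, w₀) with hl
  have hl0 : ∀ᶠ p in l, 0 ≤ p.1 := by
    filter_upwards [self_mem_nhdsWithin] with p hp using hp.1
  have hfst : Tendsto (fun p : ℝ × S.Y1 => p.1) l (𝓝[Ici 0] t₀) :=
    tendsto_nhdsWithin_iff.2 ⟨(continuous_fst.tendsto (t₀, w₀)).mono_left nhdsWithin_le_nhds, hl0⟩
  have hTw : Tendsto (fun p : ℝ × S.Y1 => T p.2) l (𝓝 (T w₀)) :=
    ((T.continuous.comp continuous_snd).tendsto (t₀, w₀)).mono_left nhdsWithin_le_nhds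
  have tS : Tendsto (fun p : ℝ × S.Y1 => xS p.1) l (𝓝 (xS t₀)) := (cS t₀ ht₀).tendsto.comp hfst
  have td : Tendsto (fun p : ℝ × S.Y1 => d p.1) l (𝓝 (d t₀)) := (cd t₀ ht₀).tendsto.comp hfst
  have td' : Tendsto (fun p : ℝ × S.Y1 => d' p.1) l (𝓝 (d' t₀)) := (cd' t₀ ht₀).tendsto.comp hfst
  have tη : Tendsto (fun p : ℝ × S.Y1 => (η p.1 p.2 : E.D)) l (𝓝 (η t₀ w₀)) :=
    (continuous_subtype_val.tendsto _).comp (cη (t₀, w₀) ⟨ht₀, mem_univ _⟩).tendsto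
  have hnear : ∀ {g : ℝ × S.Y1 → E.D} {a : E.D} {ρ : ℝ}, 0 < ρ → Tendsto g l (𝓝 a) →
      ∀ᶠ p in l, ‖g p - a‖ < ρ :=
    fun hρ h => by simpa [dist_eq_norm] using (Metric.tendsto_nhds.1 h) _ hρ
  have ht : ∀ᶠ p : ℝ × S.Y1 in l, |p.1 - t₀| < δ := by
    simpa [Real.dist_eq] using (Metric.tendsto_nhds.1 (hfst.mono_right nhdsWithin_le_nhds)) δ hδ
  have hε3 : 0 < ε / 3 := by positivity
  have hev := (hfst.eventually hI).and <| hl0.and <| ht.and <| (hnear hδ hTw).and <|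
    (hnear hδ tS).and <| (hnear hδ td).and <| (hnear hδ td').and <| (hnear hδ tη).and <|
    (hnear hε3 hTw).and <| (hnear hε3 tS).and (hnear hε3 tη)
  obtain ⟨r₀, hr₀, hr⟩ := Metric.mem_nhdsWithin_iff.1 hev
  set n := ‖(Z.symm : S.Y20 →L[ℝ] S.D20)‖ with hn
  refine ⟨(n * (|L| * ‖T‖)) / (1 - c * n), ?_⟩
  filter_upwards [Ioo_mem_nhdsGT hr₀] with r hrr t ht htr w hw w' hw'
  have hgood : ∀ w ∈ Metric.ball w₀ r, (t, w) ∈ Metric.ball (t₀, w₀) r₀ ∩ Ici 0 ×ˢ univ :=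
    fun w hw => ⟨by
      rw [Metric.mem_ball, Prod.dist_eq, max_lt_iff, Real.dist_eq]
      exact ⟨htr.trans hrr.2, lt_trans hw hrr.2⟩, ht, mem_univ _⟩
  obtain ⟨hIt, -, htδ, h1, h2, h3, h4, h5, h6, h7, h8⟩ := hr (hgood w hw)
  obtain ⟨-, -, -, -, -, -, -, h5', h6', -, h8'⟩ := hr (hgood w' hw')
  simp only at hIt htδ h1 h2 h3 h4 h5 h6 h7 h8 h5' h6' h8'
  have hNM : ∀ v, ‖T v - T w₀‖ < ε / 3 → T v + η t w' + xS t ∈ N ∩ G.M := fun v hv => by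
    refine ⟨hεN ?_, _, hT v, _, (hη t ht w').1, _, hxS t ht, rfl⟩
    rw [Metric.mem_ball, dist_eq_norm]
    calc ‖T v + η t w' + xS t - (T w₀ + η t₀ w₀ + xS t₀)‖
        = ‖(T v - T w₀) + ((η t w' : E.D) - η t₀ w₀) + (xS t - xS t₀)‖ := by congr 1; abel
      _ ≤ ‖T v - T w₀‖ + ‖(η t w' : E.D) - η t₀ w₀‖ + ‖xS t - xS t₀‖ := norm_add₃_le
      _ < ε := by linarith
  have hS : ∀ v, S.P2Sigma (T v + η t w' + xS t) = xS t := fun v =>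
    projD_adj_add (hT v) (η t w').2 (G.mem_M2Sigma_iff.1 (hxS t ht)).1
  have hdiff := hLN t hIt ht _ (hNM w h6) _ (hNM w' h6') ((hS w).trans (hS w').symm)
  have hsub : T w + η t w' + xS t - (T w' + η t w' + xS t) = T (w - w') := by
    rw [map_sub]; abel
  rw [hsub] at hdiff
  have hap := happ t ht htδ _ (hT w) h1 _ (hxS t ht) h2 _ (hd t ht) h3 _ (hd' t ht) h4
    (η t w) (η t w') h5 h5'
  have hF : S.F20 f t (T w) (η t w') (xS t) (d t) (d' t)
      = S.Q20 (f t (T w + η t w' + xS t)) - S.Q20 (f t (T w' + η t w' + xS t)) := by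
    have h := (hη t ht w').2
    rw [F20] at h ⊢
    rw [← sub_zero (_ - _ - _), ← h]; abel
  rw [(hη t ht w).2, hF, zero_sub] at hap
  have hT' : ‖T (w - w')‖ ≤ ‖T‖ * ‖w - w'‖ := T.le_opNorm _
  have hZ : ‖(Z (η t w - η t w') : Y)‖ ≤ c * ‖η t w - η t w'‖ + |L| * ‖T‖ * ‖w - w'‖ := by
    set q := S.Q20 (f t (T w + η t w' + xS t)) - S.Q20 (f t (T w' + η t w' + xS t)) with hq
    set z : Y := (Z (η t w - η t w') : Y) with hz
    calc ‖z‖ = ‖(-q) - (-q - z)‖ := by congr 1; abel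
      _ ≤ ‖-q‖ + ‖-q - z‖ := norm_sub_le _ _
      _ = ‖-q - z‖ + ‖q‖ := by rw [norm_neg, add_comm]
      _ ≤ c * ‖η t w - η t w'‖ + |L| * ‖T‖ * ‖w - w'‖ := by
        refine add_le_add hap (hdiff.trans ?_)
        rw [mul_assoc]
        exact mul_le_mul (le_abs_self L) hT' (norm_nonneg _) (abs_nonneg L)
  have hinv : ‖η t w - η t w'‖ ≤ n * ‖(Z (η t w - η t w') : Y)‖ := by
    have := (Z.symm : S.Y20 →L[ℝ] S.D20).le_opNorm (Z (η t w - η t w'))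
    simpa using this
  have hn0 : 0 ≤ n := by rw [hn]; positivity
  rw [div_mul_eq_mul_div, le_div_iff₀ (by linarith)]
  nlinarith [mul_le_mul_of_nonneg_left hZ hn0]

end RootSystem.Regions

end EigenSolution

/-! ### The a priori bound -/

section Boundedness

variable {W : Type*} [NormedAddCommGroup W] [NormedSpace ℝ W]

/-- Near the end of the interval a curve which is bounded in velocity as long as it stays in the
ball of radius `R + 1` cannot leave that ball after it has been in the ball of radius `R`. Hence
it either stays bounded for this reason or remains outside the ball of radius `R`. -/
theorem exists_norm_le_of_late {w w' : ℝ → W} {a b R : ℝ} (hab : a < b)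
    (hw : ∀ t ∈ Ico a b, HasDerivWithinAt w (w' t) (Ico a b) t)
    (hv : ∃ C, ∀ t ∈ Ico a b, ‖w t‖ ≤ R + 1 → ‖w' t‖ ≤ C)
    (hz : ∀ a' ∈ Ico a b, (∀ t ∈ Ico a' b, R < ‖w t‖) → ∃ C, ∀ t ∈ Ico a' b, ‖w t‖ ≤ C) :
    ∃ C, ∀ t ∈ Ico a b, ‖w t‖ ≤ C := by
  have hc : ContinuousOn w (Ico a b) := fun t ht => (hw t ht).continuousWithinAt
  suffices ∃ a' ∈ Ico a b, ∃ C, ∀ t ∈ Ico a' b, ‖w t‖ ≤ C by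
    obtain ⟨a', ha', C, hC⟩ := this
    obtain ⟨C', hC'⟩ := isCompact_Icc.exists_bound_of_continuousOn
      (hc.mono fun t (ht : t ∈ Icc a a') => ⟨ht.1, ht.2.trans_lt ha'.2⟩)
    refine ⟨max C C', fun t ht => ?_⟩
    rcases le_total t a' with h | h
    · exact (hC' t ⟨ht.1, h⟩).trans (le_max_right _ _)
    · exact (hC t ⟨h, ht.2⟩).trans (le_max_left _ _)
  obtain ⟨C, hC⟩ := hv
  set c := max C 0 + 1 with hcdef
  have hc0 : 0 < c := by positivity
  set a' := max a (b - 1 / c) with ha'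
  have ha'm : a' ∈ Ico a b := ⟨le_max_left _ _, max_lt hab (by simp [hc0])⟩
  by_cases hR : ∀ t ∈ Ico a' b, R < ‖w t‖
  · exact ⟨a', ha'm, hz a' ha'm hR⟩
  push Not at hR
  obtain ⟨t₁, ht₁, hwt₁⟩ := hR
  have hat₁ : a ≤ t₁ := ha'm.1.trans ht₁.1
  refine ⟨t₁, ⟨hat₁, ht₁.2⟩, R + 1, fun t ht => ?_⟩
  have hlen : c * (t - t₁) ≤ 1 := by
    have h1 : b - 1 / c ≤ t₁ := (le_max_right _ _).trans ht₁.1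
    have h2 : t - t₁ ≤ 1 / c := by linarith [ht.2]
    calc c * (t - t₁) ≤ c * (1 / c) := by gcongr
      _ = 1 := by field_simp
  have key := image_norm_le_of_norm_deriv_right_lt_deriv_boundary (f := w) (f' := w') (a := t₁)
    (b := t) (B := fun s => R + c * (s - t₁)) (B' := fun _ => c)
    (hc.mono fun s hs => ⟨hat₁.trans hs.1, hs.2.trans_lt ht.2⟩)
    (fun s hs => (hw s ⟨hat₁.trans hs.1, hs.2.trans ht.2⟩).mono_of_mem_nhdsWithin (by
      filter_upwards [Ico_mem_nhdsGE (hs.2.trans ht.2)] with u hu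
        using ⟨hat₁.trans (hs.1.trans hu.1), hu.2⟩))
    (by simpa using hwt₁)
    (fun s => by simpa using (((hasDerivAt_id s).sub_const t₁).const_mul c).const_add R)
    (fun s hs hws => by
      refine (hC s ⟨hat₁.trans hs.1, hs.2.trans ht.2⟩ ?_).trans_lt ?_
      · rw [hws]
        have : c * (s - t₁) ≤ c * (t - t₁) := by gcongr; exact hs.2.le
        linarith
      · rw [hcdef]; linarith [le_max_left C 0])
  have := key (right_mem_Icc.2 ht.1)
  linarith

theorem exists_norm_le_of_tendsto_cobounded {V : W → ℝ} (hV : Tendsto V (Bornology.cobounded W) atTop)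
    (C : ℝ) : ∃ C', ∀ w, V w ≤ C → ‖w‖ ≤ C' := by
  have h : {w | C < V w} ∈ Bornology.cobounded W := hV.eventually_gt_atTop C
  have hb : Bornology.IsBounded {w | C < V w}ᶜ :=
    Bornology.isBounded_compl_iff.2 (Bornology.isCobounded_def.2 h)
  obtain ⟨C', hC'⟩ := isBounded_iff_forall_norm_le.1 hb
  exact ⟨C', fun w hw => hC' w (not_lt.2 hw)⟩

theorem exists_lipschitzOnWith_of_hasDerivWithinAt {w w' : ℝ → W} {a b : ℝ}
    (hw : ∀ t ∈ Ico a b, HasDerivWithinAt w (w' t) (Ico a b) t)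
    (hv : ∀ r, ∃ C, ∀ t ∈ Ico a b, ‖w t‖ ≤ r → ‖w' t‖ ≤ C) {a' c : ℝ} (ha' : a ≤ a') (hc : c < b) :
    (∃ C : ℝ, ∀ t ∈ Icc a' c, ‖w' t‖ ≤ C) ∧ ∃ K : NNReal, LipschitzOnWith K w (Icc a' c) := by
  have hsub : Icc a' c ⊆ Ico a b := fun t ht => ⟨ha'.trans ht.1, ht.2.trans_lt hc⟩
  obtain ⟨r, hr⟩ := isCompact_Icc.exists_bound_of_continuousOn
    (f := w) (s := Icc a' c) fun t ht => ((hw t (hsub ht)).mono hsub).continuousWithinAt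
  obtain ⟨C, hC⟩ := hv r
  have hC' : ∀ t ∈ Icc a' c, ‖w' t‖ ≤ C := fun t ht => hC t (hsub ht) (hr t ht)
  refine ⟨⟨C, hC'⟩, Real.toNNReal C, ?_⟩
  refine (convex_Icc a' c).lipschitzOnWith_of_nnnorm_hasDerivWithin_le
    (fun t ht => (hw t (hsub ht)).mono hsub) fun t ht => ?_
  exact NNReal.coe_le_coe.1 ((hC' t ht).trans (Real.le_coe_toNNReal C))

theorem hasDerivAt_of_Ico {w : ℝ → W} {w' : W} {a b a' t : ℝ} (ha' : a ≤ a') (ht : t ∈ Ioo a' b)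
    (hw : HasDerivWithinAt w w' (Ico a b) t) : HasDerivAt w w' t :=
  hw.hasDerivAt (by
    filter_upwards [Ioo_mem_nhds ht.1 ht.2] with s hs using ⟨ha'.trans hs.1.le, hs.2⟩)

/-- The norm of the velocity bounds the derivative of a Lipschitz functional along a curve. -/
theorem exists_norm_le_of_lipschitz_functional {w w' : ℝ → W} {a b R : ℝ} (ha : 0 ≤ a)
    (hw : ∀ t ∈ Ico a b, HasDerivWithinAt w (w' t) (Ico a b) t)
    (hv : ∀ r, ∃ C, ∀ t ∈ Ico a b, ‖w t‖ ≤ r → ‖w' t‖ ≤ C)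
    {V : W → ℝ} {L : NNReal} {U ψ : ℝ → ℝ} (hV0 : ∀ w, 0 ≤ V w)
    (hVL : LipschitzOnWith L V {w | R ≤ ‖w‖}) (hU : IsComparisonPair U ψ)
    (hVt : Tendsto V (Bornology.cobounded W) atTop)
    (hd : ∀ t ∈ Ico a b, R ≤ ‖w t‖ → ‖w' t‖ ≤ U (V (w t)) * ψ t) {a' : ℝ} (ha' : a' ∈ Ico a b)
    (hR : ∀ t ∈ Ico a' b, R < ‖w t‖) : ∃ C, ∀ t ∈ Ico a' b, ‖w t‖ ≤ C := by
  suffices ∃ C, ∀ t ∈ Ico a' b, V (w t) ≤ C by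
    obtain ⟨C, hC⟩ := this
    obtain ⟨C', hC'⟩ := exists_norm_le_of_tendsto_cobounded hVt C
    exact ⟨C', fun t ht => hC' _ (hC t ht)⟩
  refine (hU.const_mul L.2).exists_bound (z := fun t => V (w t)) (T := b) (ha.trans ha'.1)
    (fun c hc => ?_) (fun t _ => hV0 _) (fun t ht z' hz' => ?_)
  · obtain ⟨-, K, hK⟩ := exists_lipschitzOnWith_of_hasDerivWithinAt hw hv ha'.1 hc.2
    exact ⟨L * K, hVL.comp hK fun t ht => (hR t ⟨ht.1, ht.2.trans_lt hc.2⟩).le⟩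
  · have hta : t ∈ Ico a b := ⟨ha'.1.trans ht.1.le, ht.2⟩
    have hwt := hasDerivAt_of_Ico ha'.1 ht (hw t hta)
    have h1 : ‖z'‖ ≤ L * ‖w' t‖ := by
      refine le_of_tendsto_of_tendsto (hasDerivAt_iff_tendsto_slope.1 hz').norm
        ((hasDerivAt_iff_tendsto_slope.1 hwt).norm.const_mul (L : ℝ)) ?_
      filter_upwards [nhdsWithin_le_nhds (Ioo_mem_nhds ht.1 ht.2)] with s hs
      rw [slope_def_module, slope_def_module, norm_smul, norm_smul, mul_left_comm]
      refine mul_le_mul_of_nonneg_left ?_ (norm_nonneg _)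
      simpa [dist_eq_norm] using hVL.dist_le_mul (w s) (hR s ⟨hs.1.le, hs.2⟩).le (w t)
        (hR t ⟨ht.1.le, ht.2⟩).le
    calc z' ≤ ‖z'‖ := Real.le_norm_self z'
      _ ≤ L * ‖w' t‖ := h1
      _ ≤ L * (U (V (w t)) * ψ t) :=
        mul_le_mul_of_nonneg_left (hd t hta (hR t ⟨ht.1.le, ht.2⟩).le) L.2
      _ = U (V (w t)) * (L * ψ t) := mul_left_comm _ _ _

/-- Where the maximum `z` of the functions `V_i ∘ w` is differentiable, its derivative is that of
each `V_j ∘ w` which attains the maximum, because `z - V_j ∘ w` has a minimum there. -/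
theorem exists_norm_le_of_max_functional {w w' : ℝ → W} {a b R : ℝ} (ha : 0 ≤ a)
    (hw : ∀ t ∈ Ico a b, HasDerivWithinAt w (w' t) (Ico a b) t)
    (hv : ∀ r, ∃ C, ∀ t ∈ Ico a b, ‖w t‖ ≤ r → ‖w' t‖ ≤ C)
    {k : ℕ} {V : Fin (k + 1) → W → ℝ} {Vmax : W → ℝ} {U ψ : ℝ → ℝ} (hV0 : ∀ i w, 0 ≤ V i w)
    (hVd : ∀ i, ContDiffOn ℝ 1 (V i) {w | R ≤ ‖w‖})
    (hVm : ∀ w, Vmax w = Finset.univ.sup' Finset.univ_nonempty fun i => V i w)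
    (hU : IsComparisonPair U ψ) (hVt : Tendsto Vmax (Bornology.cobounded W) atTop)
    (hd : ∀ t ∈ Ico a b, R ≤ ‖w t‖ → ∃ j, Vmax (w t) = V j (w t) ∧
      fderivWithin ℝ (V j) {w | R ≤ ‖w‖} (w t) (w' t) ≤ U (Vmax (w t)) * ψ t) {a' : ℝ}
    (ha' : a' ∈ Ico a b) (hR : ∀ t ∈ Ico a' b, R < ‖w t‖) : ∃ C, ∀ t ∈ Ico a' b, ‖w t‖ ≤ C := by
  have hopen : IsOpen {w : W | R < ‖w‖} := isOpen_lt continuous_const continuous_norm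
  have hVd' : ∀ i, ContDiffOn ℝ 1 (V i) {w | R < ‖w‖} := fun i =>
    (hVd i).mono fun w (hw : R < ‖w‖) => hw.le
  have hle : ∀ i u, V i u ≤ Vmax u := fun i u => by
    rw [hVm]; exact Finset.le_sup' (fun i => V i u) (Finset.mem_univ i)
  have hmax : ∀ u, ∃ i, Vmax u = V i u := fun u => by
    obtain ⟨i, -, hi⟩ := Finset.exists_mem_eq_sup' Finset.univ_nonempty fun i => V i u
    exact ⟨i, (hVm u).trans hi⟩
  have hsub : ∀ {c}, c < b → Icc a' c ⊆ Ico a b := fun hc t ht =>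
    ⟨ha'.1.trans ht.1, ht.2.trans_lt hc⟩
  have hderiv : ∀ i, ∀ t ∈ Ico a' b,
      HasDerivWithinAt (fun t => V i (w t)) (fderiv ℝ (V i) (w t) (w' t)) (Ico a b) t := by
    intro i t ht
    have h1 := (((hVd' i).contDiffAt (hopen.mem_nhds (hR t ht))).differentiableAt
      one_ne_zero).hasFDerivAt
    exact h1.comp_hasDerivWithinAt t (hw t ⟨ha'.1.trans ht.1, ht.2⟩)
  have hlip : ∀ c ∈ Ioo a' b, ∀ i, ∃ K : NNReal,
      LipschitzOnWith K (fun t => V i (w t)) (Icc a' c) := by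
    intro c hc i
    obtain ⟨⟨C, hC⟩, -⟩ := exists_lipschitzOnWith_of_hasDerivWithinAt hw hv ha'.1 hc.2
    have hcw : ContinuousOn w (Icc a' c) := fun t ht =>
      ((hw t (hsub hc.2 ht)).mono (hsub hc.2)).continuousWithinAt
    have hcd : ContinuousOn (fun t => fderiv ℝ (V i) (w t)) (Icc a' c) :=
      ((hVd' i).continuousOn_fderiv_of_isOpen hopen le_rfl).comp hcw
        fun t ht => hR t ⟨ht.1, ht.2.trans_lt hc.2⟩
    obtain ⟨C', hC'⟩ := isCompact_Icc.exists_bound_of_continuousOn hcd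
    refine ⟨Real.toNNReal (C' * C), (convex_Icc a' c).lipschitzOnWith_of_nnnorm_hasDerivWithin_le
      (fun t ht => (hderiv i t ⟨ht.1, ht.2.trans_lt hc.2⟩).mono (hsub hc.2)) fun t ht => ?_⟩
    refine NNReal.coe_le_coe.1 (le_trans ?_ (Real.le_coe_toNNReal _))
    calc ‖fderiv ℝ (V i) (w t) (w' t)‖ ≤ ‖fderiv ℝ (V i) (w t)‖ * ‖w' t‖ :=
          ContinuousLinearMap.le_opNorm _ _
      _ ≤ C' * C := mul_le_mul (hC' t ht) (hC t ht) (norm_nonneg _)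
          ((norm_nonneg _).trans (hC' t ht))
  suffices ∃ C, ∀ t ∈ Ico a' b, Vmax (w t) ≤ C by
    obtain ⟨C, hC⟩ := this
    obtain ⟨C', hC'⟩ := exists_norm_le_of_tendsto_cobounded hVt C
    exact ⟨C', fun t ht => hC' _ (hC t ht)⟩
  refine hU.exists_bound (z := fun t => Vmax (w t)) (T := b) (ha.trans ha'.1)
    (fun c hc => ?_) (fun t _ => (hV0 0 _).trans (hle 0 _)) (fun t ht z' hz' => ?_)
  · choose K hK using hlip c hc
    refine ⟨Finset.univ.sup K, LipschitzOnWith.of_le_add_mul _ fun s hs t ht => ?_⟩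
    obtain ⟨i, hi⟩ := hmax (w s)
    have h1 := ((hK i).weaken (Finset.le_sup (Finset.mem_univ i))).dist_le_mul s hs t ht
    rw [Real.dist_eq] at h1
    rw [hi]
    linarith [le_abs_self (V i (w s) - V i (w t)), hle i (w t)]
  · have hta : t ∈ Ico a b := ⟨ha'.1.trans ht.1.le, ht.2⟩
    have htR := hR t ⟨ht.1.le, ht.2⟩
    obtain ⟨j, hj, hdj⟩ := hd t hta htR.le
    have hmem : {w : W | R ≤ ‖w‖} ∈ 𝓝 (w t) :=
      mem_of_superset (hopen.mem_nhds htR) fun u (hu : R < ‖u‖) => hu.le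
    rw [fderivWithin_of_mem_nhds hmem] at hdj
    have h1 := hz'.sub (hasDerivAt_of_Ico ha'.1 ht (hderiv j t ⟨ht.1.le, ht.2⟩))
    have hmin : IsLocalMin ((fun t => Vmax (w t)) - fun t => V j (w t)) t :=
      Eventually.of_forall fun s => by
        simp only [Pi.sub_apply]
        linarith [hle j (w s)]
    have h2 := hmin.hasDerivAt_eq_zero h1
    linarith

end Boundedness

section Drift

variable {𝕜 X Y : Type*} [RCLike 𝕜] [NormedAddCommGroup X] [NormedSpace 𝕜 X]
  [NormedSpace ℝ X] [IsScalarTower ℝ 𝕜 X]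
  [NormedAddCommGroup Y] [NormedSpace 𝕜 Y] [NormedSpace ℝ Y] [IsScalarTower ℝ 𝕜 Y]
  {E : OperatorPair 𝕜 X Y} {ν : ℕ} {S : RootSystem E ν}

namespace RootSystem.Regions

variable {G : S.Regions} {f : ℝ → E.D → Y} {T : S.Y1 →L[𝕜] E.D} {BT : S.Y1 →L[𝕜] Y}

theorem coe_drift (t : ℝ) {x1 : E.D} (h1 : x1 ∈ S.D1) (x20 xS : E.D) :
    (drift S f t x1 x20 xS : Y) = S.Q1 (f t (x1 + x20 + xS)) - E.opB x1 := by
  change S.Q1 (f t (x1 + x20 + xS) - E.opB x1) = _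
  rw [map_sub, Q1_opB, S.P1_of_mem_D1 h1]

theorem Atilde_of_mem_D1 {x : E.D} (hx : x ∈ S.D1) : S.Atilde x = E.opA x := by
  simp only [Atilde, LinearMap.add_apply, LinearMap.sum_apply, LinearMap.smulRight_apply,
    LinearMap.comp_apply, Submodule.subtype_apply, ContinuousLinearMap.coe_coe]
  rw [Finset.sum_eq_zero, add_zero]
  intro i _
  rw [S.p_of_mem_D1 hx (S.one_le_m i), zero_smul]

/-- The boundedness hypothesis on `Q₁ f` controls the velocity of `w` as long as `w` is bounded. -/
theorem exists_norm_drift_le (hbdd : G.Q1Bounded f) (hT : ∀ w, T w ∈ S.D1)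
    (hBT : ∀ w, BT w = E.opB (T w)) (b r : ℝ) : ∃ C, ∀ t ∈ Icc 0 b, ∀ w : S.Y1, ‖w‖ ≤ r →
    ∀ x20 ∈ G.M20, ∀ xS ∈ G.M2Sigma,
      ‖S.Q1 (f t (T w + x20 + xS))‖ ≤ C ∧ ‖drift S f t (T w) x20 xS‖ ≤ C := by
  obtain ⟨C, hC⟩ := hbdd (max b 1) (max (‖T‖ * r) 1) (by positivity) (by positivity)
  refine ⟨C + ‖BT‖ * |r|, fun t ht w hw x20 hx20 xS hxS => ?_⟩
  have h1 : ‖S.Q1 (f t (T w + x20 + xS))‖ ≤ C := by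
    refine hC t ⟨ht.1, ht.2.trans (le_max_left _ _)⟩ _ ⟨_, hT w, _, hx20, _, hxS, rfl⟩ ?_
    rw [P1_add (hT w) (G.isOpen_M20.1 hx20) (G.mem_M2Sigma_iff.1 hxS).1]
    exact ((T.le_opNorm w).trans (mul_le_mul_of_nonneg_left hw (norm_nonneg T))).trans
      (le_max_left _ _)
  refine ⟨h1.trans (le_add_of_nonneg_right (by positivity)), ?_⟩
  have h2 : ‖BT w‖ ≤ ‖BT‖ * |r| := (BT.le_opNorm w).trans
    (mul_le_mul_of_nonneg_left (hw.trans (le_abs_self r)) (norm_nonneg BT))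
  change ‖(drift S f t (T w) x20 xS : Y)‖ ≤ _
  rw [coe_drift t (hT w), ← hBT]
  exact (norm_sub_le _ _).trans (add_le_add h1 h2)

/-- The a priori bound: a solution of the differential equation for the component `w = A x₁` cannot
blow up in finite time. -/
theorem exists_norm_le_of_lyapunov (hbdd : G.Q1Bounded f)
    (hV : G.LyapunovMax f ∨ G.LyapunovLipschitz f) (hT : ∀ w, T w ∈ S.D1)
    (hAT : ∀ w, E.opA (T w) = w) (hBT : ∀ w, BT w = E.opB (T w)) {a b : ℝ} (ha : 0 ≤ a)
    (hab : a < b) {w : ℝ → S.Y1} {x20 xS : ℝ → E.D} (h20 : ∀ t ∈ Ico a b, x20 t ∈ G.M20)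
    (hS : ∀ t ∈ Ico a b, xS t ∈ G.M2Sigma)
    (hw : ∀ t ∈ Ico a b,
      HasDerivWithinAt w (drift S f t (T (w t)) (x20 t) (xS t)) (Ico a b) t) :
    ∃ C, ∀ t ∈ Ico a b, ‖w t‖ ≤ C := by
  have hv : ∀ r, ∃ C, ∀ t ∈ Ico a b, ‖w t‖ ≤ r →
      ‖drift S f t (T (w t)) (x20 t) (xS t)‖ ≤ C := fun r => by
    obtain ⟨C, hC⟩ := exists_norm_drift_le hbdd hT hBT b r
    exact ⟨C, fun t ht htr =>
      (hC t ⟨ha.trans ht.1, ht.2.le⟩ (w t) htr _ (h20 t ht) _ (hS t ht)).2⟩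
  have hAt : ∀ w, S.Atilde (T w) = w := fun w => (Atilde_of_mem_D1 (hT w)).trans (hAT w)
  rcases hV with ⟨R, k, V, Vmax, U, ψ, -, -, hV0, hVd, hVm, hU, hVt, hd⟩ |
    ⟨R, V, U, ψ, -, -, hV0, ⟨L, hVL⟩, hU, hVt, hd⟩
  · refine exists_norm_le_of_late hab hw (hv (R + 1)) fun a' ha' hR =>
      exists_norm_le_of_max_functional ha hw hv hV0 hVd hVm hU hVt (fun t ht htR => ?_) ha' hR
    obtain ⟨j, hj, hdj⟩ := hd (w t) htR
    exact ⟨j, hj, hdj _ (hAt _) t (ha.trans ht.1) _ (h20 t ht) _ (hS t ht)⟩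
  · exact exists_norm_le_of_late hab hw (hv (R + 1)) fun a' ha' hR =>
      exists_norm_le_of_lipschitz_functional ha hw hv hV0 hVL hU hVt (fun t ht htR =>
        hd (w t) htR _ (hAt _) t (ha.trans ht.1) _ (h20 t ht) _ (hS t ht)) ha' hR

end RootSystem.Regions

end Drift

/-! ### The equation in components, and the function `x_{2Σ}` -/

section Components

variable {𝕜 X Y : Type*} [RCLike 𝕜] [NormedAddCommGroup X] [NormedSpace 𝕜 X]
  [NormedAddCommGroup Y] [NormedSpace 𝕜 Y]
  {E : OperatorPair 𝕜 X Y} {ν : ℕ} (S : RootSystem E ν)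

namespace RootSystem

/-- Only the arguments listed in the structural assumption influence `Q_{2s}^{(s+1)} f`. -/
theorem QLast_structure {f : ℝ → E.D → Y} (hf : S.HasStructure f) {t : ℝ} (ht : 0 ≤ t) (x : E.D)
    {s : ℕ} (hs : s ∈ Finset.Ico 1 ν) :
    S.QLast s (f t x) = S.QLast s (f t (∑ j ∈ Finset.Ico s ν, S.PLast j x)) := by
  conv_lhs => rw [hf t ht x]
  have h1 := (Finset.mem_Ico.1 hs).1
  have h20 : S.QLast s (S.Q20 (f t x)) = 0 := S.projY_projY_of_disjoint (fun i r _ h h' => by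
    have : r = 0 := h'
    have := h.1
    omega) _
  have hw : ∀ j ∈ Finset.Ico 1 (ν - 1), ∀ y, S.QLast s (S.QSigma j y) = 0 := fun j _ y =>
    S.projY_projY_of_disjoint (fun i r _ h h' => by
      have := h.1; have := h.2; have := h'.1; have := h'.2; omega) y
  have hl : ∀ j ∈ Finset.Ico 1 ν, j ≠ s → ∀ y, S.QLast s (S.QLast j y) = 0 := fun j _ hj y =>
    S.projY_projY_of_disjoint (fun i r _ h h' => hj (h'.1.symm.trans h.1)) y
  have hQ1 : S.QLast s (S.Q1 (f t x)) = 0 := S.projY_all_Q1 _ _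
  rw [map_add, map_add, map_add, map_sum, map_sum, h20, hQ1,
    Finset.sum_eq_zero fun j hj => hw j hj _,
    Finset.sum_eq_single_of_mem s hs fun j hj hjs => hl j hj hjs _, zero_add, zero_add, zero_add]
  exact S.projY_projY (fun _ _ _ h => h) _

/-- Only the arguments listed in the structural assumption influence `Q_{2Σ,s} f`. -/
theorem QSigma_structure {f : ℝ → E.D → Y} (hf : S.HasStructure f) {t : ℝ} (ht : 0 ≤ t) (x : E.D)
    {s : ℕ} (hs : s ∈ Finset.Ico 1 (ν - 1)) :
    S.QSigma s (f t x) = S.QSigma s (f t (∑ j ∈ Finset.Ico 1 ν, S.PLast j x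
      + ∑ j ∈ Finset.Ico s (ν - 1), S.PWedge j x)) := by
  conv_lhs => rw [hf t ht x]
  have h1 := (Finset.mem_Ico.1 hs).1
  have h20 : S.QSigma s (S.Q20 (f t x)) = 0 := S.projY_projY_of_disjoint (fun i r _ h h' => by
    have : r = 0 := h'
    have := h.1
    omega) _
  have hl : ∀ j ∈ Finset.Ico 1 ν, ∀ y, S.QSigma s (S.QLast j y) = 0 := fun j _ y =>
    S.projY_projY_of_disjoint (fun i r _ h h' => by
      have := h.1; have := h.2; have := h'.1; have := h'.2; omega) y
  have hw : ∀ j ∈ Finset.Ico 1 (ν - 1), j ≠ s → ∀ y, S.QSigma s (S.QSigma j y) = 0 :=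
    fun j _ hj y => S.projY_projY_of_disjoint (fun i r _ h h' => hj (h'.1.symm.trans h.1)) y
  have hQ1 : S.QSigma s (S.Q1 (f t x)) = 0 := S.projY_all_Q1 _ _
  rw [map_add, map_add, map_add, map_sum, map_sum, h20, hQ1,
    Finset.sum_eq_zero fun j hj => hl j hj _,
    Finset.sum_eq_single_of_mem s hs fun j hj hjs => hw j hj hjs _, zero_add, zero_add, add_zero]
  exact S.projY_projY (fun _ _ _ h => h) _

theorem FLast_PLast (f : ℝ → E.D → Y) (t : ℝ) (x : E.D) {s : ℕ} (hs : s ∈ Finset.Ico 1 ν) :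
    S.FLast f s t (S.PLast s x) (fun j => S.PLast j x)
      = S.QLast s (f t (∑ j ∈ Finset.Ico s ν, S.PLast j x)) - E.opB (S.PLast s x) := by
  rw [FLast, Finset.sum_eq_sum_Ico_succ_bot (Finset.mem_Ico.1 hs).2]

theorem FSigma_PWedge (f : ℝ → E.D → Y) (t : ℝ) (x d d' : E.D) {s : ℕ}
    (hs : s ∈ Finset.Ico 1 (ν - 1)) :
    S.FSigma f s t (fun j => S.PLast j x) (S.PWedge s x) (fun j => S.PWedge j x) d d'
      = S.QSigma s (f t (∑ j ∈ Finset.Ico 1 ν, S.PLast j x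
        + ∑ j ∈ Finset.Ico s (ν - 1), S.PWedge j x)) - E.opB (S.PWedge s x) - E.opA (d + d') := by
  rw [FSigma, Finset.sum_eq_sum_Ico_succ_bot (Finset.mem_Ico.1 hs).2, add_assoc]

theorem PWedge_eq_zero {s : ℕ} (hs : ν - 1 ≤ s) (x : E.D) : S.PWedge s x = 0 :=
  S.projD_eq_zero fun i r _ h => by
    have := S.m_le i; have := h.1; have := h.2; omega

/-- The equation `z + B x = f(t, x)`, where `z` stands for `d/dt [A x]`, splits into equations for
the components. -/
theorem equation_iff {f : ℝ → E.D → Y} (hf : S.HasStructure f) {t : ℝ} (ht : 0 ≤ t) (x : E.D)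
    (z : Y) : z + E.opB x = f t x ↔
      S.Q1 z + E.opB (S.P1 x) = S.Q1 (f t x) ∧
      S.Q20 z + E.opB (S.projD S.eig x) = S.Q20 (f t x) ∧
      (∀ s ∈ Finset.Ico 1 ν, S.QLast s z + E.opB (S.PLast s x)
        = S.QLast s (f t (∑ j ∈ Finset.Ico s ν, S.PLast j x))) ∧
      ∀ s ∈ Finset.Ico 1 (ν - 1), S.QSigma s z + E.opB (S.PWedge s x)
        = S.QSigma s (f t (∑ j ∈ Finset.Ico 1 ν, S.PLast j x
            + ∑ j ∈ Finset.Ico s (ν - 1), S.PWedge j x)) := by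
  simp only [← Q1_opB, ← Q20_opB, ← QLast_opB, ← QSigma_opB, ← map_add]
  constructor
  · intro h
    rw [h]
    exact ⟨rfl, rfl, fun s hs => S.QLast_structure hf ht x hs,
      fun s hs => S.QSigma_structure hf ht x hs⟩
  · rintro ⟨h1, h20, hl, hw⟩
    exact S.eq_of_components h1 h20 (fun s hs => (hl s hs).trans (S.QLast_structure hf ht x hs).symm)
      fun s hs => (hw s hs).trans (S.QSigma_structure hf ht x hs).symm

end RootSystem

end Components

section AdjointComponent

variable {𝕜 X Y : Type*} [RCLike 𝕜] [NormedAddCommGroup X] [NormedSpace 𝕜 X]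
  [NormedSpace ℝ X] [IsScalarTower ℝ 𝕜 X]
  [NormedAddCommGroup Y] [NormedSpace 𝕜 Y] [NormedSpace ℝ Y] [IsScalarTower ℝ 𝕜 Y]
  {E : OperatorPair 𝕜 X Y} {ν : ℕ} {S : RootSystem E ν}

namespace RootSystem

theorem hasDerivWithinAt_projD {x : ℝ → E.D} {x' : E.D} {s : Set ℝ} {t : ℝ}
    (h : HasDerivWithinAt x x' s t) (T : Fin S.n → ℕ → Prop) :
    HasDerivWithinAt (fun t => S.projD T (x t)) (S.projD T x') s t :=
  (S.compProjL LinearMap.id T).hasFDerivAt.comp_hasDerivWithinAt t h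

theorem derivWithin_projD {x : ℝ → E.D} (hx : DifferentiableOn ℝ x (Ici 0)) {t : ℝ} (ht : 0 ≤ t)
    (T : Fin S.n → ℕ → Prop) :
    derivWithin (fun t => S.projD T (x t)) (Ici 0) t = S.projD T (derivWithin x (Ici 0) t) :=
  (S.hasDerivWithinAt_projD (hx t ht).hasDerivWithinAt T).derivWithin (uniqueDiffOn_Ici 0 t ht)

namespace Regions

/-- `xS` solves the equations for the component `x_{2Σ}`. These equations do not involve the other
components, so that `xS` is the same function of time for all solutions. -/
structure IsAdjComponent (G : S.Regions) (f : ℝ → E.D → Y) (xS : ℝ → E.D) : Prop where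
  contDiffOn : ContDiffOn ℝ 1 xS (Ici 0)
  mem : ∀ t, 0 ≤ t → xS t ∈ G.M2Sigma
  last : ∀ s ∈ Finset.Ico 1 ν, ∀ t, 0 ≤ t →
    S.FLast f s t (S.PLast s (xS t)) (fun j => S.PLast j (xS t)) = 0
  wedge : ∀ s ∈ Finset.Ico 1 (ν - 1), ∀ t, 0 ≤ t →
    S.FSigma f s t (fun j => S.PLast j (xS t)) (S.PWedge s (xS t)) (fun j => S.PWedge j (xS t))
      (S.PLast (s + 1) (derivWithin xS (Ici 0) t))
      (S.PWedge (s + 1) (derivWithin xS (Ici 0) t)) = 0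

variable {G : S.Regions} {f : ℝ → E.D → Y}

theorem exists_isAdjComponent (hsm : G.Smoothness f) (hun : G.UniqueSolvability f)
    (hinv : G.Invertibility f) : ∃ xS, G.IsAdjComponent f xS := by
  obtain ⟨x, hx⟩ := G.exists_last_family hsm hun hinv
  obtain ⟨z, hz, hz0⟩ := G.exists_wedge_family hsm hun hinv
    (x := x) fun j hj => ⟨(hx j hj).1, (hx j hj).2.2⟩
  have hxD : ∀ t, 0 ≤ t → ∀ j ∈ Finset.Ico 1 ν, x j t ∈ S.DLast j := fun t ht j hj =>
    (G.isOpen_MLast j hj).1 ((hx j hj).1 t ht)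
  have hzD : ∀ t, 0 ≤ t → ∀ j ∈ Finset.Ico 1 (ν - 1), z j t ∈ S.DWedge j := fun t ht j hj =>
    (G.isOpen_MWedge j hj).1 ((hz j hj).1 t ht)
  let xS : ℝ → E.D := fun t => ∑ j ∈ Finset.Ico 1 ν, x j t + ∑ j ∈ Finset.Ico 1 (ν - 1), z j t
  have hl : ∀ t, 0 ≤ t → ∀ j ∈ Finset.Ico 1 ν, S.PLast j (xS t) = x j t := fun t ht j hj =>
    PLast_sum (hxD t ht) (hzD t ht) hj
  have hw : ∀ t, 0 ≤ t → ∀ j, 1 ≤ j → S.PWedge j (xS t) = z j t := fun t ht j hj => by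
    rcases lt_or_ge j (ν - 1) with h | h
    · exact PWedge_sum (hxD t ht) (hzD t ht) (Finset.mem_Ico.2 ⟨hj, h⟩)
    · rw [S.PWedge_eq_zero h, hz0 j h]; rfl
  have hC : ContDiffOn ℝ 1 xS (Ici 0) := by
    refine (ContDiffOn.sum fun j hj => (hx j hj).2.2.of_le ?_).add
      (ContDiffOn.sum fun j hj => (hz j hj).2.2.of_le ?_)
    · have := Finset.mem_Ico.1 hj
      have h : 1 ≤ if j = ν - 1 then ν - 1 else ν - 2 := by split_ifs <;> omega
      exact_mod_cast h
    · exact_mod_cast (Finset.mem_Ico.1 hj).1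
  have hd := hC.differentiableOn one_ne_zero
  refine ⟨xS, hC, fun t ht => ?_, fun s hs t ht => ?_, fun s hs t ht => ?_⟩
  · exact ⟨_, ⟨fun j => x j t, fun j hj => (hx j hj).1 t ht, rfl⟩, _,
      ⟨fun j => z j t, fun j hj => (hz j hj).1 t ht, rfl⟩, rfl⟩
  · rw [hl t ht s hs, ← (hx s hs).2.1 t ht]
    refine S.FLast_congr f s t _ fun j hj => hl t ht j ?_
    rw [Finset.mem_Ico] at hs hj ⊢
    omega
  · have hs' := Finset.mem_Ico.1 hs
    have e1 : derivWithin (x (s + 1)) (Ici 0) t = S.PLast (s + 1) (derivWithin xS (Ici 0) t) := by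
      rw [PLast, ← derivWithin_projD hd ht]
      exact derivWithin_congr (fun τ hτ => (hl τ hτ _ (Finset.mem_Ico.2 (by omega))).symm)
        (hl t ht _ (Finset.mem_Ico.2 (by omega))).symm
    have e2 : derivWithin (z (s + 1)) (Ici 0) t = S.PWedge (s + 1) (derivWithin xS (Ici 0) t) := by
      rw [PWedge, ← derivWithin_projD hd ht]
      exact derivWithin_congr (fun τ hτ => (hw τ hτ _ (by omega)).symm)
        (hw t ht _ (by omega)).symm
    rw [hw t ht s hs'.1, ← e1, ← e2, ← (hz s hs).2.1 t ht]
    refine S.FSigma_congr f s t _ _ _ (fun j hj => hl t ht j hj) fun j hj => hw t ht j ?_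
    have := Finset.mem_Ico.1 hj
    omega

theorem IsAdjComponent.continuousOn_derivWithin {xS : ℝ → E.D} (h : G.IsAdjComponent f xS) :
    ContinuousOn (derivWithin xS (Ici 0)) (Ici 0) :=
  h.contDiffOn.continuousOn_derivWithin (uniqueDiffOn_Ici 0) le_rfl

theorem IsAdjComponent.hasDerivWithinAt {xS : ℝ → E.D} (h : G.IsAdjComponent f xS) {t : ℝ}
    (ht : 0 ≤ t) : HasDerivWithinAt xS (derivWithin xS (Ici 0) t) (Ici 0) t :=
  (h.contDiffOn.differentiableOn one_ne_zero t ht).hasDerivWithinAt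

theorem IsAdjComponent.mem_D2Sigma {xS : ℝ → E.D} (h : G.IsAdjComponent f xS) {t : ℝ}
    (ht : 0 ≤ t) : xS t ∈ S.D2Sigma := (G.mem_M2Sigma_iff.1 (h.mem t ht)).1

theorem IsAdjComponent.derivWithin_mem {xS : ℝ → E.D} (h : G.IsAdjComponent f xS) {t : ℝ}
    (ht : 0 ≤ t) : derivWithin xS (Ici 0) t ∈ S.D2Sigma :=
  S.derivWithin_mem_spanD (fun _ => h.mem_D2Sigma) (h.contDiffOn.differentiableOn one_ne_zero) ht

end Regions

end RootSystem

end AdjointComponent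

/-! ### The reduced equation and existence -/

section ReducedEquation

variable {𝕜 X Y : Type*} [RCLike 𝕜] [NormedAddCommGroup X] [NormedSpace 𝕜 X]
  [NormedSpace ℝ X] [IsScalarTower ℝ 𝕜 X]
  [NormedAddCommGroup Y] [NormedSpace 𝕜 Y] [NormedSpace ℝ Y] [IsScalarTower ℝ 𝕜 Y]
  {E : OperatorPair 𝕜 X Y} {ν : ℕ} {S : RootSystem E ν}

namespace RootSystem.Regions

variable {G : S.Regions} {f : ℝ → E.D → Y} {T : S.Y1 →L[𝕜] E.D} {BT : S.Y1 →L[𝕜] Y}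
  {xS : ℝ → E.D} {η : ℝ → S.Y1 → S.D20}

/-- `η t w` solves the equation for `x_{20}` in which `x₁ = T w` and `x_{2Σ}` is given. -/
def IsEigComponent (G : S.Regions) (f : ℝ → E.D → Y) (T : S.Y1 →L[𝕜] E.D) (xS : ℝ → E.D)
    (η : ℝ → S.Y1 → S.D20) : Prop :=
  ∀ t, 0 ≤ t → ∀ w, (η t w : E.D) ∈ G.M20 ∧
    S.F20 f t (T w) (η t w) (xS t) (S.PLast 1 (derivWithin xS (Ici 0) t))
      (S.PWedge 1 (derivWithin xS (Ici 0) t)) = 0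

/-- The state `x = x₁ + x_{20} + x_{2Σ}` determined by `w = A x₁` at time `t`. -/
noncomputable def state (T : S.Y1 →L[𝕜] E.D) (xS : ℝ → E.D) (η : ℝ → S.Y1 → S.D20) (t : ℝ)
    (w : S.Y1) : E.D :=
  T w + η t w + xS t

/-- The vector field of the differential equation for `w = A x₁` in `Y₁`, obtained by eliminating
`x_{20}` and `x_{2Σ}`. -/
noncomputable def reducedField (f : ℝ → E.D → Y) (T : S.Y1 →L[𝕜] E.D) (xS : ℝ → E.D)
    (η : ℝ → S.Y1 → S.D20) (t : ℝ) (w : S.Y1) : S.Y1 :=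
  drift S f t (T w) (η t w) (xS t)

theorem coe_reducedField (hT : ∀ w, T w ∈ S.D1) (hBT : ∀ w, BT w = E.opB (T w)) (t : ℝ)
    (w : S.Y1) : (reducedField f T xS η t w : Y) = S.Q1 (f t (state T xS η t w)) - BT w := by
  rw [reducedField, coe_drift t (hT w), hBT]; rfl

theorem exists_isEigComponent (huniq : G.UniqueSolvability f) (hT : ∀ w, T w ∈ S.D1)
    (hS : G.IsAdjComponent f xS) : ∃ η, G.IsEigComponent f T xS η := by
  have : ∀ t w, ∃ y : S.D20, 0 ≤ t → (y : E.D) ∈ G.M20 ∧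
      S.F20 f t (T w) y (xS t) (S.PLast 1 (derivWithin xS (Ici 0) t))
        (S.PWedge 1 (derivWithin xS (Ici 0) t)) = 0 := fun t w => by
    by_cases ht : 0 ≤ t
    · obtain ⟨y, hy, -⟩ := huniq.eig t ht (T w) (hT w) (xS t) (hS.mem t ht) _ (S.projD_mem _ _) _
        (S.projD_mem _ _)
      exact ⟨⟨y, G.isOpen_M20.1 hy.1⟩, fun _ => hy⟩
    · exact ⟨0, fun h => absurd h ht⟩
  choose η hη using this
  exact ⟨η, fun t ht w => hη t w ht⟩

theorem IsEigComponent.continuousOn (hη : G.IsEigComponent f T xS η)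
    (hf : ContinuousOn (fun z : ℝ × E.D => f z.1 z.2) (Ici 0 ×ˢ univ))
    (huniq : G.UniqueSolvability f) (hc : G.EigContraction f) (hT : ∀ w, T w ∈ S.D1)
    (hS : G.IsAdjComponent f xS) : ContinuousOn (Function.uncurry η) (Ici 0 ×ˢ univ) :=
  continuousOn_eigSolution hf huniq hc hT hS.mem (fun _ _ => S.projD_mem _ _)
    (fun _ _ => S.projD_mem _ _) hS.contDiffOn.continuousOn
    ((S.continuous_projD _).comp_continuousOn hS.continuousOn_derivWithin)
    ((S.continuous_projD _).comp_continuousOn hS.continuousOn_derivWithin) hη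

theorem state_mem (hη : G.IsEigComponent f T xS η) (hT : ∀ w, T w ∈ S.D1)
    (hS : G.IsAdjComponent f xS) {t : ℝ} (ht : 0 ≤ t) (w : S.Y1) : state T xS η t w ∈ G.M :=
  ⟨_, hT w, _, (hη t ht w).1, _, hS.mem t ht, rfl⟩

theorem P1_state (hT : ∀ w, T w ∈ S.D1) (hS : G.IsAdjComponent f xS) {t : ℝ} (ht : 0 ≤ t)
    (w : S.Y1) : S.P1 (state T xS η t w) = T w :=
  P1_add (hT w) (η t w).2 (hS.mem_D2Sigma ht)

theorem projD_adj_state (hT : ∀ w, T w ∈ S.D1) (hS : G.IsAdjComponent f xS) {t : ℝ} (ht : 0 ≤ t)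
    (w : S.Y1) : S.projD S.adj (state T xS η t w) = xS t :=
  projD_adj_add (hT w) (η t w).2 (hS.mem_D2Sigma ht)

theorem continuousOn_state (hS : G.IsAdjComponent f xS)
    (cη : ContinuousOn (Function.uncurry η) (Ici 0 ×ˢ univ)) :
    ContinuousOn (Function.uncurry (state T xS η)) (Ici 0 ×ˢ univ) :=
  ((T.continuous.comp continuous_snd).continuousOn.add
    (continuous_subtype_val.comp_continuousOn cη)).add
    (hS.contDiffOn.continuousOn.comp continuous_fst.continuousOn fun _ h => h.1)

theorem continuousOn_reducedField (hT : ∀ w, T w ∈ S.D1) (hBT : ∀ w, BT w = E.opB (T w))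
    (hf : ContinuousOn (fun z : ℝ × E.D => f z.1 z.2) (Ici 0 ×ˢ univ))
    (hS : G.IsAdjComponent f xS) (cη : ContinuousOn (Function.uncurry η) (Ici 0 ×ˢ univ)) :
    ContinuousOn (Function.uncurry (reducedField f T xS η)) (Ici 0 ×ˢ univ) := by
  rw [Topology.IsInducing.subtypeVal.continuousOn_iff]
  have h1 : ContinuousOn (fun z : ℝ × S.Y1 => f z.1 (state T xS η z.1 z.2)) (Ici 0 ×ˢ univ) :=
    hf.comp (continuous_fst.continuousOn.prodMk (continuousOn_state hS cη))
      fun z hz => ⟨hz.1, mem_univ _⟩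
  refine ((S.continuous_Q1.comp_continuousOn h1).sub
    (BT.continuous.comp continuous_snd).continuousOn).congr fun z _ => ?_
  exact coe_reducedField hT hBT z.1 z.2

/-- Composition of the Lipschitz dependence of `Q₁ f` on `x₁ + x_{20}` with that of `x_{20}` on `w`. -/
theorem locallyLipschitzField_reducedField (hη : G.IsEigComponent f T xS η)
    (hc : G.EigContraction f) (hL1 : G.LocallyLipschitz fun t x => S.Q1 (f t x))
    (hL20 : G.LocallyLipschitz fun t x => S.Q20 (f t x)) (hT : ∀ w, T w ∈ S.D1)
    (hBT : ∀ w, BT w = E.opB (T w)) (hS : G.IsAdjComponent f xS)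
    (cη : ContinuousOn (Function.uncurry η) (Ici 0 ×ˢ univ)) :
    LocallyLipschitzField (reducedField f T xS η) := by
  intro t₀ ht₀ w₀
  obtain ⟨K, hK⟩ := locallyLipschitz_eigSolution hc hL20 hT hS.mem (fun _ _ => S.projD_mem _ _)
    (fun _ _ => S.projD_mem _ _) hS.contDiffOn.continuousOn
    ((S.continuous_projD _).comp_continuousOn hS.continuousOn_derivWithin)
    ((S.continuous_projD _).comp_continuousOn hS.continuousOn_derivWithin) hη cη ht₀ w₀
  obtain ⟨I, hI, N, hN, L, hLN⟩ := hL1 t₀ ht₀ _ (state_mem hη hT hS ht₀ w₀)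
  have hst : ∀ᶠ z in 𝓝[Ici 0 ×ˢ univ] (t₀, w₀), state T xS η z.1 z.2 ∈ N ∧ z.1 ∈ I := by
    have h1 := (continuousOn_state (T := T) hS cη (t₀, w₀) ⟨ht₀, mem_univ _⟩).eventually_mem hN
    have h2 : Tendsto (fun z : ℝ × S.Y1 => z.1) (𝓝[Ici 0 ×ˢ univ] (t₀, w₀)) (𝓝[Ici 0] t₀) :=
      tendsto_nhdsWithin_iff.2 ⟨(continuous_fst.tendsto (t₀, w₀)).mono_left nhdsWithin_le_nhds, by
        filter_upwards [self_mem_nhdsWithin] with z hz using hz.1⟩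
    exact h1.and (h2.eventually hI)
  obtain ⟨r₀, hr₀, hr⟩ := Metric.mem_nhdsWithin_iff.1 hst
  obtain ⟨r, hrK, hrr⟩ := (hK.and (Ioo_mem_nhdsGT hr₀)).exists
  refine ⟨r, hrr.1, Real.toNNReal (|L| * (‖T‖ + K) + ‖BT‖), fun t ht htr => ?_⟩
  refine LipschitzOnWith.of_dist_le_mul fun w hw w' hw' => ?_
  have hgood : ∀ w ∈ Metric.ball w₀ r, state T xS η t w ∈ N ∧ t ∈ I := fun w hw =>
    hr (a := (t, w)) ⟨by
      rw [Metric.mem_ball, Prod.dist_eq, max_lt_iff, Real.dist_eq]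
      exact ⟨htr.trans hrr.2, lt_trans hw hrr.2⟩, ht, mem_univ _⟩
  have h1 := hLN t (hgood w hw).2 ht _ ⟨(hgood w hw).1, state_mem hη hT hS ht w⟩ _
    ⟨(hgood w' hw').1, state_mem hη hT hS ht w'⟩
    ((projD_adj_state hT hS ht w).trans (projD_adj_state hT hS ht w').symm)
  have h2 : ‖state T xS η t w - state T xS η t w'‖ ≤ (‖T‖ + K) * ‖w - w'‖ := by
    have e : state T xS η t w - state T xS η t w' = T (w - w') + ((η t w - η t w' : S.D20) : E.D) := by
      rw [map_sub, Submodule.coe_sub, state, state]; abel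
    rw [e, add_mul]
    exact (norm_add_le _ _).trans (add_le_add (T.le_opNorm _) (hrK t ht htr w hw w' hw'))
  have h3 : ‖S.Q1 (f t (state T xS η t w)) - S.Q1 (f t (state T xS η t w'))‖
      ≤ |L| * ((‖T‖ + K) * ‖w - w'‖) :=
    h1.trans (mul_le_mul (le_abs_self L) h2 (norm_nonneg _) (abs_nonneg L))
  refine le_trans ?_ (mul_le_mul_of_nonneg_right (Real.le_coe_toNNReal _) dist_nonneg)
  rw [dist_eq_norm, dist_eq_norm]
  change ‖(reducedField f T xS η t w : Y) - (reducedField f T xS η t w' : Y)‖ ≤ _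
  rw [coe_reducedField hT hBT, coe_reducedField hT hBT, sub_sub_sub_comm, ← map_sub BT]
  calc _ ≤ _ := norm_sub_le _ _
    _ ≤ |L| * ((‖T‖ + K) * ‖w - w'‖) + ‖BT‖ * ‖w - w'‖ := add_le_add h3 (BT.le_opNorm _)
    _ = _ := by ring

/-- The a priori bound turns local existence for the reduced equation into global existence. -/
theorem exists_reduced_solution [CompleteSpace Y] (hη : G.IsEigComponent f T xS η)
    (hlip : LocallyLipschitzField (reducedField f T xS η))
    (hcont : ContinuousOn (Function.uncurry (reducedField f T xS η)) (Ici 0 ×ˢ univ))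
    (hbdd : G.Q1Bounded f) (hV : G.LyapunovMax f ∨ G.LyapunovLipschitz f)
    (hT : ∀ w, T w ∈ S.D1) (hAT : ∀ w, E.opA (T w) = w) (hBT : ∀ w, BT w = E.opB (T w))
    (hS : G.IsAdjComponent f xS) {t₀ : ℝ} (ht₀ : 0 ≤ t₀) (w₀ : S.Y1) :
    ∃ w : ℝ → S.Y1, w t₀ = w₀ ∧
      ∀ t, t₀ ≤ t → HasDerivWithinAt w (reducedField f T xS η t (w t)) (Ici t₀) t := by
  refine hlip.exists_global_solution hcont (fun a b ha hab w hw => ?_) ht₀ w₀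
  obtain ⟨C, hC⟩ := exists_norm_le_of_lyapunov hbdd hV hT hAT hBT ha hab
    (x20 := fun t => η t (w t)) (xS := xS) (fun t ht => (hη t (ha.trans ht.1) _).1)
    (fun t ht => hS.mem t (ha.trans ht.1)) hw
  obtain ⟨C', hC'⟩ := exists_norm_drift_le hbdd hT hBT b C
  exact ⟨C', fun t ht => (hC' t ⟨ha.trans ht.1, ht.2.le⟩ (w t) (hC t ht) _
    (hη t (ha.trans ht.1) _).1 _ (hS.mem t (ha.trans ht.1))).2⟩

/-- A solution of the reduced equation yields a solution of the original one. -/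
theorem isSolutionOn_state (hstruct : S.HasStructure f) (hη : G.IsEigComponent f T xS η)
    (cη : ContinuousOn (Function.uncurry η) (Ici 0 ×ˢ univ))
    (hcont : ContinuousOn (Function.uncurry (reducedField f T xS η)) (Ici 0 ×ˢ univ))
    (hT : ∀ w, T w ∈ S.D1) (hAT : ∀ w, E.opA (T w) = w) (hBT : ∀ w, BT w = E.opB (T w))
    (hS : G.IsAdjComponent f xS) {t₀ : ℝ} (ht₀ : 0 ≤ t₀) {x₀₁ : E.D} {w : ℝ → S.Y1}
    (hw₀ : T (w t₀) = x₀₁)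
    (hw : ∀ t, t₀ ≤ t → HasDerivWithinAt w (reducedField f T xS η t (w t)) (Ici t₀) t) :
    G.IsSolutionOn f t₀ x₀₁ (Ici t₀) fun t => state T xS η t (w t) := by
  have cw : ContinuousOn w (Ici t₀) := fun t ht => (hw t ht).continuousWithinAt
  have cgraph : ContinuousOn (fun t => (t, w t)) (Ici t₀) := continuousOn_id.prodMk cw
  have hgraph : MapsTo (fun t => (t, w t)) (Ici t₀) (Ici 0 ×ˢ univ) := fun t ht =>
    ⟨ht₀.trans ht, mem_univ _⟩
  have hsub : Ici t₀ ⊆ Ici 0 := Ici_subset_Ici.2 ht₀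
  have hA : ∀ t, t₀ ≤ t → E.opA (state T xS η t (w t))
      = (w t : Y) + S.compProjL E.opA S.adj (xS t) := fun t ht => by
    have h0 : E.opA (η t (w t) : E.D) = 0 := by
      have h := (η t (w t)).2
      refine Submodule.span_induction (p := fun x _ => E.opA x = 0) ?_ (map_zero _)
        (fun x y _ _ hx hy => by rw [map_add, hx, hy, add_zero])
        (fun a x _ hx => by rw [map_smul, hx, smul_zero]) h
      rintro _ ⟨i, r, -, hr, rfl⟩
      have hr : r = 0 := hr
      rw [hr, S.opA_eigenvector]
    rw [state, map_add, map_add, hAT, h0, add_zero,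
      S.compProjL_of_mem E.opA (hS.mem_D2Sigma (ht₀.trans ht))]
  let ι : S.Y1 →L[ℝ] Y := S.Y1.subtypeL.restrictScalars ℝ
  let z : ℝ → Y := fun t => reducedField f T xS η t (w t)
    + S.compProjL E.opA S.adj (derivWithin xS (Ici 0) t)
  have hd : ∀ t, t₀ ≤ t →
      HasDerivWithinAt (fun t => E.opA (state T xS η t (w t))) (z t) (Ici t₀) t := fun t ht => by
    have h1 : HasDerivWithinAt (fun t => (w t : Y)) (reducedField f T xS η t (w t) : Y) (Ici t₀) t :=
      ι.hasFDerivAt.comp_hasDerivWithinAt t (hw t ht)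
    have h2 := (S.compProjL E.opA S.adj).hasFDerivAt.comp_hasDerivWithinAt t
      ((hS.hasDerivWithinAt (ht₀.trans ht)).mono hsub)
    exact (h1.add h2).congr (fun τ hτ => hA τ hτ) (hA t ht)
  have cz : ContinuousOn z (Ici t₀) :=
    (continuous_subtype_val.comp_continuousOn (hcont.comp cgraph hgraph)).add
      ((S.compProjL E.opA S.adj).continuous.comp_continuousOn
        (hS.continuousOn_derivWithin.mono hsub))
  have hUD := uniqueDiffOn_Ici t₀
  refine ⟨(continuousOn_state hS cη).comp cgraph hgraph, ?_, fun t ht => ?_,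
    fun t ht => state_mem hη hT hS (ht₀.trans ht) _, ?_⟩
  · refine ContDiffOn.mono ?_ inter_subset_left
    rw [show (1 : WithTop ℕ∞) = 0 + 1 from (zero_add 1).symm, contDiffOn_succ_iff_derivWithin hUD]
    refine ⟨fun t ht => (hd t ht).differentiableWithinAt, by simp, ?_⟩
    rw [contDiffOn_zero]
    exact cz.congr fun t ht => (hd t ht).derivWithin (hUD t ht)
  · have ht0 : 0 ≤ t := ht₀.trans ht.1
    have hx'D := hS.derivWithin_mem ht0
    have hz : z t = reducedField f T xS η t (w t) + E.opA (derivWithin xS (Ici 0) t) := by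
      simp only [z, S.compProjL_of_mem E.opA hx'D]
    have hY1 : ∀ (U : Fin S.n → ℕ → Prop), S.projY U (reducedField f T xS η t (w t)) = 0 := fun U => by
      rw [← S.Q1_of_mem_Y1 (reducedField f T xS η t (w t)).2, S.projY_all_Q1]
    have hproj : ∀ U : Fin S.n → ℕ → Prop, (∀ i r, U i r → 1 ≤ r) →
        S.projD U (state T xS η t (w t)) = S.projD U (xS t) := fun U hU =>
      projD_add_of_le_adj hU (hT _) (η t (w t)).2
    have hpl : ∀ j, 1 ≤ j → S.PLast j (state T xS η t (w t)) = S.PLast j (xS t) := fun j hj =>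
      hproj _ fun i r h => h.1 ▸ hj
    have hpw : ∀ j, 1 ≤ j → S.PWedge j (state T xS η t (w t)) = S.PWedge j (xS t) := fun j hj =>
      hproj _ fun i r h => h.1 ▸ hj
    have hsl : ∀ s, 1 ≤ s → ∑ j ∈ Finset.Ico s ν, S.PLast j (state T xS η t (w t))
        = ∑ j ∈ Finset.Ico s ν, S.PLast j (xS t) := fun s hs =>
      Finset.sum_congr rfl fun j hj => hpl j (hs.trans (Finset.mem_Ico.1 hj).1)
    have hsw : ∀ s, 1 ≤ s → ∑ j ∈ Finset.Ico s (ν - 1), S.PWedge j (state T xS η t (w t))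
        = ∑ j ∈ Finset.Ico s (ν - 1), S.PWedge j (xS t) := fun s hs =>
      Finset.sum_congr rfl fun j hj => hpw j (hs.trans (Finset.mem_Ico.1 hj).1)
    rw [(hd t ht.1).derivWithin (hUD t ht.1), S.equation_iff hstruct ht0, hz]
    refine ⟨?_, ?_, fun s hs => ?_, fun s hs => ?_⟩
    · rw [map_add, S.Q1_of_mem_Y1 (Subtype.property _), Q1_opA, S.P1_of_mem_spanD hx'D, map_zero,
        add_zero, P1_state hT hS ht0, coe_reducedField hT hBT, hBT, sub_add_cancel]
    · have h := (hη t ht0 (w t)).2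
      rw [F20, ← Q20_opA, Q20, S.projY_projY fun _ _ _ h => h, sub_sub, sub_eq_zero] at h
      have he : S.projD S.eig (state T xS η t (w t)) = η t (w t) :=
        projD_eig_add (hT _) (η t (w t)).2 (hS.mem_D2Sigma ht0)
      rw [map_add, Q20, hY1, zero_add, he, add_comm]
      exact h.symm
    · have h := hS.last s hs t ht0
      rw [S.FLast_PLast f t _ hs, sub_eq_zero] at h
      have hs1 := (Finset.mem_Ico.1 hs).1
      rw [map_add, QLast_opA, add_zero, hsl s hs1, hpl s hs1, h, QLast, hY1, zero_add]
    · have h := hS.wedge s hs t ht0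
      rw [S.FSigma_PWedge f t _ _ _ hs, sub_sub, sub_eq_zero] at h
      have hs1 := (Finset.mem_Ico.1 hs).1
      rw [map_add, QSigma_opA, hsl 1 le_rfl, hsw s hs1, hpw s hs1, h, QSigma, hY1, zero_add,
        add_comm]
  · exact (P1_state hT hS ht₀ _).trans hw₀

end RootSystem.Regions

end ReducedEquation

/-! ### Uniqueness -/

/-- A curve on `(0, b)` whose velocity is bounded by an affine function of its norm has a limit
at `0`. -/
theorem exists_tendsto_nhdsGT_zero {W : Type*} [NormedAddCommGroup W] [NormedSpace ℝ W]
    [CompleteSpace W] {w w' : ℝ → W} {b C K : ℝ} (hb : 0 < b) (hK : 0 ≤ K)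
    (hw : ∀ t ∈ Ioo 0 b, HasDerivAt w (w' t) t)
    (hw' : ∀ t ∈ Ioo 0 b, ‖w' t‖ ≤ C + K * ‖w t‖) : ∃ w₀, Tendsto w (𝓝[>] 0) (𝓝 w₀) := by
  obtain ⟨c, hc, hcK⟩ : ∃ c ∈ Ioo 0 b, c * K ≤ 1 / 2 := by
    refine ⟨min (b / 2) (1 / (2 * (K + 1))), ⟨by positivity, ?_⟩, ?_⟩
    · exact (min_le_left _ _).trans_lt (by linarith)
    · calc _ ≤ 1 / (2 * (K + 1)) * K := mul_le_mul_of_nonneg_right (min_le_right _ _) hK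
        _ = K / (2 * (K + 1)) := by ring
        _ ≤ 1 / 2 := by
          rw [div_le_div_iff₀ (by positivity) two_pos]; linarith
  have hsub : ∀ {a t}, 0 < a → t ∈ Icc a c → t ∈ Ioo 0 b := fun ha ht =>
    ⟨ha.trans_le ht.1, ht.2.trans_lt hc.2⟩
  set M := 2 * (‖w c‖ + C * c) with hM
  have hbd : ∀ a ∈ Ioc 0 c, ‖w a‖ ≤ M := by
    intro a ha
    obtain ⟨s, hs, hmax⟩ := isCompact_Icc.exists_isMaxOn ⟨a, left_mem_Icc.2 ha.2⟩
      (f := fun t => ‖w t‖)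
      fun t ht => ((hw t (hsub ha.1 ht)).continuousAt.norm).continuousWithinAt
    have hm : ∀ t ∈ Icc a c, ‖w t‖ ≤ ‖w s‖ := fun t ht => hmax ht
    have h0 : 0 ≤ C + K * ‖w s‖ := (norm_nonneg _).trans (hw' s (hsub ha.1 hs))
    have h1 := (convex_Icc a c).norm_image_sub_le_of_norm_hasDerivWithin_le
      (C := C + K * ‖w s‖)
      (fun t ht => (hw t (hsub ha.1 ht)).hasDerivWithinAt)
      (fun t ht => (hw' t (hsub ha.1 ht)).trans (by
        have := mul_le_mul_of_nonneg_left (hm t ht) hK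
        linarith))
      (right_mem_Icc.2 ha.2) hs
    have h2 : ‖s - c‖ ≤ c := by
      rw [Real.norm_eq_abs, abs_le]; constructor <;> linarith [hs.1, hs.2, ha.1]
    have h3 : ‖w s‖ ≤ ‖w c‖ + (C + K * ‖w s‖) * c := by
      calc ‖w s‖ = ‖w c + (w s - w c)‖ := by congr 1; abel
        _ ≤ ‖w c‖ + ‖w s - w c‖ := norm_add_le _ _
        _ ≤ _ := by
          have := mul_le_mul_of_nonneg_left h2 h0
          linarith
    have h4 := mul_le_mul_of_nonneg_right hcK (norm_nonneg (w s))
    have h5 := hm a (left_mem_Icc.2 ha.2)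
    rw [hM]
    nlinarith
  have hlip : LipschitzOnWith (Real.toNNReal (C + K * M)) w (Ioc 0 c) := by
    refine (convex_Ioc 0 c).lipschitzOnWith_of_nnnorm_hasDerivWithin_le
      (fun t ht => (hw t ⟨ht.1, ht.2.trans_lt hc.2⟩).hasDerivWithinAt) fun t ht => ?_
    refine NNReal.coe_le_coe.1 (le_trans ?_ (Real.le_coe_toNNReal _))
    have h := mul_le_mul_of_nonneg_left (hbd t ht) hK
    have h' := hw' t ⟨ht.1, ht.2.trans_lt hc.2⟩
    exact h'.trans (by linarith)
  have hcau : Cauchy (map w (𝓝[>] (0 : ℝ))) :=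
    (cauchy_nhds.mono nhdsWithin_le_nhds).map_of_le hlip.uniformContinuousOn
      (le_principal_iff.2 (Ioc_mem_nhdsGT hc.1))
  exact CompleteSpace.complete hcau

section Uniqueness

variable {𝕜 X Y : Type*} [RCLike 𝕜] [NormedAddCommGroup X] [NormedSpace 𝕜 X]
  [NormedSpace ℝ X] [IsScalarTower ℝ 𝕜 X]
  [NormedAddCommGroup Y] [NormedSpace 𝕜 Y] [NormedSpace ℝ Y] [IsScalarTower ℝ 𝕜 Y]
  {E : OperatorPair 𝕜 X Y} {ν : ℕ} {S : RootSystem E ν}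

namespace RootSystem

theorem hasDerivWithinAt_projY {y : ℝ → Y} {y' : Y} {s : Set ℝ} {t : ℝ}
    (h : HasDerivWithinAt y y' s t) (T : Fin S.n → ℕ → Prop) :
    HasDerivWithinAt (fun t => S.projY T (y t)) (S.projY T y') s t :=
  ((⟨S.projY T, S.continuous_projY T⟩ : Y →L[𝕜] Y).restrictScalars ℝ).hasFDerivAt
    |>.comp_hasDerivWithinAt t h

theorem hasDerivWithinAt_Q1 {y : ℝ → Y} {y' : Y} {s : Set ℝ} {t : ℝ}
    (h : HasDerivWithinAt y y' s t) :
    HasDerivWithinAt (fun t => S.Q1.rangeRestrict (y t)) (S.Q1.rangeRestrict y') s t :=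
  ((⟨S.Q1.rangeRestrict, S.continuous_Q1.subtype_mk _⟩ : Y →L[𝕜] S.Y1).restrictScalars
    ℝ).hasFDerivAt.comp_hasDerivWithinAt t h

theorem PLast_eq_zero {s : ℕ} (hs : ν ≤ s) (x : E.D) : S.PLast s x = 0 :=
  S.projD_eq_zero fun i r _ h => by
    have := S.m_le i; have := h.2; omega

namespace Regions

variable {G : S.Regions} {f : ℝ → E.D → Y} {T : S.Y1 →L[𝕜] E.D} {BT : S.Y1 →L[𝕜] Y}
  {xS : ℝ → E.D} {η : ℝ → S.Y1 → S.D20} {t₀ : ℝ} {x₀₁ : E.D} {J : Set ℝ} {y : ℝ → E.D}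

theorem IsSolutionOn.hasDerivWithinAt (hy : G.IsSolutionOn f t₀ x₀₁ J y) {t : ℝ} (ht : t ∈ J)
    (ht0 : 0 < t) :
    HasDerivWithinAt (fun t => E.opA (y t)) (derivWithin (fun t => E.opA (y t)) J t) J t :=
  ((hy.contDiffOn.differentiableOn one_ne_zero t ⟨ht, ht0⟩).mono_of_mem_nhdsWithin
    (inter_mem_nhdsWithin J (Ioi_mem_nhds ht0))).hasDerivWithinAt

theorem uniqueDiffWithinAt_of_mem_nhdsGE {J : Set ℝ} {t : ℝ} (hJ : J ∈ 𝓝[≥] t) :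
    UniqueDiffWithinAt ℝ J t :=
  (uniqueDiffOn_Ici t t self_mem_Ici).mono_nhds (nhdsWithin_le_of_mem hJ)

/-- For `t > 0`, each component of order `s` at the end of a chain is determined by the ones of
higher order. -/
theorem IsSolutionOn.PLast_eq (hy : G.IsSolutionOn f t₀ x₀₁ J y) (hstruct : S.HasStructure f)
    (huniq : G.UniqueSolvability f) (hS : G.IsAdjComponent f xS)
    (hJ : ∀ t ∈ J, J ∈ 𝓝[≥] t) {t : ℝ} (ht : t ∈ J) (ht0 : 0 < t) {s : ℕ} (hs : 1 ≤ s) :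
    S.PLast s (y t) = S.PLast s (xS t) := by
  have heq := ((S.equation_iff hstruct ht0.le _ _).1 (hy.equation t ⟨ht, ht0⟩)).2.2.1
  have hMy := (G.mem_M2Sigma_iff.1 (G.mem_M_iff.1 (hy.mem t ht)).2).2.1
  have hMx := (G.mem_M2Sigma_iff.1 (hS.mem t ht0.le)).2.1
  induction h : ν - s using Nat.strong_induction_on generalizing s with
  | _ k ih =>
    rcases le_or_gt ν s with hνs | hνs
    · rw [S.PLast_eq_zero hνs, S.PLast_eq_zero hνs]
    have hs' : s ∈ Finset.Ico 1 ν := Finset.mem_Ico.2 ⟨hs, hνs⟩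
    have hIco : ∀ j ∈ Finset.Ico (s + 1) ν, j ∈ Finset.Ico 1 ν := fun j hj => by
      rw [Finset.mem_Ico] at hj ⊢; omega
    refine (huniq.last s hs' t ht0.le (fun j => S.PLast j (xS t))
      fun j hj => hMx j (hIco j hj)).unique ⟨?_, ?_⟩ ⟨hMx s hs', hS.last s hs' t ht0.le⟩
    · have h1 : S.PLast s (S.projD S.adj (y t)) = S.PLast s (y t) :=
        S.projD_projD (fun i r _ h => h.1 ▸ hs) _
      exact h1 ▸ hMy s hs'
    · have h0 : S.QLast s (derivWithin (fun t => E.opA (y t)) J t) = 0 :=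
        (uniqueDiffWithinAt_of_mem_nhdsGE (hJ t ht)).eq_deriv J
          (S.hasDerivWithinAt_projY (hy.hasDerivWithinAt ht ht0) (S.last s))
          ((hasDerivWithinAt_const t J (0 : Y)).congr_of_mem (fun τ _ => S.QLast_opA s (y τ)) ht)
      have h1 := heq s hs'
      rw [h0, zero_add] at h1
      rw [S.FLast_congr f s t _ (x' := fun j => S.PLast j (y t)), S.FLast_PLast f t _ hs', h1,
        sub_self]
      intro j hj
      have := Finset.mem_Ico.1 hj
      exact (ih (ν - j) (by omega) (by omega) rfl).symm

/-- If the components of order `k` of a solution agree with those of `xS`, then so does the part of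
the derivative of `A x` which comes from them. -/
theorem IsSolutionOn.projY_derivWithin (hy : G.IsSolutionOn f t₀ x₀₁ J y)
    (hS : G.IsAdjComponent f xS) (hJ : ∀ t ∈ J, J ∈ 𝓝[≥] t) {t : ℝ} (ht : t ∈ J) (ht0 : 0 < t)
    (hJ0 : J ⊆ Ici 0) {U : Fin S.n → ℕ → Prop} {k : ℕ}
    (hU : ∀ x, S.projY U (E.opA x) = E.opA (S.PLast k x + S.PWedge k x))
    (hk : ∀ τ ∈ J, 0 < τ →
      S.PLast k (y τ) + S.PWedge k (y τ) = S.PLast k (xS τ) + S.PWedge k (xS τ)) :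
    S.projY U (derivWithin (fun t => E.opA (y t)) J t)
      = E.opA (S.PLast k (derivWithin xS (Ici 0) t) + S.PWedge k (derivWithin xS (Ici 0) t)) := by
  have h1 := S.hasDerivWithinAt_projY (hy.hasDerivWithinAt ht ht0) U
  have h2 := (S.compProjL E.opA fun _ r => r = k).hasFDerivAt.comp_hasDerivWithinAt t
    ((hS.hasDerivWithinAt ht0.le).mono hJ0)
  rw [S.compProjL_apply, ← PLast_add_PWedge] at h2
  refine (uniqueDiffWithinAt_of_mem_nhdsGE (hJ t ht)).eq_deriv J h1
    (h2.congr_of_eventuallyEq ?_ ?_)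
  · filter_upwards [self_mem_nhdsWithin, nhdsWithin_le_nhds (Ioi_mem_nhds ht0)] with τ hτ hτ0
    rw [hU, hk τ hτ hτ0, Function.comp_apply, S.compProjL_apply, PLast_add_PWedge]
  · rw [hU, hk t ht ht0, Function.comp_apply, S.compProjL_apply, PLast_add_PWedge]

/-- The inner components of order `s` are determined by the components of order `s + 1`, which already
agree with those of `xS` on an interval, so that their derivatives agree as well. -/
theorem IsSolutionOn.PWedge_eq (hy : G.IsSolutionOn f t₀ x₀₁ J y) (hstruct : S.HasStructure f)
    (huniq : G.UniqueSolvability f) (hS : G.IsAdjComponent f xS)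
    (hJ : ∀ t ∈ J, J ∈ 𝓝[≥] t) (hJ0 : J ⊆ Ici 0) {s : ℕ} (hs : 1 ≤ s) :
    ∀ t ∈ J, 0 < t → S.PWedge s (y t) = S.PWedge s (xS t) := by
  induction h : ν - s using Nat.strong_induction_on generalizing s with
  | _ k ih =>
    intro t ht ht0
    rcases le_or_gt (ν - 1) s with hνs | hνs
    · rw [S.PWedge_eq_zero hνs, S.PWedge_eq_zero hνs]
    have heq := ((S.equation_iff hstruct ht0.le _ _).1 (hy.equation t ⟨ht, ht0⟩)).2.2.2
    have hMy := (G.mem_M2Sigma_iff.1 (G.mem_M_iff.1 (hy.mem t ht)).2).2.2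
    have hMx := (G.mem_M2Sigma_iff.1 (hS.mem t ht0.le)).2
    have hs' : s ∈ Finset.Ico 1 (ν - 1) := Finset.mem_Ico.2 ⟨hs, hνs⟩
    have hIco : ∀ j ∈ Finset.Ico (s + 1) (ν - 1), j ∈ Finset.Ico 1 (ν - 1) := fun j hj => by
      rw [Finset.mem_Ico] at hj ⊢; omega
    have hl : ∀ τ ∈ J, 0 < τ → ∀ j, 1 ≤ j → S.PLast j (y τ) = S.PLast j (xS τ) :=
      fun τ hτ hτ0 j hj => hy.PLast_eq hstruct huniq hS hJ hτ hτ0 hj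
    refine (huniq.wedge s hs' t ht0.le (fun j => S.PLast j (xS t)) (fun j => S.PWedge j (xS t))
      hMx.1 (fun j hj => hMx.2 j (hIco j hj))
      (S.PLast (s + 1) (derivWithin xS (Ici 0) t)) (S.projD_mem _ _)
      (S.PWedge (s + 1) (derivWithin xS (Ici 0) t)) (S.projD_mem _ _)).unique
      ⟨?_, ?_⟩ ⟨hMx.2 s hs', hS.wedge s hs' t ht0.le⟩
    · have h1 : S.PWedge s (S.projD S.adj (y t)) = S.PWedge s (y t) :=
        S.projD_projD (fun i r _ h => h.1 ▸ hs) _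
      exact h1 ▸ hMy s hs'
    · have h0 := hy.projY_derivWithin hS hJ ht ht0 hJ0 (S.QSigma_opA s) fun τ hτ hτ0 => by
        rw [hl τ hτ hτ0 (s + 1) (by omega), ih (ν - (s + 1)) (by omega) (by omega) rfl τ hτ hτ0]
      have h1 := heq s hs'
      rw [QSigma, h0] at h1
      rw [S.FSigma_congr f s t _ _ _ (x' := fun j => S.PLast j (y t))
        (z' := fun j => S.PWedge j (y t)), S.FSigma_PWedge f t _ _ _ hs', QSigma, ← h1]
      · abel
      · intro j hj
        exact (hl t ht ht0 j (Finset.mem_Ico.1 hj).1).symm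
      · intro j hj
        have := Finset.mem_Ico.1 hj
        exact (ih (ν - j) (by omega) (by omega) rfl t ht ht0).symm

/-- The component `A x₁` of a function `y`. -/
noncomputable def diffComponent (S : RootSystem E ν) (y : ℝ → E.D) (t : ℝ) : S.Y1 :=
  S.Q1.rangeRestrict (E.opA (y t))

theorem coe_diffComponent (t : ℝ) : (diffComponent S y t : Y) = E.opA (S.P1 (y t)) :=
  S.Q1_opA (y t)

/-- For `t > 0` a solution is the state determined by its component `A x₁`: its adjoined components
are those of `xS`, and its component in `ker A` is the unique zero of `F_{20}`. -/
theorem IsSolutionOn.eq_state (hy : G.IsSolutionOn f t₀ x₀₁ J y) (hstruct : S.HasStructure f)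
    (huniq : G.UniqueSolvability f) (hS : G.IsAdjComponent f xS)
    (hη : G.IsEigComponent f T xS η) (hT : ∀ w, T w ∈ S.D1)
    (hTA : ∀ x ∈ S.D1, ∀ w : S.Y1, E.opA x = w → T w = x)
    (hJ : ∀ t ∈ J, J ∈ 𝓝[≥] t) (hJ0 : J ⊆ Ici 0) {t : ℝ} (ht : t ∈ J) (ht0 : 0 < t) :
    y t = state T xS η t (diffComponent S y t) := by
  have hl : ∀ τ ∈ J, 0 < τ → ∀ j, 1 ≤ j → S.PLast j (y τ) = S.PLast j (xS τ) :=
    fun τ hτ hτ0 j hj => hy.PLast_eq hstruct huniq hS hJ hτ hτ0 hj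
  have hw : ∀ τ ∈ J, 0 < τ → ∀ j, 1 ≤ j → S.PWedge j (y τ) = S.PWedge j (xS τ) :=
    fun τ hτ hτ0 j hj => hy.PWedge_eq hstruct huniq hS hJ hJ0 hj τ hτ hτ0
  have hadj : S.projD S.adj (y t) = xS t := by
    rw [← S.mem_spanD_iff.1 (hS.mem_D2Sigma ht0.le), projD_adj_eq_sum, projD_adj_eq_sum,
      Finset.sum_congr rfl fun j hj => hl t ht ht0 j (Finset.mem_Ico.1 hj).1,
      Finset.sum_congr rfl fun j hj => hw t ht ht0 j (Finset.mem_Ico.1 hj).1]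
  have hT1 : T (diffComponent S y t) = S.P1 (y t) :=
    hTA _ ⟨y t, rfl⟩ _ (coe_diffComponent t).symm
  have hdec := S.eq_add_components (y t)
  rw [hadj, ← hT1] at hdec
  have heig : S.projD S.eig (y t) = η t (diffComponent S y t) := by
    refine (huniq.eig t ht0.le _ (hT (diffComponent S y t)) (xS t) (hS.mem t ht0.le)
      (S.PLast 1 (derivWithin xS (Ici 0) t)) (S.projD_mem _ _)
      (S.PWedge 1 (derivWithin xS (Ici 0) t)) (S.projD_mem _ _)).unique
      ⟨(G.mem_M_iff.1 (hy.mem t ht)).1, ?_⟩ (hη t ht0.le _)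
    have heq := ((S.equation_iff hstruct ht0.le _ _).1 (hy.equation t ⟨ht, ht0⟩)).2.1
    have h0 := hy.projY_derivWithin hS hJ ht ht0 hJ0 S.Q20_opA fun τ hτ hτ0 => by
      rw [hl τ hτ hτ0 1 le_rfl, hw τ hτ hτ0 1 le_rfl]
    rw [Q20, h0] at heq
    have h1 : S.Q20 (E.opA (S.PLast 1 (derivWithin xS (Ici 0) t)
        + S.PWedge 1 (derivWithin xS (Ici 0) t)))
        = E.opA (S.PLast 1 (derivWithin xS (Ici 0) t)
          + S.PWedge 1 (derivWithin xS (Ici 0) t)) := by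
      rw [← Q20_opA, Q20, S.projY_projY fun _ _ _ h => h]
    rw [F20, h1, ← hdec, Q20, ← heq]
    abel
  rw [heig] at hdec
  exact hdec

theorem IsSolutionOn.hasDerivWithinAt_diffComponent (hy : G.IsSolutionOn f t₀ x₀₁ J y)
    (hstruct : S.HasStructure f) (hT : ∀ w, T w ∈ S.D1) (hBT : ∀ w, BT w = E.opB (T w))
    (hTA : ∀ x ∈ S.D1, ∀ w : S.Y1, E.opA x = w → T w = x) {t : ℝ} (ht : t ∈ J) (ht0 : 0 < t)
    (hst : y t = state T xS η t (diffComponent S y t)) :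
    HasDerivWithinAt (diffComponent S y) (reducedField f T xS η t (diffComponent S y t)) J t := by
  have h : HasDerivWithinAt (diffComponent S y) _ J t :=
    S.hasDerivWithinAt_Q1 (hy.hasDerivWithinAt ht ht0)
  refine h.congr_deriv (Subtype.ext ?_)
  have heq := ((S.equation_iff hstruct ht0.le _ _).1 (hy.equation t ⟨ht, ht0⟩)).1
  have hT1 : T (diffComponent S y t) = S.P1 (y t) :=
    hTA _ ⟨y t, rfl⟩ _ (coe_diffComponent t).symm
  rw [coe_reducedField hT hBT, ← hst, hBT, hT1, ← heq, add_sub_cancel_right]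
  rfl

/-- For `t₀ = 0` the differential equation is only required for `t > 0`. Its right-hand side is
bounded near `0`, so that `A x₁(t)` has a limit as `t → 0`, which is `A x₁(0)` because `A` is
closed on `D₁`. -/
theorem IsSolutionOn.tendsto_diffComponent [CompleteSpace Y] (hy : G.IsSolutionOn f 0 x₀₁ J y)
    (hbdd : G.Q1Bounded f) (hT : ∀ w, T w ∈ S.D1) (hAT : ∀ w, E.opA (T w) = w)
    (hBT : ∀ w, BT w = E.opB (T w)) (hTA : ∀ x ∈ S.D1, ∀ w : S.Y1, E.opA x = w → T w = x)
    (hJ : ∀ t ∈ J, J ∈ 𝓝[≥] t) (h0J : 0 ∈ J)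
    (hst : ∀ t ∈ J, 0 < t → y t = state T xS η t (diffComponent S y t))
    (hd : ∀ t ∈ J, 0 < t → HasDerivWithinAt (diffComponent S y)
      (reducedField f T xS η t (diffComponent S y t)) J t) :
    Tendsto (diffComponent S y) (𝓝[>] 0) (𝓝 (diffComponent S y 0)) := by
  obtain ⟨b, hb, hbJ⟩ := (mem_nhdsGE_iff_exists_Icc_subset).1 (hJ 0 h0J)
  have hb : 0 < b := hb
  have cP : ContinuousOn (fun t => S.P1 (y t)) J := S.continuous_P1.comp_continuousOn hy.continuousOn
  obtain ⟨C₁, hC₁⟩ := isCompact_Icc.exists_bound_of_continuousOn (cP.mono hbJ)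
  obtain ⟨C, hC⟩ := hbdd b (max C₁ 1) hb (by positivity)
  obtain ⟨w₀, hw₀⟩ := exists_tendsto_nhdsGT_zero (C := C) hb (norm_nonneg BT)
    (fun t ht => (hd t (hbJ (Ioo_subset_Icc_self ht)) ht.1).hasDerivAt
      (mem_of_superset (Icc_mem_nhds ht.1 ht.2) hbJ)) fun t ht => by
    have htb := Ioo_subset_Icc_self ht
    change ‖(reducedField f T xS η t (diffComponent S y t) : Y)‖ ≤ _
    rw [coe_reducedField hT hBT, ← hst t (hbJ htb) ht.1]
    exact (norm_sub_le _ _).trans (add_le_add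
      (hC t htb _ (hy.mem t (hbJ htb)) ((hC₁ t htb).trans (le_max_left _ _))) (BT.le_opNorm _))
  have hlim : Tendsto (fun t => S.P1 (y t)) (𝓝[>] 0) (𝓝 (S.P1 (y 0))) :=
    (cP 0 h0J).tendsto.mono_left ((nhdsWithin_mono 0 Ioi_subset_Ici_self).trans
      (nhdsWithin_le_of_mem (hJ 0 h0J)))
  have hlim' : Tendsto (fun t => S.P1 (y t)) (𝓝[>] 0) (𝓝 (T w₀)) := by
    refine ((T.continuous.tendsto w₀).comp hw₀).congr fun t => ?_
    exact hTA _ ⟨y t, rfl⟩ _ (coe_diffComponent t).symm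
  have : diffComponent S y 0 = w₀ := Subtype.ext <| by
    rw [coe_diffComponent, tendsto_nhds_unique hlim hlim', hAT]
  rwa [this]

/-- Every solution is the state over the solution `w` of the reduced equation with the same initial
value. -/
theorem IsSolutionOn.eqOn_state [CompleteSpace Y] (hy : G.IsSolutionOn f t₀ x₀₁ J y)
    (hstruct : S.HasStructure f)
    (huniq : G.UniqueSolvability f) (hbdd : G.Q1Bounded f) (hS : G.IsAdjComponent f xS)
    (hη : G.IsEigComponent f T xS η) (hT : ∀ w, T w ∈ S.D1) (hAT : ∀ w, E.opA (T w) = w)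
    (hBT : ∀ w, BT w = E.opB (T w)) (hTA : ∀ x ∈ S.D1, ∀ w : S.Y1, E.opA x = w → T w = x)
    (cη : ContinuousOn (Function.uncurry η) (Ici 0 ×ˢ univ))
    (hlip : LocallyLipschitzField (reducedField f T xS η))
    (hcont : ContinuousOn (Function.uncurry (reducedField f T xS η)) (Ici 0 ×ˢ univ))
    (ht₀ : 0 ≤ t₀) (ht₀J : t₀ ∈ J) (hJt₀ : J ⊆ Ici t₀) (hJ : ∀ t ∈ J, J ∈ 𝓝[≥] t)
    (hJc : J.OrdConnected) {w : ℝ → S.Y1} (hw₀ : T (w t₀) = x₀₁)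
    (hw : ∀ t, t₀ ≤ t → HasDerivWithinAt w (reducedField f T xS η t (w t)) (Ici t₀) t) :
    EqOn y (fun t => state T xS η t (w t)) J := by
  have hJ0 : J ⊆ Ici 0 := hJt₀.trans (Ici_subset_Ici.2 ht₀)
  have hst : ∀ t ∈ J, 0 < t → y t = state T xS η t (diffComponent S y t) := fun t ht ht0 =>
    hy.eq_state hstruct huniq hS hη hT hTA hJ hJ0 ht ht0
  have hd : ∀ t ∈ J, 0 < t → HasDerivWithinAt (diffComponent S y)
      (reducedField f T xS η t (diffComponent S y t)) J t := fun t ht ht0 =>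
    hy.hasDerivWithinAt_diffComponent hstruct hT hBT hTA ht ht0 (hst t ht ht0)
  have hinit : diffComponent S y t₀ = w t₀ := Subtype.ext <| by
    rw [coe_diffComponent, hy.initial, ← hw₀, hAT]
  have hGE : ∀ t ∈ J, 0 < t → HasDerivWithinAt (diffComponent S y)
      (reducedField f T xS η t (diffComponent S y t)) (Ici t) t := fun t ht ht0 =>
    (hd t ht ht0).mono_of_mem_nhdsWithin (hJ t ht)
  have hwc : ContinuousOn w (Ici t₀) := fun t ht => (hw t ht).continuousWithinAt
  have hwGE : ∀ t, t₀ ≤ t → HasDerivWithinAt w (reducedField f T xS η t (w t)) (Ici t) t :=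
    fun t ht => (hw t ht).mono (Ici_subset_Ici.2 ht)
  have hzero : t₀ = 0 → ContinuousWithinAt (diffComponent S y) (Ici t₀) t₀ ∧
      HasDerivWithinAt (diffComponent S y) (reducedField f T xS η t₀ (diffComponent S y t₀))
        (Ici t₀) t₀ := by
    rintro rfl
    have hlim := hy.tendsto_diffComponent hbdd hT hAT hBT hTA hJ ht₀J hst hd
    have hlim' : ContinuousWithinAt (diffComponent S y) (Ioi 0) 0 := hlim
    obtain ⟨b, hb, hbJ⟩ := (mem_nhdsGE_iff_exists_Icc_subset).1 (hJ 0 ht₀J)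
    have hb : 0 < b := hb
    have hda : ∀ t ∈ Ioo 0 b, HasDerivAt (diffComponent S y)
        (reducedField f T xS η t (diffComponent S y t)) t := fun t ht =>
      (hd t (hbJ (Ioo_subset_Icc_self ht)) ht.1).hasDerivAt
        (mem_of_superset (Icc_mem_nhds ht.1 ht.2) hbJ)
    refine ⟨continuousWithinAt_Ioi_iff_Ici.1 hlim', ?_⟩
    refine hasDerivWithinAt_Ici_of_tendsto_deriv (s := Ioo 0 b)
      (fun t ht => (hda t ht).differentiableAt.differentiableWithinAt)
      (hlim'.mono Ioo_subset_Ioi_self) (Ioo_mem_nhdsGT hb) ?_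
    have h1 : Tendsto (fun t => (t, diffComponent S y t)) (𝓝[>] 0)
        (𝓝[Ici 0 ×ˢ univ] (0, diffComponent S y 0)) :=
      tendsto_nhdsWithin_iff.2 ⟨(tendsto_nhdsWithin_of_tendsto_nhds tendsto_id).prodMk_nhds hlim, by
        filter_upwards [self_mem_nhdsWithin] with t ht using ⟨Ioi_subset_Ici_self ht, mem_univ _⟩⟩
    refine ((hcont (0, diffComponent S y 0) ⟨self_mem_Ici, mem_univ _⟩).tendsto.comp h1).congr' ?_
    filter_upwards [Ioo_mem_nhdsGT hb] with t ht using (hda t ht).deriv.symm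
  have heq : ∀ t ∈ J, diffComponent S y t = w t := by
    intro t ht
    have hsub : Icc t₀ t ⊆ J := hJc.out ht₀J ht
    refine hlip.eqOn_Icc ht₀ (fun s hs => ?_) (fun s hs => ?_)
      (hwc.mono Icc_subset_Ici_self) (fun s hs => hwGE s hs.1) hinit (right_mem_Icc.2 (hJt₀ ht))
    · rcases (ht₀.trans hs.1).eq_or_lt with h | h
      · have h0 : t₀ = 0 := le_antisymm (h ▸ hs.1) ht₀
        have hs0 : s = t₀ := h.symm.trans h0.symm
        exact hs0 ▸ (hzero h0).1.mono Icc_subset_Ici_self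
      · exact (hd s (hsub hs) h).continuousWithinAt.mono hsub
    · rcases (ht₀.trans hs.1).eq_or_lt with h | h
      · have h0 : t₀ = 0 := le_antisymm (h ▸ hs.1) ht₀
        have hs0 : s = t₀ := h.symm.trans h0.symm
        exact hs0 ▸ (hzero h0).2
      · exact hGE s (hsub (Ico_subset_Icc_self hs)) h
  have hpos : ∀ t ∈ J, 0 < t → y t = state T xS η t (w t) := fun t ht ht0 => by
    rw [← heq t ht]; exact hst t ht ht0
  intro t ht
  rcases (mem_Ici.1 (hJ0 ht)).eq_or_lt with h | h
  · -- both sides are continuous at `0` and agree for positive times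
    subst h
    have h0 : t₀ = 0 := le_antisymm (hJt₀ ht) ht₀
    subst h0
    have hle : 𝓝[>] (0 : ℝ) ≤ 𝓝[J] 0 := (nhdsWithin_mono 0 Ioi_subset_Ici_self).trans
      (nhdsWithin_le_of_mem (hJ 0 ht))
    have c2 : ContinuousOn (fun t => state T xS η t (w t)) (Ici 0) :=
      (continuousOn_state hS cη).comp (continuousOn_id.prodMk hwc) fun t ht => ⟨ht, mem_univ _⟩
    refine tendsto_nhds_unique ((hy.continuousOn 0 ht).tendsto.mono_left hle)
      (((c2 0 self_mem_Ici).tendsto.mono_left (nhdsWithin_mono 0 Ioi_subset_Ici_self)).congr' ?_)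
    filter_upwards [self_mem_nhdsWithin, hle self_mem_nhdsWithin] with s hs hsJ
      using (hpos s hsJ hs).symm
  · exact hpos t ht h

end Regions

end RootSystem

end Uniqueness

end ADAE

theorem mainTheorem8 {𝕜 X Y : Type*} [RCLike 𝕜]
    [NormedAddCommGroup X] [NormedSpace 𝕜 X] [NormedSpace ℝ X] [IsScalarTower ℝ 𝕜 X]
    [CompleteSpace X]
    [NormedAddCommGroup Y] [NormedSpace 𝕜 Y] [NormedSpace ℝ Y] [IsScalarTower ℝ 𝕜 Y]
    [CompleteSpace Y]
    (E : ADAE.OperatorPair 𝕜 X Y) (ν : ℕ) (hE : E.IsRegularOfIndex ν)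
    (S : ADAE.RootSystem E ν) (G : S.Regions) (f : ℝ → E.D → Y)
    (hf : ContinuousOn (fun z : ℝ × E.D => f z.1 z.2) (Ici 0 ×ˢ univ))
    (hstruct : S.HasStructure f)
    (hsmooth : G.Smoothness f)
    (huniq : G.UniqueSolvability f)
    (hinv : G.Invertibility f)
    (h2e : G.LipschitzCondition f ∨ G.SmoothCondition f)
    (hbdd : G.Q1Bounded f)
    (hV : G.LyapunovMax f ∨ G.LyapunovLipschitz f) :
    ∀ t₀ : ℝ, 0 ≤ t₀ → ∀ x₀₁ ∈ S.D1,
      ∃ x : ℝ → E.D, G.IsSolutionOn f t₀ x₀₁ (Ici t₀) x ∧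
        ∀ J : Set ℝ, (J = Ici t₀ ∨ ∃ T, t₀ < T ∧ J = Ico t₀ T) →
          ∀ y : ℝ → E.D, G.IsSolutionOn f t₀ x₀₁ J y → EqOn y x J := by
  have hLip : G.EigContraction f ∧ G.LocallyLipschitz (fun t x => S.Q1 (f t x)) ∧
      G.LocallyLipschitz (fun t x => S.Q20 (f t x)) := by
    rcases h2e with h | h
    · exact ⟨h.eigContraction, h.lipschitz_Q1, h.lipschitz_Q20⟩
    · exact ⟨h.eigContraction,
        ADAE.RootSystem.Regions.locallyLipschitz_of_continuous_fderiv h.diff_Q1 h.cont_Q1,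
        ADAE.RootSystem.Regions.locallyLipschitz_of_continuous_fderiv h.diff_Q20 h.cont_Q20⟩
  obtain ⟨hc, hL1, hL20⟩ := hLip
  obtain ⟨T, BT, hT, hAT, hBT, hTA⟩ := S.exists_inverse hE
  obtain ⟨xS, hS⟩ := ADAE.RootSystem.Regions.exists_isAdjComponent hsmooth huniq hinv
  obtain ⟨η, hη⟩ := ADAE.RootSystem.Regions.exists_isEigComponent huniq hT hS
  have cη := hη.continuousOn hf huniq hc hT hS
  have hlip := ADAE.RootSystem.Regions.locallyLipschitzField_reducedField hη hc hL1 hL20 hT hBT hS cη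
  have hcont := ADAE.RootSystem.Regions.continuousOn_reducedField hT hBT hf hS cη
  intro t₀ ht₀ x₀₁ hx₀₁
  obtain ⟨w, hw₀, hw⟩ := ADAE.RootSystem.Regions.exists_reduced_solution hη hlip hcont hbdd hV hT
    hAT hBT hS ht₀ ⟨E.opA x₀₁, S.opA_mem_Y1 hx₀₁⟩
  have hTw₀ : T (w t₀) = x₀₁ := hTA _ hx₀₁ _ (by rw [hw₀])
  refine ⟨_, ADAE.RootSystem.Regions.isSolutionOn_state hstruct hη cη hcont hT hAT hBT hS ht₀ hTw₀
    hw, fun J hJ y hy => ?_⟩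
  obtain ⟨h1, h2, h3, h4⟩ : t₀ ∈ J ∧ J ⊆ Ici t₀ ∧ (∀ t ∈ J, J ∈ 𝓝[≥] t) ∧ J.OrdConnected := by
    rcases hJ with rfl | ⟨b, hb, rfl⟩
    · exact ⟨self_mem_Ici, subset_rfl, fun t ht =>
        mem_of_superset self_mem_nhdsWithin (Ici_subset_Ici.2 ht), ordConnected_Ici⟩
    · exact ⟨left_mem_Ico.2 hb, Ico_subset_Ici_self, fun t ht =>
        mem_of_superset (Ico_mem_nhdsGE ht.2) (Ico_subset_Ico_left ht.1), ordConnected_Ico⟩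
  exact hy.eqOn_state hstruct huniq hbdd hS hη hT hAT hBT hTA cη hlip hcont ht₀ h1 h2 h3 h4 hTw₀ hw
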